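/- **Setting.** Let $m,p\in\mathbb{N}_0$, $a_i\in\mathbb{R}$, $\alpha_i>0$ with $a_i+\alpha_i>0$ ($i=1,\dots,p$), and $b_j\in\mathbb{R}$, $\beta_j>0$ with $b_j+\beta_j>0$ ($j=1,\dots,m$). Put $a^*=\sum_j\beta_j-\sum_i\alpha_i$ and $\mu=\sum_j b_j-\sum_i a_i+\frac{p-m}{2}$, and assume that either $a^*>0$, or $a^*=0$ and $\mu<-1$. For $\tau>0$ let $$H^{m,0}_{p,m}(\tau)=\frac{1}{2\pi \mathrm{i}}\int_{\gamma-\mathrm{i}\infty}^{\gamma+\mathrm{i}\infty}\frac{\prod_{j=1}^m\Gamma(b_j+\beta_j s)}{\prod_{i=1}^p\Gamma(a_i+\alpha_i s)}\,\tau^{-s}\,\mathrm{d}s ,$$ where the line $\operatorname{Re}s=\gamma$ lies to the right of all the points $-(b_j+l)/\beta_j$, $l\in\mathbb{N}_0$, and assume that $H^{m,0}_{p,m}\ge 0$ on $(0,\infty)$. Let $$K=\frac{\prod_{j=1}^m\Gamma(b_j+\beta_j)}{\prod_{i=1}^p\Gamma(a_i+\alpha_i)},\qquad {}_m\Psi_p(z)=\sum_{k\ge0}\frac{\prod_{j=1}^m\Gamma(b_j+\beta_j+\beta_jk)}{\prod_{i=1}^p\Gamma(a_i+\alpha_i+\alpha_ik)}\frac{z^k}{k!};$$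 where this series does not converge absolutely (possible only for $a^*\ge1$), ${}_m\Psi_p(z)$ is understood, for $z<0$, as the Fox-$H$ function $$\frac1{2\pi \mathrm{i}}\int_{\gamma-\mathrm{i}\infty}^{\gamma+\mathrm{i}\infty}\Gamma(s)\frac{\prod_{j=1}^m\Gamma(b_j+\beta_j-\beta_js)}{\prod_{i=1}^p\Gamma(a_i+\alpha_i-\alpha_is)}(-z)^{-s}\,\mathrm{d}s,\qquad 0<\gamma<\min_j\frac{b_j+\beta_j}{\beta_j}.$$ Let $\mu_\Psi$ be the probability measure on the space $\mathcal{S}'(\mathbb{R})$ of real tempered distributions, with its cylinder $\sigma$-algebra, such that $\int \mathrm{e}^{\mathrm{i}\langle\omega,\varphi\rangle}\,\mathrm{d}\mu_\Psi(\omega)=\frac1K\,{}_m\Psi_p\bigl(-\tfrac12\int_{\mathbb{R}}\varphi(x)^2\,\mathrm{d}x\bigr)$ for all real Schwartz functions $\varphi$. For $f\in L^2(\mathbb{R})$ let $\langle\cdot,f\rangle$ be the $L^2(\mu_\Psi)$-limit of $\langle\cdot,\varphi_k\rangle$ for Schwartz functions $\varphi_k\to f$ in $L^2(\mathbb{R})$.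 For $H\in(0,1)$ let $$M^H_-f=\begin{cases}K_H\,D_-^{1/2-H}f,& H<1/2,\\ f,& H=1/2,\\ K_H\,I_-^{H-1/2}f,& H>1/2,\end{cases}\qquad K_H=\Gamma(H+\tfrac12)\Bigl(\int_0^\infty\bigl((1+s)^{H-1/2}-s^{H-1/2}\bigr)^2\mathrm{d}s+\tfrac1{2H}\Bigr)^{-1/2},$$ with the right-sided Riemann–Liouville operators $I^\sigma_-f(x)=\frac1{\Gamma(\sigma)}\int_x^\infty f(t)(t-x)^{\sigma-1}\,\mathrm{d}t$ and $D^\sigma_-f(x)=-\frac1{\Gamma(1-\sigma)}\frac{\mathrm{d}}{\mathrm{d}x}\int_x^\infty f(t)(t-x)^{-\sigma}\,\mathrm{d}t$. The generalized Fox-$H$ process is $X_t=\langle\cdot,M^H_-\mathbf 1_{[0,t)}\rangle$ ($\mu_\Psi$-a.s.), $t\ge0$; expectations are with respect to $\mu_\Psi$. **Proposition.** The following hold. 1. For $n\in\mathbb{N}$, $0<t_1<\dots<t_n$ and $\lambda\in\mathbb{R}^n$, $$\mathbb{E}\Bigl[\mathrm{e}^{\mathrm{i}\sum_l\lambda_lX_{t_l}}\Bigr]=\frac1K\,{}_m\Psi_p\Bigl(-\frac{(\lambda,\Sigma_{H,n}\lambda)}2\Bigr),\qquad(\Sigma_{H,n})_{l,k}=\tfrac12\bigl(|t_l|^{2H}+|t_k|^{2H}-|t_l-t_k|^{2H}\bigr).$$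 2. For $n\in\mathbb{N}$ and $0<t_1<\dots<t_n$, let $\varrho_{B^H}(x)=(2\pi)^{-n/2}\det(\Sigma_{H,n})^{-1/2}\exp\bigl(-\frac12(x,\Sigma_{H,n}^{-1}x)\bigr)$ be the joint density of fractional Brownian motion at $t_1,\dots,t_n$. Then $(X_{t_1},\dots,X_{t_n})$ has, with respect to Lebesgue measure on $\mathbb{R}^n$, the density $$\varrho_X(x)=\frac1K\int_0^\infty\tau^{-n/2}\,\varrho_{B^H}\bigl(x/\sqrt\tau\bigr)\,H^{m,0}_{p,m}(\tau)\,\mathrm{d}\tau ,$$ where the integral converges for every $x\ne0$. 3. For every $t\ge0$ all moments of $X_t$ are finite, and for $n\in\mathbb{N}_0$ $$\mathbb{E}[X_t^{2n+1}]=0,\qquad \mathbb{E}[X_t^{2n}]=\frac1K\,\frac{\prod_{j=1}^m\Gamma(b_j+\beta_j(n+1))}{\prod_{i=1}^p\Gamma(a_i+\alpha_i(n+1))}\,\frac{(2n)!}{n!\,2^n}\,t^{2nH}.$$ 4. For $t,s\ge0$ the product $X_tX_s$ is integrable and $$\mathbb{E}[X_tX_s]=\frac1{2K}\,\frac{\prod_{j=1}^m\Gamma(b_j+2\beta_j)}{\prod_{i=1}^p\Gamma(a_i+2\alpha_i)}\bigl(t^{2H}+s^{2H}-|t-s|^{2H}\bigr).$$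 -/

import Mathlib

open MeasureTheory Filter Topology Set
open scoped SchwartzMap Matrix ENNReal Nat

noncomputable section

/-! ### Fox-H functions and generalized Wright functions -/

/-- The Mellin-Barnes kernel `𝓗^{m,n}_{p,q}(s)` with upper parameters `(a_i, α_i)`, `i < p`, and
lower parameters `(b_j, β_j)`, `j < q`. -/
def foxHKernel (m n : ℕ) {p q : ℕ} (a : Fin p → ℂ) (α : Fin p → ℝ) (b : Fin q → ℂ)
    (β : Fin q → ℝ) (s : ℂ) : ℂ :=
  ((∏ j : Fin q with j.val < m, Complex.Gamma (b j + s * β j)) *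
      ∏ i : Fin p with i.val < n, Complex.Gamma (1 - a i - s * α i)) /
    ((∏ i : Fin p with n ≤ i.val, Complex.Gamma (a i + s * α i)) *
      ∏ j : Fin q with m ≤ j.val, Complex.Gamma (1 - b j - s * β j))

/-- The vertical line `Re s = γ` has all poles `-(b_j + l) / β_j` (`j < m`, `l = 0, 1, …`) on its
left and all poles `(1 - a_i + k) / α_i` (`i < n`, `k = 0, 1, …`) on its right. -/
def SeparatesPoles (m n : ℕ) {p q : ℕ} (a : Fin p → ℂ) (α : Fin p → ℝ) (b : Fin q → ℂ)
    (β : Fin q → ℝ) (γ : ℝ) : Prop :=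
  (∀ j : Fin q, j.val < m → ∀ l : ℕ, (-(b j + l) / (β j : ℂ)).re < γ) ∧
    ∀ i : Fin p, i.val < n → ∀ k : ℕ, γ < ((1 - a i + k) / (α i : ℂ)).re

/-- The integral `(1 / 2πi) ∫ 𝓗(s) z^{-s} ds` along the line from `γ - i∞` to `γ + i∞`, with the
parametrization `s = γ + i y`. -/
def mellinBarnes (m n : ℕ) {p q : ℕ} (a : Fin p → ℂ) (α : Fin p → ℝ) (b : Fin q → ℂ)
    (β : Fin q → ℝ) (γ : ℝ) (z : ℂ) : ℂ :=
  1 / (2 * Real.pi : ℂ) *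
    ∫ y : ℝ, foxHKernel m n a α b β (γ + y * Complex.I) * z ^ (-(γ + y * Complex.I : ℂ))

open Classical in
/-- The Fox-H function `H^{m,n}_{p,q}(z)`, `z ≠ 0`, with a vertical contour that separates the two
families of poles. By Cauchy's theorem the value does not depend on the choice of the line. For the
two families of Fox-H functions used below (`n = 0`, `q = m`, and the one in `genWright`) such a
vertical line exists and the integral converges absolutely for positive `z`. -/
def foxH (m n : ℕ) {p q : ℕ} (a : Fin p → ℂ) (α : Fin p → ℝ) (b : Fin q → ℂ)
    (β : Fin q → ℝ) (z : ℂ) : ℂ :=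
  if h : ∃ γ : ℝ, SeparatesPoles m n a α b β γ then mellinBarnes m n a α b β h.choose z else 0

/-- The `k`-th term of the power series of the generalized Wright function. -/
def genWrightTerm {m p : ℕ} (A : Fin m → ℂ) (α : Fin m → ℝ) (B : Fin p → ℂ) (β : Fin p → ℝ)
    (z : ℂ) (k : ℕ) : ℂ :=
  (∏ i, Complex.Gamma (A i + α i * k)) / (∏ j, Complex.Gamma (B j + β j * k)) * (z ^ k / (k ! : ℂ))

open Classical in
/-- The generalized Wright function `_mΨ_p[(A_i, α_i)_{1,m}; (B_j, β_j)_{1,p} | z]`: the sum of its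
power series where the series converges absolutely (everywhere if `∑ α_i - ∑ β_j < 1`), and its
representation `H^{1,m}_{m,p+1}[-z | (1 - A_i, α_i); (0, 1), (1 - B_j, β_j)]` as a Fox-H function
elsewhere. -/
def genWright {m p : ℕ} (A : Fin m → ℂ) (α : Fin m → ℝ) (B : Fin p → ℂ) (β : Fin p → ℝ)
    (z : ℂ) : ℂ :=
  if Summable (genWrightTerm A α B β z) then ∑' k, genWrightTerm A α B β z k
  else foxH 1 m (fun i => 1 - A i) α (Fin.cons 0 (fun j => 1 - B j) : Fin (p + 1) → ℂ)
    (Fin.cons 1 β : Fin (p + 1) → ℝ) (-z)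

/-! ### Fox-H densities with all moments -/

/-- `H^{m,0}_{p,m}[τ | (a_i, α_i)_{1,p}; (b_j, β_j)_{1,m}]` for real parameters and `τ > 0`. The
complex integral is then real, and we read it as a real number. -/
def foxHReal {m p : ℕ} (a α : Fin p → ℝ) (b β : Fin m → ℝ) (τ : ℝ) : ℝ :=
  (foxH m 0 (fun i => (a i : ℂ)) α (fun j => (b j : ℂ)) β (τ : ℂ)).re

/-- The number `a^*` for `n = 0` and `q = m`. -/
def aStar {m p : ℕ} (α : Fin p → ℝ) (β : Fin m → ℝ) : ℝ := ∑ j, β j - ∑ i, α i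

/-- The number `μ = ∑ b_j - ∑ a_i + (p - q) / 2` for `q = m`. -/
def muIndex {m p : ℕ} (a : Fin p → ℝ) (b : Fin m → ℝ) : ℝ :=
  ∑ j, b j - ∑ i, a i + ((p : ℝ) - (m : ℝ)) / 2

/-- The standing assumptions on the parameters of a Fox-H density with all moments. -/
structure FoxHAssumption {m p : ℕ} (a α : Fin p → ℝ) (b β : Fin m → ℝ) : Prop where
  alpha_pos : ∀ i, 0 < α i
  a_add_alpha_pos : ∀ i, 0 < a i + α i
  beta_pos : ∀ j, 0 < β j
  b_add_beta_pos : ∀ j, 0 < b j + β j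
  aStar_cond : 0 < aStar α β ∨ (aStar α β = 0 ∧ muIndex a b < -1)
  foxH_nonneg : ∀ τ : ℝ, 0 < τ → 0 ≤ foxHReal a α b β τ

/-- The Gamma quotient `∏ Γ(b_j + β_j (l + 1)) / ∏ Γ(a_i + α_i (l + 1))`. -/
def gammaRatio {m p : ℕ} (a α : Fin p → ℝ) (b β : Fin m → ℝ) (l : ℕ) : ℝ :=
  (∏ j, Real.Gamma (b j + β j * (l + 1))) / ∏ i, Real.Gamma (a i + α i * (l + 1))

/-- The normalizing constant `K = ∏ Γ(b_j + β_j) / ∏ Γ(a_i + α_i)`. -/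
def normConst {m p : ℕ} (a α : Fin p → ℝ) (b β : Fin m → ℝ) : ℝ :=
  (∏ j, Real.Gamma (b j + β j)) / ∏ i, Real.Gamma (a i + α i)

/-- `_mΨ_p[(b_j + β_j, β_j)_{1,m}; (a_i + α_i, α_i)_{1,p} | z]`. -/
def wrightPsi {m p : ℕ} (a α : Fin p → ℝ) (b β : Fin m → ℝ) (z : ℂ) : ℂ :=
  genWright (fun j => ((b j + β j : ℝ) : ℂ)) β (fun i => ((a i + α i : ℝ) : ℂ)) α z

/-! ### The generalized Fox-H measure on the space of real tempered distributions -/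

/-- The space `𝓢'(ℝ)` of real tempered distributions. -/
abbrev RealTempered : Type := 𝓢(ℝ, ℝ) →L[ℝ] ℝ

/-- The cylinder σ-algebra on `𝓢'(ℝ)`, generated by the maps `ω ↦ ⟨ω, ξ⟩`. -/
instance cylinderSigma : MeasurableSpace RealTempered :=
  ⨆ ξ : 𝓢(ℝ, ℝ), MeasurableSpace.comap (fun ω : RealTempered => ω ξ) (borel ℝ)

/-- `μ` is the generalized Fox-H measure `μ_Ψ`: the probability measure on `𝓢'(ℝ)` with
characteristic functional `ξ ↦ (1 / K) _mΨ_p(-⟨ξ, ξ⟩ / 2)`. -/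
structure IsFoxHMeasure {m p : ℕ} (a α : Fin p → ℝ) (b β : Fin m → ℝ)
    (μ : Measure RealTempered) : Prop where
  isProbabilityMeasure : IsProbabilityMeasure μ
  charFunctional : ∀ ξ : 𝓢(ℝ, ℝ),
    ∫ ω, Complex.exp (Complex.I * (ω ξ : ℂ)) ∂μ =
      1 / (normConst a α b β : ℂ) * wrightPsi a α b β (((-(∫ x, ξ x ^ 2) / 2 : ℝ)) : ℂ)

/-- `Y` is the `L²(μ)`-limit of `⟨·, ξ_k⟩` for a sequence of Schwartz functions `ξ_k` that converges
to `f` in `L²(ℝ)`. -/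
def IsL2Pairing (μ : Measure RealTempered) (f : ℝ → ℝ) (Y : RealTempered → ℝ) : Prop :=
  MemLp Y 2 μ ∧ ∃ ξ : ℕ → 𝓢(ℝ, ℝ),
    Tendsto (fun k => eLpNorm (fun x => ξ k x - f x) 2 volume) atTop (𝓝 0) ∧
      Tendsto (fun k => eLpNorm (fun ω : RealTempered => ω (ξ k) - Y ω) 2 μ) atTop (𝓝 0)

open Classical in
/-- The extended dual pairing `ω ↦ ⟨ω, f⟩`, `f ∈ L²(ℝ)`, determined up to `μ`-null sets. -/
def l2Pairing (μ : Measure RealTempered) (f : ℝ → ℝ) : RealTempered → ℝ :=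
  if h : ∃ Y, IsL2Pairing μ f Y then h.choose else 0

/-! ### Fractional operators and the generalized Fox-H process -/

/-- The right-sided Riemann-Liouville fractional integral `I^σ_- f`. -/
def rlIntegralMinus (σ : ℝ) (f : ℝ → ℝ) (x : ℝ) : ℝ :=
  1 / Real.Gamma σ * ∫ t in Ioi x, f t * (t - x) ^ (σ - 1)

/-- The right-sided Riemann-Liouville fractional derivative `D^σ_- f`. -/
def rlDerivMinus (σ : ℝ) (f : ℝ → ℝ) (x : ℝ) : ℝ :=
  -(1 / Real.Gamma (1 - σ)) * deriv (fun y => ∫ t in Ioi y, f t * (t - y) ^ (-σ)) x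

/-- The constant `K_H`. -/
def fracConst (H : ℝ) : ℝ :=
  Real.Gamma (H + 1 / 2) *
    ((∫ s in Ioi (0 : ℝ), ((1 + s) ^ (H - 1 / 2) - s ^ (H - 1 / 2)) ^ 2) + 1 / (2 * H)) ^
      (-(1 / 2) : ℝ)

/-- The operator `M^H_-`. -/
def fracOpMinus (H : ℝ) (f : ℝ → ℝ) (x : ℝ) : ℝ :=
  if H < 1 / 2 then fracConst H * rlDerivMinus (-(H - 1 / 2)) f x
  else if H = 1 / 2 then f x
  else fracConst H * rlIntegralMinus (H - 1 / 2) f x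

/-- `X` is (a version of) the generalized Fox-H process with Hurst parameter `H` under `μ`:
`X_t(ω) = ⟨ω, M^H_- 1_{[0,t)}⟩` for `μ`-almost all `ω`, for every `t ≥ 0`. -/
def IsFoxHProcess (μ : Measure RealTempered) (H : ℝ) (X : ℝ → RealTempered → ℝ) : Prop :=
  ∀ t : ℝ, 0 ≤ t → X t =ᵐ[μ] l2Pairing μ (fracOpMinus H ((Ico 0 t).indicator fun _ => 1))

/-- The covariance matrix of fractional Brownian motion at the times `t_1, …, t_n`. -/
def fbmCov (H : ℝ) {n : ℕ} (t : Fin n → ℝ) : Matrix (Fin n) (Fin n) ℝ :=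
  Matrix.of fun l k =>
    1 / 2 * (|t l| ^ (2 * H) + |t k| ^ (2 * H) - |t l - t k| ^ (2 * H))

/-- The joint density of fractional Brownian motion at the times `t_1, …, t_n`. -/
def fbmDensity (H : ℝ) {n : ℕ} (t : Fin n → ℝ) (x : Fin n → ℝ) : ℝ :=
  1 / ((2 * Real.pi) ^ ((n : ℝ) / 2) * (fbmCov H t).det ^ (1 / 2 : ℝ)) *
    Real.exp (-(x ⬝ᵥ (fbmCov H t)⁻¹ *ᵥ x) / 2)

/-- The integrand of the mixture, `τ^{-n/2} ϱ_{B^H}(x / √τ) H^{m,0}_{p,m}(τ)`. -/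
def mixtureIntegrand {m p : ℕ} (a α : Fin p → ℝ) (b β : Fin m → ℝ) (H : ℝ) {n : ℕ}
    (t : Fin n → ℝ) (x : Fin n → ℝ) (τ : ℝ) : ℝ :=
  1 / τ ^ ((n : ℝ) / 2) * fbmDensity H t (fun i => x i / Real.sqrt τ) * foxHReal a α b β τ

end

noncomputable section

/-! ### Growth of the Gamma function along vertical lines -/

/-! The process is a Gaussian scale mixture. Let ν be the measure on (0, ∞) with density
H^{m,0}_{p,m}(τ) / K (`mixingMeasure`). Nonnegativity of the Fox-H function makes ν a positive
measure, and the heart of the proof is the identity (1/K) Ψ(-u) = ∫ e^{-uτ} dν(τ) for u ≥ 0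
(`wrightPsi_eq_laplace`). Hence ⟨·, φ⟩ has the law of √τ ‖φ‖ z with τ ∼ ν and z standard Gaussian,
independent, and all four claims are Gaussian facts averaged over τ.

For the Laplace identity one needs the Mellin transform of the Fox-H function, which is its Gamma
quotient (`mellin_foxHReal`). This is Fourier inversion after τ = e^{-u}. It rests on integrability
of the quotient on vertical lines and on moving those lines, hence on |Γ(σ + it)| being comparable
to |t|^{σ-1/2} e^{-π|t|/2} uniformly on strips. That estimate is exact up to constants at σ = 1/2 by
reflection, passes to other half-integers by the recurrence, and is interpolated by convexity in σ
of log(Γ(σ) / |Γ(σ + it)|). The moments of ν are then Gamma quotients. Where the Wright series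
converges absolutely, e^{-uτ} is expanded and integrated term by term. Otherwise the complex moments
of ν are inserted into the Mellin-Barnes integral, and Fubini reduces it to Mellin inversion of
e^{-x}.

The second moment of the mixture shows that φ ↦ ⟨·, φ⟩ is, up to a constant factor, an isometry into
L²(μ), so it extends to L²(ℝ) with the same form of characteristic function. The function M^H_-
1_{[0,t)} is a.e. the normalized Mandelbrot-Van Ness kernel (`fracOpMinus_indicator`). Translation
and scaling give the squared norm |t - s|^{2H} for differences of kernels (`mvnKernel_sub_sq`), so
Σ_{H,n} is their Gram matrix. Positive definiteness of this matrix and uniqueness of characteristic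
functions give the density; moments factor, and covariances follow by polarization. -/

lemma convexOn_log_one_add_div (t : ℝ) :
    ConvexOn ℝ (Ioi 0) (fun x : ℝ => Real.log (x ^ 2 + t ^ 2) - 2 * Real.log x) := by
  have hd : ∀ x : ℝ, 0 < x → HasDerivAt (fun x : ℝ => Real.log (x ^ 2 + t ^ 2) - 2 * Real.log x)
      (-(2 * t ^ 2 / (x * (x ^ 2 + t ^ 2)))) x := by
    intro x hx
    have hp : 0 < x ^ 2 + t ^ 2 := by positivity
    have h1 := (((hasDerivAt_id x).pow 2).add_const (t ^ 2)).log hp.ne'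
    have h2 := (Real.hasDerivAt_log hx.ne').const_mul 2
    refine (h1.sub h2).congr_deriv ?_
    simp only [id, Pi.pow_apply]
    field_simp
    ring
  refine MonotoneOn.convexOn_of_deriv (convex_Ioi 0)
    (fun x hx => (hd x hx).continuousAt.continuousWithinAt)
    (fun x hx => ((hd x (interior_subset hx)).differentiableAt).differentiableWithinAt) ?_
  rw [interior_Ioi]
  intro x hx y hy hxy
  have hx' : 0 < x := hx
  have hy' : 0 < y := hy
  rw [(hd x hx).deriv, (hd y hy).deriv]
  apply neg_le_neg
  gcongr

/-- The logarithm of `Γ(σ) / |Γ(σ + i t)|`. -/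
def logGammaQuot (t σ : ℝ) : ℝ :=
  Real.log (Real.Gamma σ) - Real.log ‖Complex.Gamma (σ + t * Complex.I)‖

lemma norm_add_mul_I_sq (x t : ℝ) : ‖(x + t * Complex.I : ℂ)‖ ^ 2 = x ^ 2 + t ^ 2 := by
  rw [Complex.sq_norm, Complex.normSq_add_mul_I]

lemma log_norm_add_mul_I (x t : ℝ) :
    Real.log ‖(x + t * Complex.I : ℂ)‖ = Real.log (x ^ 2 + t ^ 2) / 2 := by
  rw [← norm_add_mul_I_sq, Real.log_pow]
  push_cast; ring

lemma log_gammaSeq_quot {σ : ℝ} (hσ : 0 < σ) (t : ℝ) {n : ℕ} (hn : n ≠ 0) :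
    Real.log (Real.GammaSeq σ n) - Real.log ‖Complex.GammaSeq (σ + t * Complex.I) n‖ =
      ∑ j ∈ Finset.range (n + 1),
        (Real.log ((σ + j) ^ 2 + t ^ 2) - 2 * Real.log (σ + j)) / 2 := by
  have hn' : (0 : ℝ) < n := by positivity
  have hp : ∀ j : ℕ, 0 < σ + j := fun j => by positivity
  have hq : ∀ j : ℕ, (σ + t * Complex.I + j : ℂ) = ((σ + j : ℝ) : ℂ) + t * Complex.I := by
    intro j; push_cast; ring
  have hne : ∀ j : ℕ, ‖((σ + j : ℝ) : ℂ) + t * Complex.I‖ ≠ 0 := by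
    intro j h
    have := norm_add_mul_I_sq (σ + j) t
    rw [h] at this
    have := hp j
    nlinarith [sq_nonneg t]
  rw [Real.GammaSeq, Complex.GammaSeq, norm_div, norm_mul, norm_prod,
    Complex.norm_natCast_cpow_of_pos (Nat.pos_of_ne_zero hn)]
  simp only [hq]
  rw [Real.log_div (by positivity) (Finset.prod_ne_zero_iff.2 fun j _ => (hp j).ne'),
    Real.log_div (mul_ne_zero (by positivity) (by simp [Nat.factorial_ne_zero]))
      (Finset.prod_ne_zero_iff.2 fun j _ => hne j),
    Real.log_prod (fun j _ => (hp j).ne'), Real.log_prod (fun j _ => hne j)]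
  simp only [log_norm_add_mul_I, sub_div, Finset.sum_sub_distrib]
  simp

lemma tendsto_logGammaQuot {σ : ℝ} (hσ : 0 < σ) (t : ℝ) :
    Tendsto (fun n : ℕ => ∑ j ∈ Finset.range (n + 1),
        (Real.log ((σ + j) ^ 2 + t ^ 2) - 2 * Real.log (σ + j)) / 2) atTop
      (𝓝 (logGammaQuot t σ)) := by
  have h1 := (Real.GammaSeq_tendsto_Gamma σ).log (Real.Gamma_pos_of_pos hσ).ne'
  have h2 := (Complex.GammaSeq_tendsto_Gamma (σ + t * Complex.I)).norm.log
    (norm_ne_zero_iff.2 (Complex.Gamma_ne_zero_of_re_pos (by simpa using hσ)))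
  refine (h1.sub h2).congr' ?_
  filter_upwards [eventually_ne_atTop 0] with n hn using log_gammaSeq_quot hσ t hn

/-- Euler's limit formula writes log(Γ(σ) / |Γ(σ + it)|) as a limit of sums of terms ½ log(1 + t²/(σ
+ j)²), each convex in σ, and convexity survives pointwise limits. -/
lemma convexOn_logGammaQuot (t : ℝ) : ConvexOn ℝ (Ioi 0) (logGammaQuot t) := by
  refine ⟨convex_Ioi 0, fun x hx y hy θ η hθ hη hs => ?_⟩
  have hz := (convex_Ioi (0 : ℝ)) hx hy hθ hη hs
  refine le_of_tendsto_of_tendsto' (tendsto_logGammaQuot hz t)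
    (((tendsto_logGammaQuot hx t).const_smul θ).add ((tendsto_logGammaQuot hy t).const_smul η)) ?_
  intro n
  simp only [smul_eq_mul, Finset.mul_sum, ← Finset.sum_add_distrib]
  refine Finset.sum_le_sum fun j _ => ?_
  have hx' : x + j ∈ Ioi (0 : ℝ) := by have : 0 < x := hx; simp only [mem_Ioi]; positivity
  have hy' : y + j ∈ Ioi (0 : ℝ) := by have : 0 < y := hy; simp only [mem_Ioi]; positivity
  have h := (convexOn_log_one_add_div t).2 hx' hy' hθ hη hs
  simp only [smul_eq_mul] at h
  have e : θ * (x + j) + η * (y + j) = θ * x + η * y + j := by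
    linear_combination (j : ℝ) * hs
  rw [e] at h
  linarith

/-- On the line Re s = 1/2 the point 1 - s is the conjugate of s, so the reflection formula yields
the modulus exactly. -/
lemma norm_Gamma_half_add (t : ℝ) :
    ‖Complex.Gamma (((1 / 2 : ℝ) : ℂ) + t * Complex.I)‖ ^ 2 = Real.pi / Real.cosh (Real.pi * t) := by
  have h := Complex.Gamma_mul_Gamma_one_sub (((1 / 2 : ℝ) : ℂ) + t * Complex.I)
  have e1 : (1 - (((1 / 2 : ℝ) : ℂ) + t * Complex.I)) =
      (starRingEnd ℂ) (((1 / 2 : ℝ) : ℂ) + t * Complex.I) := by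
    simp only [map_add, map_mul, Complex.conj_ofReal, Complex.conj_I]; push_cast; ring
  have e2 : Complex.sin (Real.pi * (((1 / 2 : ℝ) : ℂ) + t * Complex.I)) =
      (Real.cosh (Real.pi * t) : ℂ) := by
    rw [show (Real.pi * (((1 / 2 : ℝ) : ℂ) + t * Complex.I)) =
      (Real.pi * t : ℝ) * Complex.I + Real.pi / 2 by push_cast; ring, Complex.sin_add_pi_div_two,
      Complex.cos_mul_I]
    push_cast; rfl
  rw [e1, Complex.Gamma_conj, Complex.mul_conj, e2, Complex.normSq_eq_norm_sq] at h
  exact_mod_cast h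

lemma log_norm_Gamma_half_bound {t : ℝ} :
    |Real.log ‖Complex.Gamma (((1 / 2 : ℝ) : ℂ) + t * Complex.I)‖ + Real.pi * |t| / 2| ≤
      Real.log (2 * Real.pi) := by
  have h := norm_Gamma_half_add t
  have hc : 0 < Real.cosh (Real.pi * t) := Real.cosh_pos _
  have h2 : 2 * Real.log ‖Complex.Gamma (((1 / 2 : ℝ) : ℂ) + t * Complex.I)‖ =
      Real.log Real.pi - Real.log (Real.cosh (Real.pi * t)) := by
    rw [← Real.log_div Real.pi_pos.ne' hc.ne', ← h, Real.log_pow]; norm_num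
  have hcabs : Real.cosh (Real.pi * t) = Real.cosh (Real.pi * |t|) := by
    rw [← Real.cosh_abs, abs_mul, abs_of_pos Real.pi_pos]
  have hu : Real.log (Real.cosh (Real.pi * t)) ≤ Real.pi * |t| := by
    rw [hcabs, Real.log_le_iff_le_exp (Real.cosh_pos _), Real.cosh_eq]
    have : Real.exp (-(Real.pi * |t|)) ≤ Real.exp (Real.pi * |t|) := by
      apply Real.exp_le_exp.2
      have : 0 ≤ Real.pi * |t| := by positivity
      linarith
    linarith
  have hl : Real.pi * |t| - Real.log 2 ≤ Real.log (Real.cosh (Real.pi * t)) := by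
    rw [hcabs, Real.le_log_iff_exp_le (Real.cosh_pos _), Real.exp_sub, Real.exp_log two_pos,
      Real.cosh_eq]
    have := Real.exp_pos (-(Real.pi * |t|))
    linarith
  have h3 : 0 ≤ Real.log Real.pi := Real.log_nonneg (by linarith [Real.pi_gt_three])
  have h4 : 0 ≤ Real.log 2 := Real.log_nonneg one_le_two
  rw [Real.log_mul two_ne_zero Real.pi_pos.ne', abs_le]
  constructor <;> linarith

lemma norm_add_mul_I_bounds {c : ℝ} (x t : ℝ) (hx : |x| ≤ c) (ht : 1 ≤ |t|) :
    |t| ≤ ‖(x + t * Complex.I : ℂ)‖ ∧ ‖(x + t * Complex.I : ℂ)‖ ≤ (c + 1) * |t| := by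
  constructor
  · simpa using Complex.abs_im_le_norm (x + t * Complex.I : ℂ)
  · have h := norm_add_le (x : ℂ) (t * Complex.I)
    simp only [norm_mul, Complex.norm_real, Complex.norm_I, mul_one, Real.norm_eq_abs] at h
    have : 0 ≤ c := (abs_nonneg x).trans hx
    nlinarith

/-- `log |Γ(σ + i t)|` compared with its asymptotic value on vertical lines. -/
def logGammaDefect (t σ : ℝ) : ℝ :=
  Real.log ‖Complex.Gamma (σ + t * Complex.I)‖ + Real.pi * |t| / 2 - (σ - 1 / 2) * Real.log |t|

lemma logGammaDefect_add_one {σ t : ℝ} (ht : 1 ≤ |t|) :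
    logGammaDefect t (σ + 1) = logGammaDefect t σ +
      (Real.log ‖(σ + t * Complex.I : ℂ)‖ - Real.log |t|) := by
  have hne : (σ + t * Complex.I : ℂ) ≠ 0 := by
    intro h
    have := congrArg Complex.im h
    simp at this
    rw [this] at ht; norm_num at ht
  have hG : Complex.Gamma (σ + t * Complex.I) ≠ 0 := by
    apply Complex.Gamma_ne_zero
    intro m h
    have := congrArg Complex.im h
    simp at this
    rw [this] at ht; norm_num at ht
  have e : (((σ + 1 : ℝ) : ℂ) + t * Complex.I) = (σ + t * Complex.I) + 1 := by push_cast; ring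
  rw [logGammaDefect, logGammaDefect, e, Complex.Gamma_add_one _ hne, norm_mul,
    Real.log_mul (norm_ne_zero_iff.2 hne) (norm_ne_zero_iff.2 hG)]
  ring

/-- By the recurrence, a unit shift of σ multiplies |Γ| by |σ + it|, which is comparable to |t| when
|t| ≥ 1; the defect therefore moves by a bounded amount. -/
lemma abs_logGammaDefect_add_one_sub {σ t c : ℝ} (hσ : |σ| ≤ c) (ht : 1 ≤ |t|) :
    |logGammaDefect t (σ + 1) - logGammaDefect t σ| ≤ Real.log (c + 1) := by
  have hc : 0 ≤ c := (abs_nonneg σ).trans hσ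
  obtain ⟨h1, h2⟩ := norm_add_mul_I_bounds σ t hσ ht
  have ht0 : 0 < |t| := by linarith
  have h3 : Real.log |t| ≤ Real.log ‖(σ + t * Complex.I : ℂ)‖ := Real.log_le_log ht0 h1
  have h4 : Real.log ‖(σ + t * Complex.I : ℂ)‖ ≤ Real.log (c + 1) + Real.log |t| := by
    rw [← Real.log_mul (by positivity) ht0.ne']
    exact Real.log_le_log (by linarith) h2
  rw [logGammaDefect_add_one ht, add_sub_cancel_left, abs_le]
  constructor <;> linarith [Real.log_nonneg (show 1 ≤ c + 1 by linarith)]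

lemma abs_logGammaDefect_add_nat_sub {σ t c : ℝ} (hσ : |σ| ≤ c) (ht : 1 ≤ |t|) (n : ℕ) :
    |logGammaDefect t (σ + n) - logGammaDefect t σ| ≤ n * Real.log (c + n + 1) := by
  induction n with
  | zero => simp
  | succ n ih =>
    have hc : 0 ≤ c := (abs_nonneg σ).trans hσ
    have h1 : |σ + n| ≤ c + n := (abs_add_le _ _).trans (by simpa using hσ)
    have h2 := abs_logGammaDefect_add_one_sub h1 ht
    have h3 : logGammaDefect t (σ + (n + 1 : ℕ)) - logGammaDefect t σ =
      (logGammaDefect t (σ + n + 1) - logGammaDefect t (σ + n)) +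
      (logGammaDefect t (σ + n) - logGammaDefect t σ) := by
      push_cast; rw [← add_assoc]; ring
    have h4 : Real.log (c + n + 1) ≤ Real.log (c + (n + 1 : ℕ) + 1) := by
      apply Real.log_le_log (by positivity); push_cast; linarith
    rw [h3]
    refine (abs_add_le _ _).trans ?_
    have := mul_le_mul_of_nonneg_left h4 (Nat.cast_nonneg (α := ℝ) n)
    push_cast at *
    linarith

lemma exists_abs_logGammaDefect_half_le (n : ℕ) :
    ∃ C : ℝ, ∀ t : ℝ, 1 ≤ |t| → |logGammaDefect t (1 / 2 + n)| ≤ C := by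
  refine ⟨n * Real.log (1 + n + 1) + Real.log (2 * Real.pi), fun t ht => ?_⟩
  have h1 := abs_logGammaDefect_add_nat_sub (σ := 1 / 2) (c := 1) (by norm_num) ht n
  have h2 : |logGammaDefect t (1 / 2)| ≤ Real.log (2 * Real.pi) := by
    have := log_norm_Gamma_half_bound (t := t)
    simpa [logGammaDefect] using this
  have := abs_add_le (logGammaDefect t (1 / 2 + n) - logGammaDefect t (1 / 2))
    (logGammaDefect t (1 / 2))
  rw [sub_add_cancel] at this
  linarith

/-- From above, a convex function is bounded by its endpoint values on [x₁, x₂]. From below, the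
chord through x₀ and x₁, extended past x₁, stays under the graph; this is why an anchor to the left
of the interval is needed. -/
lemma abs_le_of_convex_three {g : ℝ → ℝ} (hg : ConvexOn ℝ (Ioi 0) g) {x₀ x₁ x₂ C σ : ℝ}
    (h0 : 0 < x₀) (h01 : x₀ + 1 = x₁) (hs1 : x₁ ≤ σ) (hs2 : σ ≤ x₂)
    (b0 : |g x₀| ≤ C) (b1 : |g x₁| ≤ C) (b2 : |g x₂| ≤ C) :
    |g σ| ≤ 2 * C * (x₂ - x₀) := by
  have hC : 0 ≤ C := (abs_nonneg _).trans b0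
  have hx2 : 0 < x₂ := by linarith
  have hσ : 0 < σ := by linarith
  have hup : g σ ≤ C := by
    have := hg.le_max_of_mem_Icc (show x₁ ∈ Ioi (0 : ℝ) by simp only [mem_Ioi]; linarith)
      (show x₂ ∈ Ioi (0 : ℝ) from hx2) (show σ ∈ Icc x₁ x₂ from ⟨hs1, hs2⟩)
    exact this.trans (max_le (le_of_abs_le b1) (le_of_abs_le b2))
  have hd : 0 < σ - x₀ := by linarith
  have hd1 : 1 ≤ σ - x₀ := by linarith
  have hlow : -(2 * C * (x₂ - x₀)) ≤ g σ := by
    -- The weights write x₁ as a convex combination of x₀ and σ; they are simple because x₁ - x₀ =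
    -- 1.
    have h := hg.2 (show x₀ ∈ Ioi (0 : ℝ) from h0) (show σ ∈ Ioi (0 : ℝ) from hσ)
      (show 0 ≤ (σ - x₁) / (σ - x₀) by apply div_nonneg <;> linarith)
      (show 0 ≤ 1 / (σ - x₀) by positivity) (by rw [← add_div, ← h01]; field_simp; ring)
    have e : ((σ - x₁) / (σ - x₀)) • x₀ + (1 / (σ - x₀)) • σ = x₁ := by
      simp only [smul_eq_mul]; rw [← h01]; field_simp; ring
    rw [e] at h
    simp only [smul_eq_mul] at h
    have h' : (σ - x₀) * g x₁ ≤ (σ - x₁) * g x₀ + g σ := by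
      have := mul_le_mul_of_nonneg_left h hd.le
      have e2 : (σ - x₀) * ((σ - x₁) / (σ - x₀) * g x₀ + 1 / (σ - x₀) * g σ) =
        (σ - x₁) * g x₀ + g σ := by field_simp
      linarith
    have := (abs_le.1 b1).1
    have := (abs_le.1 b0).2
    nlinarith
  rw [abs_le]
  refine ⟨hlow, ?_⟩
  nlinarith

/-- `|Γ(σ + i t)|` is comparable to `|t|^{σ - 1/2} e^{-π|t|/2}`, uniformly on vertical strips. -/
lemma exists_abs_logGammaDefect_le (c d : ℝ) :
    ∃ C : ℝ, ∀ σ ∈ Icc c d, ∀ t : ℝ, 1 ≤ |t| → |logGammaDefect t σ| ≤ C := by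
  -- To the right of 3/2: the defect differs from log Γ(x) by a function g that is `logGammaQuot`
  -- plus an affine function of x, hence convex. It is bounded uniformly in t at 1/2, 3/2 and 1/2 +
  -- N, so the three-point bound applies.
  have key : ∀ N : ℕ, ∃ C : ℝ, ∀ σ ∈ Icc (3 / 2 : ℝ) (1 / 2 + N), ∀ t : ℝ, 1 ≤ |t| →
      |logGammaDefect t σ| ≤ C := by
    intro N
    obtain ⟨C0, h0⟩ := exists_abs_logGammaDefect_half_le 0
    obtain ⟨C1, h1⟩ := exists_abs_logGammaDefect_half_le 1
    obtain ⟨C2, h2⟩ := exists_abs_logGammaDefect_half_le N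
    have hcont : ContinuousOn (fun σ : ℝ => Real.log (Real.Gamma σ)) (Icc (1 / 2) (1 / 2 + N)) := by
      intro x hx
      have hx0 : 0 < x := by linarith [hx.1]
      exact ((Real.differentiableAt_Gamma fun m h => by
        have : (0 : ℝ) ≤ m := Nat.cast_nonneg m
        linarith).continuousAt.log
        (Real.Gamma_pos_of_pos hx0).ne').continuousWithinAt
    obtain ⟨L, hL⟩ := isCompact_Icc.exists_bound_of_continuousOn hcont
    have hL' : ∀ x : ℝ, 1 / 2 ≤ x → x ≤ 1 / 2 + N → |Real.log (Real.Gamma x)| ≤ L :=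
      fun x h1 h2 => hL x ⟨h1, h2⟩
    set C := max C0 (max C1 C2)
    refine ⟨2 * (C + L) * (1 / 2 + N - 1 / 2) + L, fun σ hσ t ht => ?_⟩
    have hN : (1 : ℝ) ≤ N := by linarith [hσ.1, hσ.2]
    set g : ℝ → ℝ := fun x => Real.log (Real.Gamma x) - logGammaDefect t x with hgdef
    have hg : ConvexOn ℝ (Ioi 0) g := by
      have hl : ConvexOn ℝ (Ioi (0 : ℝ)) (fun x : ℝ => x * Real.log |t| +
          (- (1 / 2) * Real.log |t| - Real.pi * |t| / 2)) := by
        refine ⟨convex_Ioi 0, fun x _ y _ θ η _ _ hs => le_of_eq ?_⟩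
        simp only [smul_eq_mul]
        linear_combination (-(- (1 / 2) * Real.log |t| - Real.pi * |t| / 2)) * hs
      refine ((convexOn_logGammaQuot t).add hl).congr fun x _ => ?_
      simp only [hgdef, logGammaDefect, logGammaQuot, Pi.add_apply]
      ring
    have bd : ∀ x D : ℝ, 1 / 2 ≤ x → x ≤ 1 / 2 + N → |logGammaDefect t x| ≤ D → D ≤ C →
        |g x| ≤ C + L := by
      intro x D a1 a2 a3 a4
      have := abs_sub (Real.log (Real.Gamma x)) (logGammaDefect t x)
      have := hL' x a1 a2
      simp only [hgdef]
      linarith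
    have hm := abs_le_of_convex_three hg (x₀ := 1 / 2) (x₁ := 3 / 2) (x₂ := 1 / 2 + N) (C := C + L)
      (by norm_num) (by norm_num) hσ.1 hσ.2
      (bd _ _ le_rfl (by linarith) (by simpa using h0 t ht) (le_max_left _ _))
      (bd _ _ (by norm_num) (by linarith) (by have := h1 t ht; norm_num at this ⊢; exact this)
        ((le_max_left _ _).trans (le_max_right _ _)))
      (bd _ _ (by linarith) le_rfl (h2 t ht) ((le_max_right _ _).trans (le_max_right _ _)))
    have e : logGammaDefect t σ = Real.log (Real.Gamma σ) - g σ := by simp [hgdef]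
    rw [e]
    have := abs_sub (Real.log (Real.Gamma σ)) (g σ)
    have := hL' σ (by linarith [hσ.1]) hσ.2
    linarith
  -- The recurrence carries any strip into the region already treated: M unit steps put σ to the
  -- right of 3/2, and N is then large enough on the other side.
  obtain ⟨M, hM⟩ := exists_nat_ge (3 / 2 - c)
  obtain ⟨N, hN⟩ := exists_nat_ge (d + M)
  obtain ⟨C, hC⟩ := key N
  refine ⟨C + M * Real.log (max |c| |d| + M + 1), fun σ hσ t ht => ?_⟩
  have h1 := hC (σ + M) ⟨by linarith [hσ.1], by linarith [hσ.2]⟩ t ht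
  have h2 := abs_logGammaDefect_add_nat_sub (abs_le_max_abs_abs hσ.1 hσ.2) ht M
  have := abs_sub (logGammaDefect t (σ + M)) (logGammaDefect t (σ + M) - logGammaDefect t σ)
  rw [sub_sub_cancel] at this
  linarith

/-! ### The Gamma quotient of a Fox-H density -/

/-- The Gamma quotient `∏ Γ(b_j + β_j s) / ∏ Γ(a_i + α_i s)`. -/
def gammaQuot {m p : ℕ} (a α : Fin p → ℝ) (b β : Fin m → ℝ) (s : ℂ) : ℂ :=
  (∏ j, Complex.Gamma (b j + s * β j)) / ∏ i, Complex.Gamma (a i + s * α i)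

lemma foxHKernel_eq_gammaQuot {m p : ℕ} (a α : Fin p → ℝ) (b β : Fin m → ℝ) (s : ℂ) :
    foxHKernel m 0 (fun i => (a i : ℂ)) α (fun j => (b j : ℂ)) β s = gammaQuot a α b β s := by
  have h1 : (Finset.univ.filter fun j : Fin m => j.val < m) = Finset.univ := by
    ext j; simp
  have h2 : (Finset.univ.filter fun j : Fin m => m ≤ j.val) = ∅ := by
    ext j; simp
  simp only [foxHKernel, gammaQuot, h1, h2]
  simp

lemma exists_abs_log_norm_Gamma_le (b : ℝ) {β : ℝ} (hβ : 0 < β) (c d : ℝ) :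
    ∃ C T : ℝ, ∀ σ ∈ Icc c d, ∀ y : ℝ, T ≤ |y| →
      |Real.log ‖Complex.Gamma (b + (σ + y * Complex.I) * β)‖ -
        ((b + σ * β - 1 / 2) * Real.log |y| - Real.pi / 2 * |y| * β)| ≤ C := by
  obtain ⟨C, hC⟩ := exists_abs_logGammaDefect_le (b + c * β) (b + d * β)
  -- The extra term absorbs (b + σβ - 1/2) log β, created by replacing the height β|y| by |y|; the
  -- threshold 1/β ensures β|y| ≥ 1.
  refine ⟨C + max |b + c * β - 1 / 2| |b + d * β - 1 / 2| * |Real.log β|, 1 / β,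
    fun σ hσ y hy => ?_⟩
  have hy0 : 0 < |y| := lt_of_lt_of_le (by positivity) hy
  have ht : |β * y| = β * |y| := by rw [abs_mul, abs_of_pos hβ]
  have ht1 : 1 ≤ |β * y| := by
    rw [ht]; rw [div_le_iff₀ hβ] at hy; linarith
  have h1 : b + c * β ≤ b + σ * β := by have := mul_le_mul_of_nonneg_right hσ.1 hβ.le; linarith
  have h2 : b + σ * β ≤ b + d * β := by have := mul_le_mul_of_nonneg_right hσ.2 hβ.le; linarith
  have h := hC (b + σ * β) ⟨h1, h2⟩ (β * y) ht1
  have e : ((b : ℂ) + (σ + y * Complex.I) * β) =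
      ((b + σ * β : ℝ) : ℂ) + ((β * y : ℝ) : ℂ) * Complex.I := by
    push_cast; ring
  rw [logGammaDefect, ← e, ht, Real.log_mul hβ.ne' hy0.ne'] at h
  have h3 : |(b + σ * β - 1 / 2) * Real.log β| ≤
      max |b + c * β - 1 / 2| |b + d * β - 1 / 2| * |Real.log β| := by
    rw [abs_mul]
    exact mul_le_mul_of_nonneg_right (abs_le_max_abs_abs (by linarith) (by linarith))
      (abs_nonneg _)
  have := abs_add_le (Real.log ‖Complex.Gamma (b + (σ + y * Complex.I) * β)‖ +
    Real.pi * (β * |y|) / 2 - (b + σ * β - 1 / 2) * (Real.log β + Real.log |y|))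
    ((b + σ * β - 1 / 2) * Real.log β)
  have e2 : Real.log ‖Complex.Gamma (b + (σ + y * Complex.I) * β)‖ -
        ((b + σ * β - 1 / 2) * Real.log |y| - Real.pi / 2 * |y| * β) =
      Real.log ‖Complex.Gamma (b + (σ + y * Complex.I) * β)‖ +
    Real.pi * (β * |y|) / 2 - (b + σ * β - 1 / 2) * (Real.log β + Real.log |y|) +
    (b + σ * β - 1 / 2) * Real.log β := by ring
  rw [e2]
  linarith

lemma exists_abs_log_norm_prod_Gamma_le {m : ℕ} (b : Fin m → ℝ) {β : Fin m → ℝ}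
    (hβ : ∀ j, 0 < β j) (c d : ℝ) :
    ∃ C T : ℝ, ∀ σ ∈ Icc c d, ∀ y : ℝ, T ≤ |y| →
      |Real.log ‖∏ j, Complex.Gamma (b j + (σ + y * Complex.I) * β j)‖ -
        ((∑ j, b j + σ * ∑ j, β j - m / 2) * Real.log |y| - Real.pi / 2 * |y| * ∑ j, β j)| ≤ C := by
  choose C T h using fun j => exists_abs_log_norm_Gamma_le (b j) (hβ j) c d
  refine ⟨∑ j, C j, 1 + ∑ j, |T j|, fun σ hσ y hy => ?_⟩
  have hT : ∀ j, T j ≤ |y| := by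
    intro j
    have := Finset.single_le_sum (f := fun j => |T j|) (fun i _ => abs_nonneg _) (Finset.mem_univ j)
    have := le_abs_self (T j)
    linarith
  have hy0 : y ≠ 0 := by
    rintro rfl
    have : 0 ≤ ∑ j, |T j| := Finset.sum_nonneg fun _ _ => abs_nonneg _
    simp at hy
    linarith
  have hne : ∀ j, ‖Complex.Gamma (b j + (σ + y * Complex.I) * β j)‖ ≠ 0 := by
    intro j
    rw [norm_ne_zero_iff]
    apply Complex.Gamma_ne_zero
    intro k hk
    have := congrArg Complex.im hk
    simp [hy0, (hβ j).ne'] at this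
  rw [norm_prod, Real.log_prod fun j _ => hne j]
  have e : (∑ j, b j + σ * ∑ j, β j - m / 2) * Real.log |y| - Real.pi / 2 * |y| * ∑ j, β j =
      ∑ j, ((b j + σ * β j - 1 / 2) * Real.log |y| - Real.pi / 2 * |y| * β j) := by
    simp only [Finset.sum_sub_distrib, ← Finset.sum_mul, ← Finset.mul_sum, Finset.sum_add_distrib,
      Finset.sum_const, Finset.card_univ, Fintype.card_fin, nsmul_eq_mul]
    ring
  rw [e, ← Finset.sum_sub_distrib]
  exact (Finset.abs_sum_le_sum_abs _ _).trans (Finset.sum_le_sum fun j _ => h j σ hσ y (hT j))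

/-- Adding the one-factor asymptotics shows what a* and μ measure: a* is the exponential rate of
decay and μ + σ a* the power of |y|. The exponents -1/2 of the factors add up to (p - m)/2. -/
lemma exists_log_norm_gammaQuot_le {m p : ℕ} (a : Fin p → ℝ) {α : Fin p → ℝ} (b : Fin m → ℝ)
    {β : Fin m → ℝ} (hα : ∀ i, 0 < α i) (hβ : ∀ j, 0 < β j) (c d : ℝ) :
    ∃ C T : ℝ, ∀ σ ∈ Icc c d, ∀ y : ℝ, T ≤ |y| →
      Real.log ‖gammaQuot a α b β (σ + y * Complex.I)‖ ≤
        (muIndex a b + σ * aStar α β) * Real.log |y| - Real.pi / 2 * |y| * aStar α β + C := by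
  obtain ⟨C₁, T₁, h₁⟩ := exists_abs_log_norm_prod_Gamma_le b hβ c d
  obtain ⟨C₂, T₂, h₂⟩ := exists_abs_log_norm_prod_Gamma_le a hα c d
  refine ⟨C₁ + C₂, max 1 (max T₁ T₂), fun σ hσ y hy => ?_⟩
  have hy0 : y ≠ 0 := by
    rintro rfl
    have := (le_max_left _ _).trans hy
    norm_num at this
  have hne : ∀ {k : ℕ} (b β : Fin k → ℝ), (∀ j, 0 < β j) →
      ‖∏ j, Complex.Gamma (b j + (σ + y * Complex.I) * β j)‖ ≠ 0 := by
    intro k b β hβ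
    rw [norm_ne_zero_iff, Finset.prod_ne_zero_iff]
    intro j _
    apply Complex.Gamma_ne_zero
    intro k hk
    have := congrArg Complex.im hk
    simp [hy0, (hβ j).ne'] at this
  have k1 := (abs_le.1 (h₁ σ hσ y (((le_max_left _ _).trans (le_max_right _ _)).trans hy))).2
  have k2 := (abs_le.1 (h₂ σ hσ y (((le_max_right _ _).trans (le_max_right _ _)).trans hy))).1
  rw [gammaQuot, norm_div, Real.log_div (hne b β hβ) (hne a α hα)]
  have e : (muIndex a b + σ * aStar α β) * Real.log |y| - Real.pi / 2 * |y| * aStar α β =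
      ((∑ j, b j + σ * ∑ j, β j - m / 2) * Real.log |y| - Real.pi / 2 * |y| * ∑ j, β j) -
      ((∑ j, a j + σ * ∑ j, α j - p / 2) * Real.log |y| - Real.pi / 2 * |y| * ∑ j, α j) := by
    rw [muIndex, aStar]; ring
  rw [e]
  linarith

/-- This is where the alternative on a* and μ enters. If a* > 0, exponential decay beats every
power; if a* = 0, what remains is |y|^μ, integrable at infinity because μ < -1. -/
lemma exists_norm_gammaQuot_tail_le {m p : ℕ} {a α : Fin p → ℝ} {b β : Fin m → ℝ}
    (hα : ∀ i, 0 < α i) (hβ : ∀ j, 0 < β j)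
    (hs : 0 < aStar α β ∨ (aStar α β = 0 ∧ muIndex a b < -1)) (c d : ℝ) :
    ∃ ρ > (1 : ℝ), ∃ C > 0, ∃ T ≥ (1 : ℝ), ∀ σ ∈ Icc c d, ∀ y : ℝ, T ≤ |y| →
      ‖gammaQuot a α b β (σ + y * Complex.I)‖ ≤ C * |y| ^ (-ρ) := by
  obtain ⟨C, T, h⟩ := exists_log_norm_gammaQuot_le a b hα hβ c d
  have key : ∃ ρ > (1 : ℝ), ∃ T' : ℝ, ∀ σ ∈ Icc c d, ∀ y : ℝ, T' ≤ |y| →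
      (muIndex a b + σ * aStar α β) * Real.log |y| - Real.pi / 2 * |y| * aStar α β ≤
        -ρ * Real.log |y| := by
    rcases hs with hs | ⟨h0, h1⟩
    -- M bounds μ + σ a* + 2 on the strip, so log = o(id) lets the exponential absorb the polynomial
    -- factor and still leave |y|^{-2}.
    · set M := |muIndex a b| + max |c| |d| * aStar α β + 2
      have hM : 0 < M := by positivity
      have hlim := Real.isLittleO_log_id_atTop.bound
        (show 0 < Real.pi / 2 * aStar α β / M by positivity)
      obtain ⟨T', hT'⟩ := (eventually_atTop.1 hlim)
      refine ⟨2, by norm_num, max 1 T', fun σ hσ y hy => ?_⟩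
      have hy1 : 1 ≤ |y| := (le_max_left _ _).trans hy
      have h2 := hT' |y| ((le_max_right _ _).trans hy)
      have hlog : 0 ≤ Real.log |y| := Real.log_nonneg hy1
      simp only [Real.norm_eq_abs, id, abs_abs] at h2
      rw [abs_of_nonneg hlog] at h2
      have h3 : M * Real.log |y| ≤ Real.pi / 2 * aStar α β * |y| := by
        have := mul_le_mul_of_nonneg_left h2 hM.le
        rwa [← mul_assoc, mul_div_cancel₀ _ hM.ne'] at this
      have h4 : muIndex a b + σ * aStar α β + 2 ≤ M := by
        have k1 := le_abs_self (muIndex a b)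
        have k2 : σ ≤ max |c| |d| := (le_abs_self σ).trans (abs_le_max_abs_abs hσ.1 hσ.2)
        have := mul_le_mul_of_nonneg_right k2 hs.le
        simp only [M]; linarith
      have := mul_le_mul_of_nonneg_right h4 hlog
      linarith
    · refine ⟨-muIndex a b, by linarith, 0, fun σ _ y _ => ?_⟩
      rw [h0]; simp
  obtain ⟨ρ, hρ, T', hT'⟩ := key
  refine ⟨ρ, hρ, Real.exp C, Real.exp_pos _, max 1 (max T T'), le_max_left _ _,
    fun σ hσ y hy => ?_⟩
  have hy1 : 1 ≤ |y| := (le_max_left _ _).trans hy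
  have h1 := h σ hσ y (((le_max_left _ _).trans (le_max_right _ _)).trans hy)
  have h2 := hT' σ hσ y (((le_max_right _ _).trans (le_max_right _ _)).trans hy)
  rw [Real.rpow_def_of_pos (by linarith), ← Real.exp_add]
  rcases (norm_nonneg (gammaQuot a α b β (σ + y * Complex.I))).eq_or_lt with h0 | h0
  · rw [← h0]; exact (Real.exp_pos _).le
  · rw [← Real.log_le_iff_le_exp h0]
    linarith

lemma differentiableAt_gammaQuot {m p : ℕ} {a α : Fin p → ℝ} {b β : Fin m → ℝ} {s : ℂ}
    (hs : ∀ j, 0 < b j + s.re * β j) : DifferentiableAt ℂ (gammaQuot a α b β) s := by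
  have e : gammaQuot a α b β = fun s => (∏ j, Complex.Gamma (b j + s * β j)) *
      ∏ i, (Complex.Gamma (a i + s * α i))⁻¹ := by
    ext s; rw [gammaQuot, div_eq_mul_inv, Finset.prod_inv_distrib]
  rw [e]
  refine DifferentiableAt.mul (DifferentiableAt.fun_finsetProd fun j _ => ?_)
    (DifferentiableAt.fun_finsetProd fun i _ => ?_)
  · refine (Complex.differentiableAt_Gamma _ fun k hk => ?_).comp s (by fun_prop)
    have h1 := congrArg Complex.re hk
    have h2 := hs j
    simp at h1
    have : (0 : ℝ) ≤ k := Nat.cast_nonneg k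
    linarith
  · exact (Complex.differentiable_one_div_Gamma _).comp s (by fun_prop)

/-- The Gamma quotient is dominated, uniformly on vertical strips, by an integrable power. -/
lemma exists_norm_gammaQuot_le {m p : ℕ} {a α : Fin p → ℝ} {b β : Fin m → ℝ}
    (hα : ∀ i, 0 < α i) (hβ : ∀ j, 0 < β j)
    (hs : 0 < aStar α β ∨ (aStar α β = 0 ∧ muIndex a b < -1)) {c d : ℝ}
    (hc : ∀ j, 0 < b j + c * β j) :
    ∃ ρ > (1 : ℝ), ∃ C > 0, ∀ σ ∈ Icc c d, ∀ y : ℝ,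
      ‖gammaQuot a α b β (σ + y * Complex.I)‖ ≤ C * (1 + ‖y‖) ^ (-ρ) := by
  obtain ⟨ρ, hρ, C, hC, T, hT, h⟩ := exists_norm_gammaQuot_tail_le hα hβ hs c d
  have hcont : ContinuousOn (fun q : ℝ × ℝ => gammaQuot a α b β (q.1 + q.2 * Complex.I))
      (Icc c d ×ˢ Icc (-T) T) := by
    intro q hq
    have hd : DifferentiableAt ℂ (gammaQuot a α b β) (q.1 + q.2 * Complex.I) := by
      apply differentiableAt_gammaQuot
      intro j
      have := mul_le_mul_of_nonneg_right hq.1.1 (hβ j).le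
      have := hc j
      simp
      linarith
    exact (ContinuousAt.comp (f := fun q : ℝ × ℝ => (q.1 + q.2 * Complex.I : ℂ)) hd.continuousAt
      (by fun_prop)).continuousWithinAt
  obtain ⟨B, hB⟩ := (isCompact_Icc.prod isCompact_Icc).exists_bound_of_continuousOn hcont
  refine ⟨ρ, hρ, max (|B| * (1 + T) ^ ρ) (C * 2 ^ ρ), by positivity, fun σ hσ y => ?_⟩
  have hp : 0 < 1 + ‖y‖ := by positivity
  rw [Real.rpow_neg hp.le]
  rw [← div_eq_mul_inv, le_div_iff₀ (by positivity)]
  rcases le_total |y| T with hy | hy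
  · refine le_trans ?_ (le_max_left _ _)
    have h1 := hB (σ, y) ⟨hσ, abs_le.1 hy⟩
    simp only at h1
    have h2 : (1 + ‖y‖) ^ ρ ≤ (1 + T) ^ ρ :=
      Real.rpow_le_rpow hp.le (by rw [Real.norm_eq_abs]; linarith) (by linarith)
    exact mul_le_mul (h1.trans (le_abs_self _)) h2 (by positivity) (abs_nonneg _)
  · refine le_trans ?_ (le_max_right _ _)
    have hy0 : 0 < |y| := by linarith
    have h1 := h σ hσ y hy
    have h2 : (1 + ‖y‖) ^ ρ ≤ 2 ^ ρ * |y| ^ ρ := by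
      rw [← Real.mul_rpow two_pos.le hy0.le]
      exact Real.rpow_le_rpow hp.le (by rw [Real.norm_eq_abs]; linarith) (by linarith)
    calc _ ≤ C * |y| ^ (-ρ) * (2 ^ ρ * |y| ^ ρ) := by gcongr
      _ = C * 2 ^ ρ := by
        rw [Real.rpow_neg hy0.le]
        have : |y| ^ ρ ≠ 0 := (Real.rpow_pos_of_pos hy0 _).ne'
        field_simp

/-! ### Shifting vertical contours and the Mellin transform of a Fox-H density -/

lemma integrable_of_norm_le_one_add_rpow {f : ℝ → ℂ} (hf : Continuous f) {ρ C : ℝ} (hρ : 1 < ρ)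
    (h : ∀ y, ‖f y‖ ≤ C * (1 + ‖y‖) ^ (-ρ)) : Integrable f :=
  ((integrable_one_add_norm (by simpa using hρ)).const_mul C).mono' hf.aestronglyMeasurable
    (Eventually.of_forall h)

/-- Cauchy's theorem on rectangles of height 2T: the horizontal sides are O((1 + T)^{-ρ}) and vanish
as T → ∞, while the vertical sides converge to the two integrals. -/
lemma integral_vertical_line_eq {f : ℂ → ℂ} {c d : ℝ} (hcd : c ≤ d)
    (hf : ∀ s : ℂ, s.re ∈ Icc c d → DifferentiableAt ℂ f s) {ρ C : ℝ} (hρ : 1 < ρ)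
    (h : ∀ σ ∈ Icc c d, ∀ y : ℝ, ‖f (σ + y * Complex.I)‖ ≤ C * (1 + ‖y‖) ^ (-ρ)) :
    ∫ y : ℝ, f (c + y * Complex.I) = ∫ y : ℝ, f (d + y * Complex.I) := by
  have hcont : ∀ σ ∈ Icc c d, Continuous fun y : ℝ => f (σ + y * Complex.I) := by
    intro σ hσ
    refine continuous_iff_continuousAt.2 fun y => ?_
    exact ContinuousAt.comp (f := fun y : ℝ => (σ + y * Complex.I : ℂ))
      (hf _ (by simpa using hσ)).continuousAt (by fun_prop)
  have hint : ∀ σ ∈ Icc c d, Integrable fun y : ℝ => f (σ + y * Complex.I) :=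
    fun σ hσ => integrable_of_norm_le_one_add_rpow (hcont σ hσ) hρ (h σ hσ)
  have hlim : ∀ σ ∈ Icc c d, Tendsto (fun T : ℝ => ∫ y in (-T)..T, f (σ + y * Complex.I)) atTop
      (𝓝 (∫ y : ℝ, f (σ + y * Complex.I))) := fun σ hσ =>
    intervalIntegral_tendsto_integral (hint σ hσ) tendsto_neg_atTop_atBot tendsto_id
  have hhor : ∀ u : ℝ → ℝ, (∀ T, ‖u T‖ = |T|) →
      Tendsto (fun T : ℝ => ∫ x in c..d, f (x + u T * Complex.I)) atTop (𝓝 0) := by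
    intro u hu
    have hz : Tendsto (fun T : ℝ => C * (1 + T) ^ (-ρ) * |d - c|) atTop (𝓝 0) := by
      have h0 : Tendsto (fun T : ℝ => (1 + T) ^ (-ρ)) atTop (𝓝 0) :=
        (tendsto_rpow_neg_atTop (by linarith)).comp (tendsto_atTop_add_const_left _ 1 tendsto_id)
      simpa using (h0.const_mul C).mul_const |d - c|
    refine squeeze_zero_norm' ?_ hz
    filter_upwards [eventually_ge_atTop 0] with T hT
    refine intervalIntegral.norm_integral_le_of_norm_le_const fun x hx => ?_
    rw [uIoc_of_le hcd] at hx
    have := h x ⟨hx.1.le, hx.2⟩ (u T)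
    rwa [hu, abs_of_nonneg hT] at this
  have hrect : ∀ T : ℝ, (∫ x in c..d, f (x + (-T : ℝ) * Complex.I)) -
      (∫ x in c..d, f (x + T * Complex.I)) +
      Complex.I * (∫ y in (-T)..T, f (d + y * Complex.I)) -
      Complex.I * (∫ y in (-T)..T, f (c + y * Complex.I)) = 0 := by
    intro T
    have := Complex.integral_boundary_rect_eq_zero_of_differentiableOn f
      (c + (-T : ℝ) * Complex.I) (d + T * Complex.I) (by
        intro s hs
        have := hs.1
        simp only [Complex.add_re, Complex.ofReal_re, Complex.mul_re, Complex.ofReal_im,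
          Complex.I_re, Complex.I_im] at this
        norm_num at this
        rw [uIcc_of_le hcd] at this
        exact (hf s this).differentiableWithinAt)
    simpa [smul_eq_mul] using this
  have hlim2 := (((hhor (fun T => -T) (by simp)).sub (hhor (fun T => T) (by simp))).add
    ((hlim d ⟨hcd, le_rfl⟩).const_mul Complex.I)).sub
    ((hlim c ⟨le_rfl, hcd⟩).const_mul Complex.I)
  have h0 := tendsto_nhds_unique (hlim2.congr hrect) tendsto_const_nhds
  rw [sub_zero, zero_add, ← mul_sub] at h0
  rcases mul_eq_zero.1 h0 with h0 | h0
  · exact absurd h0 Complex.I_ne_zero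
  · exact (sub_eq_zero.1 h0).symm

section Density

variable {m p : ℕ} {a α : Fin p → ℝ} {b β : Fin m → ℝ}

lemma norm_ofReal_cpow_neg {τ : ℝ} (hτ : 0 < τ) (σ y : ℝ) :
    ‖(τ : ℂ) ^ (-(σ + y * Complex.I))‖ = τ ^ (-σ) := by
  rw [Complex.norm_cpow_eq_rpow_re_of_pos hτ]; simp

lemma foxHReal_assumption_pos (hA : FoxHAssumption a α b β) {c σ : ℝ}
    (hc : ∀ j, 0 < b j + c * β j) (h : c ≤ σ) (j : Fin m) : 0 < b j + σ * β j := by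
  have := mul_le_mul_of_nonneg_right h (hA.beta_pos j).le
  linarith [hc j]

lemma continuous_gammaQuot_line {σ : ℝ} (hσ : ∀ j, 0 < b j + σ * β j) :
    Continuous fun y : ℝ => gammaQuot a α b β (σ + y * Complex.I) := by
  refine continuous_iff_continuousAt.2 fun y => ?_
  exact ContinuousAt.comp (f := fun y : ℝ => (σ + y * Complex.I : ℂ))
    (differentiableAt_gammaQuot (by simpa using hσ)).continuousAt (by fun_prop)

lemma integrable_gammaQuot_line (hA : FoxHAssumption a α b β) {σ : ℝ}
    (hσ : ∀ j, 0 < b j + σ * β j) :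
    Integrable fun y : ℝ => gammaQuot a α b β (σ + y * Complex.I) := by
  obtain ⟨ρ, hρ, C, -, h⟩ :=
    exists_norm_gammaQuot_le (d := σ) hA.alpha_pos hA.beta_pos hA.aStar_cond hσ
  exact integrable_of_norm_le_one_add_rpow (continuous_gammaQuot_line hσ) hρ
    (h σ ⟨le_rfl, le_rfl⟩)

/-- The inverse Mellin transform of the Gamma quotient does not depend on the vertical line. -/
lemma mellinInv_gammaQuot_eq (hA : FoxHAssumption a α b β) {c d : ℝ}
    (hc : ∀ j, 0 < b j + c * β j) (hd : ∀ j, 0 < b j + d * β j) {τ : ℝ} (hτ : 0 < τ) :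
    mellinInv c (gammaQuot a α b β) τ = mellinInv d (gammaQuot a α b β) τ := by
  wlog hcd : c ≤ d generalizing c d
  · exact (this hd hc (le_of_not_ge hcd)).symm
  obtain ⟨ρ, hρ, C, hC, h⟩ :=
    exists_norm_gammaQuot_le (d := d) hA.alpha_pos hA.beta_pos hA.aStar_cond hc
  have hcont : ContinuousOn (fun σ : ℝ => τ ^ (-σ)) (Icc c d) := by
    intro σ _
    exact (ContinuousAt.rpow continuousAt_const continuousAt_id.neg
      (Or.inl hτ.ne')).continuousWithinAt
  obtain ⟨B, hB⟩ := isCompact_Icc.exists_bound_of_continuousOn hcont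
  rw [mellinInv, mellinInv]
  congr 1
  refine integral_vertical_line_eq (f := fun s : ℂ => (τ : ℂ) ^ (-s) • gammaQuot a α b β s)
    (C := B * C) hcd (fun s hs => ?_) hρ fun σ hσ y => ?_
  · have h1 : DifferentiableAt ℂ (fun s : ℂ => (τ : ℂ) ^ (-s)) s :=
      differentiableAt_id.neg.const_cpow (Or.inl (Complex.ofReal_ne_zero.2 hτ.ne'))
    exact h1.smul (differentiableAt_gammaQuot fun j => foxHReal_assumption_pos hA hc hs.1 j)
  · rw [norm_smul, norm_ofReal_cpow_neg hτ, mul_assoc]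
    have h1 := hB σ hσ
    rw [Real.norm_of_nonneg (Real.rpow_nonneg hτ.le _)] at h1
    exact mul_le_mul h1 (h σ hσ y) (norm_nonneg _) ((Real.rpow_nonneg hτ.le _).trans h1)

lemma separatesPoles_of_pos (hβ : ∀ j, 0 < β j) {γ : ℝ} :
    SeparatesPoles m 0 (fun i => (a i : ℂ)) α (fun j => (b j : ℂ)) β γ ↔
      ∀ j, 0 < b j + γ * β j := by
  have e : ∀ (j : Fin m) (l : ℕ),
      (-((b j : ℂ) + l) / (β j : ℂ)).re < γ ↔ 0 < b j + γ * β j + l := by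
    intro j l
    rw [Complex.div_ofReal_re, div_lt_iff₀ (hβ j)]
    simp only [Complex.neg_re, Complex.add_re, Complex.ofReal_re, Complex.natCast_re]
    constructor <;> intro h <;> linarith
  constructor
  · intro h j
    have := (e j 0).1 (h.1 j j.2 0)
    simpa using this
  · refine fun h => ⟨fun j _ l => (e j l).2 ?_, fun i hi => absurd hi (Nat.not_lt_zero _)⟩
    have := h j
    positivity

/-- The definition picks an unspecified separating line. Independence of the line replaces it by any
admissible σ, a freedom used for all later estimates. -/
lemma foxH_eq_mellinInv (hA : FoxHAssumption a α b β) {σ : ℝ}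
    (hσ : ∀ j, 0 < b j + σ * β j) {τ : ℝ} (hτ : 0 < τ) :
    foxH m 0 (fun i => (a i : ℂ)) α (fun j => (b j : ℂ)) β (τ : ℂ) =
      mellinInv σ (gammaQuot a α b β) τ := by
  have hex : ∃ γ : ℝ, SeparatesPoles m 0 (fun i => (a i : ℂ)) α (fun j => (b j : ℂ)) β γ :=
    ⟨σ, (separatesPoles_of_pos hA.beta_pos).2 hσ⟩
  rw [foxH, dif_pos hex, ← mellinInv_gammaQuot_eq hA
    ((separatesPoles_of_pos hA.beta_pos).1 hex.choose_spec) hσ hτ, mellinBarnes, mellinInv]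
  simp only [foxHKernel_eq_gammaQuot, smul_eq_mul, Complex.real_smul]
  push_cast
  congr 1
  refine integral_congr_ae (Eventually.of_forall fun y => ?_)
  simp only [mul_comm]

lemma gammaQuot_conj (s : ℂ) :
    gammaQuot a α b β ((starRingEnd ℂ) s) = (starRingEnd ℂ) (gammaQuot a α b β s) := by
  simp only [gammaQuot, map_div₀, map_prod, ← Complex.Gamma_conj, map_add, map_mul,
    Complex.conj_ofReal]

/-- Conjugation reverses the orientation of the line, which y ↦ -y undoes. Thus the Fox-H values are
real and taking the real part in `foxHReal` loses nothing. -/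
lemma mellinInv_conj {F : ℂ → ℂ} (hF : ∀ s, F ((starRingEnd ℂ) s) = (starRingEnd ℂ) (F s))
    (σ : ℝ) {τ : ℝ} (hτ : 0 < τ) :
    (starRingEnd ℂ) (mellinInv σ F τ) = mellinInv σ F τ := by
  rw [mellinInv]
  simp only [Complex.real_smul, smul_eq_mul, map_mul, Complex.conj_ofReal]
  congr 1
  rw [← integral_conj, ← integral_neg_eq_self]
  refine integral_congr_ae (Eventually.of_forall fun y => ?_)
  simp only [map_mul]
  have h1 : (starRingEnd ℂ) ((τ : ℂ) ^ (-(σ + ((-y : ℝ) : ℂ) * Complex.I))) =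
      (τ : ℂ) ^ (-(σ + y * Complex.I)) := by
    have := Complex.cpow_conj (τ : ℂ) (-(σ + ((-y : ℝ) : ℂ) * Complex.I))
      (by rw [Complex.arg_ofReal_of_nonneg hτ.le]; exact Real.pi_pos.ne)
    rw [Complex.conj_ofReal] at this
    rw [← this]
    simp
  rw [← hF, h1]
  simp

lemma foxHReal_eq_mellinInv (hA : FoxHAssumption a α b β) {σ : ℝ}
    (hσ : ∀ j, 0 < b j + σ * β j) {τ : ℝ} (hτ : 0 < τ) :
    (foxHReal a α b β τ : ℂ) = mellinInv σ (gammaQuot a α b β) τ := by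
  rw [foxHReal, foxH_eq_mellinInv hA hσ hτ]
  exact Complex.conj_eq_iff_re.1 (mellinInv_conj gammaQuot_conj σ hτ)

/-- Every admissible line gives a power bound. A line to the left of Re s controls τ → 0 in the
Mellin integral, and one to the right controls τ → ∞. -/
lemma exists_abs_foxHReal_le (hA : FoxHAssumption a α b β) {σ : ℝ}
    (hσ : ∀ j, 0 < b j + σ * β j) :
    ∃ C : ℝ, ∀ τ : ℝ, 0 < τ → |foxHReal a α b β τ| ≤ C * τ ^ (-σ) := by
  refine ⟨1 / (2 * Real.pi) * ∫ y : ℝ, ‖gammaQuot a α b β (σ + y * Complex.I)‖, fun τ hτ => ?_⟩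
  have e : |foxHReal a α b β τ| = ‖(foxHReal a α b β τ : ℂ)‖ := by simp
  rw [e, foxHReal_eq_mellinInv hA hσ hτ, mellinInv, norm_smul, mul_assoc]
  have h2 : ‖(1 / (2 * Real.pi) : ℝ)‖ = 1 / (2 * Real.pi) :=
    Real.norm_of_nonneg (by positivity)
  rw [h2]
  refine mul_le_mul_of_nonneg_left ?_ (by positivity)
  refine (norm_integral_le_integral_norm _).trans (le_of_eq ?_)
  simp only [norm_smul, norm_ofReal_cpow_neg hτ]
  rw [integral_const_mul, mul_comm]

/-- With τ = e^{-u} the Mellin-Barnes integral becomes an inverse Fourier transform, so continuity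
and inversion can be taken from Fourier analysis. -/
lemma foxHReal_exp_neg (hA : FoxHAssumption a α b β) {σ : ℝ}
    (hσ : ∀ j, 0 < b j + σ * β j) (u : ℝ) :
    (Real.exp (-σ * u) • (foxHReal a α b β (Real.exp (-u)) : ℂ)) =
      FourierTransformInv.fourierInv
        (fun y : ℝ => gammaQuot a α b β (σ + 2 * Real.pi * y * Complex.I)) u := by
  rw [foxHReal_eq_mellinInv hA hσ (Real.exp_pos _), mellinInv_eq_fourierInv _ _ (Real.exp_pos _),
    Real.log_exp, neg_neg, Complex.real_smul, smul_eq_mul, ← mul_assoc]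
  have : ((Real.exp (-σ * u) : ℝ) : ℂ) * ((Real.exp (-u) : ℝ) : ℂ) ^ (-σ : ℂ) = 1 := by
    rw [← Complex.ofReal_neg, ← Complex.ofReal_cpow (Real.exp_pos _).le, ← Complex.ofReal_mul,
      ← Real.exp_mul, ← Real.exp_add, show -σ * u + -u * -σ = 0 by ring, Real.exp_zero,
      Complex.ofReal_one]
  rw [this, one_mul]

lemma continuousOn_foxHReal (hA : FoxHAssumption a α b β) :
    ContinuousOn (foxHReal a α b β) (Ioi 0) := by
  have h1 : ∀ j, 0 < b j + (1 : ℝ) * β j := by simpa using hA.b_add_beta_pos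
  have hc : Continuous fun u : ℝ =>
      (Real.exp (-1 * u) • (foxHReal a α b β (Real.exp (-u)) : ℂ)) := by
    simp_rw [foxHReal_exp_neg hA h1]
    have := (integrable_gammaQuot_line hA h1).comp_mul_left' (R := 2 * Real.pi)
      (by positivity)
    push_cast at this
    exact VectorFourier.fourierIntegral_continuous Real.continuous_fourierChar
      (by fun_prop) this
  have hc2 : Continuous fun u : ℝ => foxHReal a α b β (Real.exp (-u)) := by
    have h3 : Continuous fun u : ℝ => (Real.exp u • (Real.exp (-1 * u) •
      (foxHReal a α b β (Real.exp (-u)) : ℂ))).re :=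
      Complex.continuous_re.comp (Real.continuous_exp.smul hc)
    refine h3.congr fun u => ?_
    rw [smul_smul, ← Real.exp_add]
    simp
  have : ContinuousOn (fun τ : ℝ => foxHReal a α b β (Real.exp (-(-Real.log τ)))) (Ioi 0) :=
    hc2.comp_continuousOn (Real.continuousOn_log.mono (by simp)).neg
  refine this.congr fun τ hτ => ?_
  simp only [neg_neg]
  rw [Real.exp_log hτ]

/-- Finitely many strict linear inequalities define an open set. The room to the left gives
convergence of the Mellin integral at 0 and, at σ = 1, a contour for the Wright function. -/
lemma exists_lt_admissible {σ : ℝ} (hσ : ∀ j, 0 < b j + σ * β j) :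
    ∃ c < σ, ∀ j, 0 < b j + c * β j := by
  have h : ∀ᶠ c in 𝓝[<] σ, ∀ j, 0 < b j + c * β j := by
    rw [eventually_all]
    intro j
    refine (ContinuousAt.eventually_lt (f := fun _ : ℝ => (0 : ℝ)) (g := fun c => b j + c * β j)
      continuousAt_const (by fun_prop) (hσ j)).filter_mono nhdsWithin_le_nhds
  obtain ⟨c, hc, h2⟩ := (h.and self_mem_nhdsWithin).exists
  exact ⟨c, h2, hc⟩

lemma mellinConvergent_foxHReal (hA : FoxHAssumption a α b β) {s : ℂ}
    (hs : ∀ j, 0 < b j + s.re * β j) :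
    MellinConvergent (fun τ => (foxHReal a α b β τ : ℂ)) s := by
  obtain ⟨c, hc, hcb⟩ := exists_lt_admissible hs
  obtain ⟨C₁, h₁⟩ := exists_abs_foxHReal_le hA hcb
  obtain ⟨C₂, h₂⟩ := exists_abs_foxHReal_le hA
    (foxHReal_assumption_pos hA hs (show s.re ≤ s.re + 1 by linarith))
  refine mellinConvergent_of_isBigO_rpow (a := s.re + 1) (b := c) ?_ ?_ (by linarith) ?_ hc
  · exact (Complex.continuous_ofReal.comp_continuousOn
      (continuousOn_foxHReal hA)).locallyIntegrableOn measurableSet_Ioi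
  · refine Asymptotics.IsBigO.of_bound C₂ ?_
    filter_upwards [eventually_gt_atTop 0] with τ hτ
    rw [Complex.norm_real, Real.norm_of_nonneg (Real.rpow_nonneg hτ.le _)]
    exact h₂ τ hτ
  · refine Asymptotics.IsBigO.of_bound C₁ ?_
    filter_upwards [self_mem_nhdsWithin] with τ hτ
    rw [Complex.norm_real, Real.norm_of_nonneg (Real.rpow_nonneg (le_of_lt hτ) _)]
    exact h₁ τ hτ

/-- The Mellin transform of a Fox-H density is its Gamma quotient. -/
lemma mellin_foxHReal (hA : FoxHAssumption a α b β) {s : ℂ} (hs : ∀ j, 0 < b j + s.re * β j) :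
    mellin (fun τ => (foxHReal a α b β τ : ℂ)) s = gammaQuot a α b β s := by
  have hconv := mellinConvergent_foxHReal hA (s := s.re) hs
  set g : ℝ → ℂ := fun y => gammaQuot a α b β (s.re + 2 * Real.pi * y * Complex.I) with hg
  have hgc : Continuous g := by
    have := (continuous_gammaQuot_line (a := a) (α := α) hs).comp
      (continuous_const.mul continuous_id : Continuous fun y : ℝ => (2 * Real.pi) * y)
    refine this.congr fun y => ?_
    simp [hg]
  have hgi : Integrable g := by
    have := (integrable_gammaQuot_line hA hs).comp_mul_left' (R := 2 * Real.pi) (by positivity)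
    push_cast at this
    exact this
  -- Fourier inversion needs the transform itself to be integrable. After the substitution τ =
  -- e^{-u} this is Mellin convergence at Re s.
  have hFi : Integrable (FourierTransformInv.fourierInv g) := by
    have e : FourierTransformInv.fourierInv g = fun u : ℝ =>
      (Real.exp (-s.re * u) • (foxHReal a α b β (Real.exp (-u)) : ℂ)) := by
      ext u; rw [foxHReal_exp_neg hA hs]
    rw [e]
    have := hconv
    rw [MellinConvergent] at this
    have himg : Ioi (0 : ℝ) = (fun u : ℝ => Real.exp (-u)) '' univ := by
      ext x
      simp only [mem_Ioi, mem_image, mem_univ, true_and]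
      exact ⟨fun hx => ⟨-Real.log x, by simp [Real.exp_log hx]⟩, fun ⟨u, hu⟩ => hu ▸ Real.exp_pos _⟩
    rw [himg, integrableOn_image_iff_integrableOn_abs_deriv_smul MeasurableSet.univ
      (fun u _ => (((hasDerivAt_neg u).exp)).hasDerivWithinAt)
      (fun u _ v _ h => by simpa using h), integrableOn_univ] at this
    refine this.congr (Eventually.of_forall fun u => ?_)
    simp only [smul_eq_mul, Complex.real_smul, mul_neg, mul_one, abs_neg, Real.abs_exp]
    rw [← Complex.ofReal_one, ← Complex.ofReal_sub, ← Complex.ofReal_cpow (Real.exp_pos _).le,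
      ← Real.exp_mul, ← mul_assoc, ← Complex.ofReal_mul, ← Real.exp_add]
    congr 3
    ring
  have hFi' : Integrable (FourierTransform.fourier g) := by
    refine hFi.comp_neg.congr (Eventually.of_forall fun u => ?_)
    simp only [Real.fourierInv_eq_fourier_neg, neg_neg]
  have hinv := hgc.fourier_fourierInv_eq hgi hFi'
  rw [mellin_eq_fourier]
  simp_rw [foxHReal_exp_neg hA hs]
  have e2 : (fun u : ℝ => FourierTransformInv.fourierInv
        (fun y : ℝ => gammaQuot a α b β (s.re + 2 * Real.pi * y * Complex.I)) u) =
      FourierTransformInv.fourierInv g := rfl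
  rw [e2, hinv]
  simp only [hg]
  congr 1
  push_cast
  rw [mul_div_cancel₀ _ (by exact_mod_cast (show (2 * Real.pi) ≠ 0 by positivity)),
    Complex.re_add_im]

end Density

/-! ### The mixing measure and the Laplace transform of a Fox-H density -/

section Mixing

variable {m p : ℕ} {a α : Fin p → ℝ} {b β : Fin m → ℝ}

lemma gammaRatio_pos (hA : FoxHAssumption a α b β) (l : ℕ) : 0 < gammaRatio a α b β l := by
  refine div_pos (Finset.prod_pos fun j _ => Real.Gamma_pos_of_pos ?_)
    (Finset.prod_pos fun i _ => Real.Gamma_pos_of_pos ?_)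
  · have h1 := hA.b_add_beta_pos j
    have h2 := hA.beta_pos j
    have : 0 ≤ β j * l := by positivity
    linarith
  · have h1 := hA.a_add_alpha_pos i
    have h2 := hA.alpha_pos i
    have : 0 ≤ α i * l := by positivity
    linarith

lemma gammaRatio_zero : gammaRatio a α b β 0 = normConst a α b β := by
  simp [gammaRatio, normConst]

lemma normConst_pos (hA : FoxHAssumption a α b β) : 0 < normConst a α b β :=
  gammaRatio_zero (a := a) (α := α) (b := b) (β := β) ▸ gammaRatio_pos hA 0

lemma gammaQuot_nat_add_one (l : ℕ) :
    gammaQuot a α b β (l + 1) = (gammaRatio a α b β l : ℂ) := by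
  simp only [gammaQuot, gammaRatio, Complex.ofReal_div, Complex.ofReal_prod, ← Complex.Gamma_ofReal]
  push_cast
  simp only [mul_comm]

variable (a α b β) in
/-- The probability measure on `(0, ∞)` whose density is the normalized Fox-H function. -/
def mixingMeasure : Measure ℝ :=
  (volume.restrict (Ioi 0)).withDensity
    (fun τ => ENNReal.ofReal (foxHReal a α b β τ / normConst a α b β))

lemma aemeasurable_foxHReal (hA : FoxHAssumption a α b β) :
    AEMeasurable (foxHReal a α b β) (volume.restrict (Ioi 0)) :=
  (continuousOn_foxHReal hA).aemeasurable measurableSet_Ioi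

lemma aemeasurable_mixingDensity (hA : FoxHAssumption a α b β) :
    AEMeasurable (fun τ => ENNReal.ofReal (foxHReal a α b β τ / normConst a α b β))
      (volume.restrict (Ioi 0)) :=
  ((aemeasurable_foxHReal hA).div_const _).ennreal_ofReal

lemma ae_mixingMeasure_pos : ∀ᵐ τ ∂mixingMeasure a α b β, 0 < τ :=
  (withDensity_absolutelyContinuous _ _).ae_le (ae_restrict_mem measurableSet_Ioi)

lemma integral_mixingMeasure {E : Type*} [NormedAddCommGroup E] [NormedSpace ℝ E]
    (hA : FoxHAssumption a α b β) (g : ℝ → E) :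
    ∫ τ, g τ ∂mixingMeasure a α b β =
      ∫ τ in Ioi (0 : ℝ), (foxHReal a α b β τ / normConst a α b β) • g τ := by
  rw [mixingMeasure, integral_withDensity_eq_integral_toReal_smul₀ (aemeasurable_mixingDensity hA)
    (Eventually.of_forall fun _ => ENNReal.ofReal_lt_top)]
  refine setIntegral_congr_fun measurableSet_Ioi fun τ hτ => ?_
  rw [ENNReal.toReal_ofReal (div_nonneg (hA.foxH_nonneg τ hτ) (normConst_pos hA).le)]

lemma integrable_mixingMeasure_iff {E : Type*} [NormedAddCommGroup E] [NormedSpace ℝ E]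
    (hA : FoxHAssumption a α b β) {g : ℝ → E} :
    Integrable g (mixingMeasure a α b β) ↔
      IntegrableOn (fun τ => (foxHReal a α b β τ / normConst a α b β) • g τ) (Ioi (0 : ℝ)) := by
  rw [mixingMeasure, integrable_withDensity_iff_integrable_smul₀' (aemeasurable_mixingDensity hA)
    (Eventually.of_forall fun _ => ENNReal.ofReal_lt_top)]
  refine integrableOn_congr_fun (fun τ hτ => ?_) measurableSet_Ioi
  rw [ENNReal.toReal_ofReal (div_nonneg (hA.foxH_nonneg τ hτ) (normConst_pos hA).le)]

/-- Complex moments of the mixing measure. -/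
lemma integral_cpow_mixingMeasure (hA : FoxHAssumption a α b β) {s : ℂ}
    (hs : ∀ j, 0 < b j + (1 + s).re * β j) :
    Integrable (fun τ : ℝ => (τ : ℂ) ^ s) (mixingMeasure a α b β) ∧
      ∫ τ : ℝ, (τ : ℂ) ^ s ∂mixingMeasure a α b β =
        gammaQuot a α b β (1 + s) / normConst a α b β := by
  have hfun : (fun τ : ℝ => (foxHReal a α b β τ / normConst a α b β) • (τ : ℂ) ^ s) =
      fun τ : ℝ => ((τ : ℂ) ^ (1 + s - 1) • (foxHReal a α b β τ : ℂ)) * (1 / normConst a α b β) := by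
    ext τ
    rw [add_sub_cancel_left, Complex.real_smul, smul_eq_mul]
    push_cast
    ring
  constructor
  · rw [integrable_mixingMeasure_iff hA, hfun]
    exact (mellinConvergent_foxHReal hA hs).mul_const _
  · rw [integral_mixingMeasure hA, hfun, integral_mul_const, ← mellin_foxHReal hA hs, mellin]
    ring

lemma integrable_rpow_mixingMeasure (hA : FoxHAssumption a α b β) {r : ℝ}
    (hr : ∀ j, 0 < b j + (1 + r) * β j) :
    Integrable (fun τ : ℝ => τ ^ r) (mixingMeasure a α b β) := by
  have h := (integral_cpow_mixingMeasure hA (s := r) (by simpa using hr)).1.re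
  refine h.congr ?_
  filter_upwards [ae_mixingMeasure_pos] with τ hτ
  simp [← Complex.ofReal_cpow hτ.le]

lemma nonneg_admissible (hA : FoxHAssumption a α b β) {r : ℝ} (hr : 0 ≤ r) (j : Fin m) :
    0 < b j + (1 + r) * β j :=
  foxHReal_assumption_pos hA (c := 1) (by simpa using hA.b_add_beta_pos) (by linarith) j

lemma integrable_pow_mixingMeasure (hA : FoxHAssumption a α b β) (l : ℕ) :
    Integrable (fun τ : ℝ => τ ^ l) (mixingMeasure a α b β) := by
  simpa using integrable_rpow_mixingMeasure hA (r := l) (nonneg_admissible hA (Nat.cast_nonneg l))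

/-- Moments of the mixing measure. -/
lemma integral_pow_mixingMeasure (hA : FoxHAssumption a α b β) (l : ℕ) :
    ∫ τ : ℝ, τ ^ l ∂mixingMeasure a α b β = gammaRatio a α b β l / normConst a α b β := by
  have h := (integral_cpow_mixingMeasure hA (s := (l : ℂ)) (by
    intro j
    have := nonneg_admissible hA (Nat.cast_nonneg l) j
    simpa using this)).2
  rw [add_comm, gammaQuot_nat_add_one] at h
  simp only [Complex.cpow_natCast] at h
  exact_mod_cast h

/-- The total mass is the zeroth moment, and the Gamma quotient at s = 1 equals K. -/
lemma isProbabilityMeasure_mixingMeasure (hA : FoxHAssumption a α b β) :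
    IsProbabilityMeasure (mixingMeasure a α b β) := by
  have h := integral_pow_mixingMeasure hA 0
  have hi := integrable_pow_mixingMeasure hA 0
  simp only [pow_zero, gammaRatio_zero, div_self (normConst_pos hA).ne', integral_const,
    smul_eq_mul, mul_one] at h hi
  have hf : IsFiniteMeasure (mixingMeasure a α b β) := by
    rwa [integrable_const_iff_isFiniteMeasure one_ne_zero] at hi
  constructor
  rw [Measure.real, ENNReal.toReal_eq_one_iff] at h
  exact h

/-! ### The Wright function as a Laplace transform -/

lemma genWrightTerm_eq (k : ℕ) (z : ℂ) :
    genWrightTerm (fun j => ((b j + β j : ℝ) : ℂ)) β (fun i => ((a i + α i : ℝ) : ℂ)) α z k =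
      gammaRatio a α b β k * (z ^ k / (k ! : ℂ)) := by
  rw [genWrightTerm, ← gammaQuot_nat_add_one, gammaQuot]
  have e : ∀ b β : ℝ, ((b + β : ℝ) : ℂ) + β * k = b + (k + 1) * β := by
    intro b β; push_cast; ring
  simp only [e]

/-- Up to K, the coefficients of the series are the moments of ν divided by k!. Expanding e^{-uτ}
under the integral is legitimate because the integrals of the absolute values sum exactly to the
absolutely convergent Wright series, divided by K. -/
lemma wrightPsi_of_summable (hA : FoxHAssumption a α b β) {u : ℝ}
    (h : Summable (genWrightTerm (fun j => ((b j + β j : ℝ) : ℂ)) β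
      (fun i => ((a i + α i : ℝ) : ℂ)) α ((-u : ℝ) : ℂ))) :
    1 / (normConst a α b β : ℂ) * wrightPsi a α b β ((-u : ℝ) : ℂ) =
      ((∫ τ, Real.exp (-(u * τ)) ∂mixingMeasure a α b β : ℝ) : ℂ) := by
  rw [wrightPsi, genWright, if_pos h]
  simp only [genWrightTerm_eq]
  have hnorm : Summable fun k : ℕ =>
      gammaRatio a α b β k / normConst a α b β * (|u| ^ k / (k ! : ℝ)) := by
    have := h.norm.mul_left (1 / normConst a α b β)
    refine this.congr fun k => ?_
    rw [genWrightTerm_eq, norm_mul, norm_div, norm_pow, Complex.norm_real, Complex.norm_real, Complex.norm_natCast,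
      Real.norm_of_nonneg (gammaRatio_pos hA k).le, Real.norm_eq_abs, abs_neg]
    ring
  have hint : ∀ k : ℕ, Integrable (fun τ : ℝ => (-u) ^ k / (k ! : ℝ) * τ ^ k)
      (mixingMeasure a α b β) := fun k => (integrable_pow_mixingMeasure hA k).const_mul _
  have hs := hasSum_integral_of_summable_integral_norm hint (by
    refine hnorm.congr fun k => ?_
    rw [← integral_pow_mixingMeasure hA, mul_comm, ← integral_const_mul]
    refine integral_congr_ae ?_
    filter_upwards [ae_mixingMeasure_pos] with τ hτ
    rw [norm_mul, norm_div, norm_pow, norm_pow, Real.norm_of_nonneg hτ.le, Real.norm_eq_abs,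
      abs_neg, Real.norm_natCast])
  have he : ∀ τ : ℝ, ∑' k : ℕ, (-u) ^ k / (k ! : ℝ) * τ ^ k = Real.exp (-(u * τ)) := by
    intro τ
    rw [Real.exp_eq_exp_ℝ, NormedSpace.exp_eq_tsum_div]
    refine tsum_congr fun k => ?_
    rw [← neg_mul, mul_pow]; ring
  simp only [he, integral_const_mul, integral_pow_mixingMeasure hA] at hs
  rw [← hs.tsum_eq, Complex.ofReal_tsum, ← tsum_mul_left]
  refine tsum_congr fun k => ?_
  push_cast
  ring

/-- Γ is itself a Gamma quotient, with m = 1, p = 0, b = 0, β = 1 and a* = 1, so the general strip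
estimate covers it. -/
lemma integrable_Gamma_line {γ : ℝ} (hγ : 0 < γ) :
    Integrable fun y : ℝ => Complex.Gamma (γ + y * Complex.I) := by
  obtain ⟨ρ, hρ, C, -, h⟩ := exists_norm_gammaQuot_le (m := 1) (p := 0) (a := fun _ => 0)
    (α := fun _ => 1) (b := fun _ => 0) (β := fun _ => 1) (c := γ) (d := γ) (by simp) (by simp)
    (by simp [aStar]) (by simpa using hγ)
  have hc := continuous_gammaQuot_line (m := 1) (p := 0) (a := fun _ => 0)
    (α := fun _ => 1) (b := fun _ => 0) (β := fun _ => 1) (σ := γ) (by simpa using hγ)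
  refine (integrable_of_norm_le_one_add_rpow hc hρ (h γ ⟨le_rfl, le_rfl⟩)).congr
    (Eventually.of_forall fun y => ?_)
  simp [gammaQuot]

lemma mellinInv_Gamma {γ x : ℝ} (hγ : 0 < γ) (hx : 0 < x) :
    mellinInv γ Complex.Gamma x = Real.exp (-x) := by
  have hG : ∀ y : ℝ, mellin (fun x : ℝ => ((Real.exp (-x) : ℝ) : ℂ)) (γ + y * Complex.I) =
      Complex.Gamma (γ + y * Complex.I) := by
    intro y
    rw [Complex.Gamma_eq_integral (by simpa using hγ), Complex.GammaIntegral_eq_mellin]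
  have h := mellinInv_mellin_eq γ (fun x : ℝ => ((Real.exp (-x) : ℝ) : ℂ)) hx ?_ ?_ (by fun_prop)
  · rw [← h, mellinInv, mellinInv]
    simp only [hG]
  · have := Complex.GammaIntegral_convergent (s := γ) (by simpa using hγ)
    refine this.congr_fun (fun x _ => ?_) measurableSet_Ioi
    simp [mul_comm]
  · simp only [Complex.VerticalIntegrable, hG]
    exact integrable_Gamma_line hγ

/-- The lower pair (0, 1) supplies Γ(s), the Mellin transform of e^{-x}; the remaining factors are
the Mellin transform of the Fox-H function at 1 - s. Such a product is the Mellin transform of a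
Laplace transform. -/
lemma foxHKernel_wright (s : ℂ) :
    foxHKernel 1 m (fun j => 1 - ((b j + β j : ℝ) : ℂ)) β
      (Fin.cons 0 (fun i => 1 - ((a i + α i : ℝ) : ℂ)) : Fin (p + 1) → ℂ)
      (Fin.cons 1 α : Fin (p + 1) → ℝ) s = Complex.Gamma s * gammaQuot a α b β (1 - s) := by
  have h1 : (Finset.univ.filter fun j : Fin m => j.val < m) = Finset.univ := by ext j; simp
  have h2 : (Finset.univ.filter fun j : Fin m => m ≤ j.val) = ∅ := by ext j; simp
  have h3 : (Finset.univ.filter fun j : Fin (p + 1) => j.val < 1) = {0} := by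
    ext j
    simp only [Finset.mem_filter, Finset.mem_univ, true_and, Finset.mem_singleton, Nat.lt_one_iff,
      Fin.ext_iff, Fin.val_zero]
  have h4 : (Finset.univ.filter fun j : Fin (p + 1) => 1 ≤ j.val) =
      Finset.univ.map (Fin.succEmb p) := by
    ext j
    simp only [Finset.mem_filter, Finset.mem_univ, true_and, Finset.mem_map, Fin.coe_succEmb]
    constructor
    · intro h
      exact ⟨j.pred (by rintro rfl; simp at h), by simp⟩
    · rintro ⟨i, rfl⟩; simp
  have e : ∀ b β : ℝ, 1 - (1 - ((b + β : ℝ) : ℂ)) - s * β = b + (1 - s) * β := by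
    intro b β; push_cast; ring
  simp only [foxHKernel, gammaQuot, h1, h2, h3, h4, Finset.prod_map, Fin.coe_succEmb,
    Fin.cons_succ, Finset.prod_singleton, Fin.cons_zero, e, Finset.prod_empty]
  simp [mul_div_assoc]

lemma separatesPoles_wright (hA : FoxHAssumption a α b β) {γ : ℝ} :
    SeparatesPoles 1 m (fun j => 1 - ((b j + β j : ℝ) : ℂ)) β
      (Fin.cons 0 (fun i => 1 - ((a i + α i : ℝ) : ℂ)) : Fin (p + 1) → ℂ)
      (Fin.cons 1 α : Fin (p + 1) → ℝ) γ ↔ 0 < γ ∧ ∀ j, 0 < b j + (1 - γ) * β j := by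
  have e : ∀ (j : Fin m) (k : ℕ),
      γ < ((1 - (1 - ((b j + β j : ℝ) : ℂ)) + k) / (β j : ℂ)).re ↔
        0 < b j + (1 - γ) * β j + k := by
    intro j k
    rw [Complex.div_ofReal_re, lt_div_iff₀ (hA.beta_pos j), sub_sub_cancel]
    simp only [Complex.add_re, Complex.ofReal_re, Complex.natCast_re]
    constructor <;> intro h <;> linarith
  constructor
  · rintro ⟨h1, h2⟩
    refine ⟨by simpa using h1 0 (by simp) 0, fun j => ?_⟩
    simpa using (e j 0).1 (h2 j j.2 0)
  · rintro ⟨h1, h2⟩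
    refine ⟨fun j hj l => ?_, fun j _ k => (e j k).2 (by have := h2 j; positivity)⟩
    have hj0 : j = 0 := by ext; simpa using hj
    subst hj0
    have : (0 : ℝ) ≤ l := Nat.cast_nonneg l
    simp
    linarith

/-- The Gamma quotient at 1 - s is K ∫ τ^{-s} dν. After Fubini the inner contour integral is the
inverse Mellin transform of Γ at uτ, that is e^{-uτ}. -/
lemma wrightPsi_of_not_summable (hA : FoxHAssumption a α b β) {u : ℝ} (hu : 0 < u)
    (h : ¬ Summable (genWrightTerm (fun j => ((b j + β j : ℝ) : ℂ)) β
      (fun i => ((a i + α i : ℝ) : ℂ)) α ((-u : ℝ) : ℂ))) :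
    1 / (normConst a α b β : ℂ) * wrightPsi a α b β ((-u : ℝ) : ℂ) =
      ((∫ τ, Real.exp (-(u * τ)) ∂mixingMeasure a α b β : ℝ) : ℂ) := by
  have hK := normConst_pos hA
  have := isProbabilityMeasure_mixingMeasure hA
  have hex : ∃ γ : ℝ, SeparatesPoles 1 m (fun j => 1 - ((b j + β j : ℝ) : ℂ)) β
      (Fin.cons 0 (fun i => 1 - ((a i + α i : ℝ) : ℂ)) : Fin (p + 1) → ℂ)
      (Fin.cons 1 α : Fin (p + 1) → ℝ) γ := by
    obtain ⟨c, hc1, hc⟩ := exists_lt_admissible (b := b) (β := β) (σ := 1)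
      (by simpa using hA.b_add_beta_pos)
    -- An admissible c < 1 gives γ = 1 - c > 0 for which the negative moment of order γ of ν is
    -- still finite.
    exact ⟨1 - c, (separatesPoles_wright hA).2 ⟨by linarith, by simpa using hc⟩⟩
  rw [wrightPsi, genWright, if_neg h, foxH, dif_pos hex]
  obtain ⟨hγ, hγb⟩ := (separatesPoles_wright hA).1 hex.choose_spec
  set γ := hex.choose
  clear_value γ
  set ν := mixingMeasure a α b β
  rw [mellinBarnes]
  simp only [foxHKernel_wright]
  have hM : ∀ y : ℝ, gammaQuot a α b β (1 - (γ + y * Complex.I)) =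
      normConst a α b β * ∫ τ : ℝ, (τ : ℂ) ^ (-(γ + y * Complex.I)) ∂ν := by
    intro y
    rw [(integral_cpow_mixingMeasure hA (s := -(γ + y * Complex.I))
      (by simpa [sub_eq_add_neg] using hγb)).2, ← sub_eq_add_neg,
      mul_div_cancel₀ _ (Complex.ofReal_ne_zero.2 hK.ne')]
  have hneg : -((-u : ℝ) : ℂ) = (u : ℂ) := by push_cast; ring
  have hF : ∀ y : ℝ, Complex.Gamma (γ + y * Complex.I) *
      gammaQuot a α b β (1 - (γ + y * Complex.I)) * (-((-u : ℝ) : ℂ)) ^ (-(γ + y * Complex.I)) =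
      normConst a α b β * ∫ τ : ℝ, Complex.Gamma (γ + y * Complex.I) *
        ((u : ℂ) ^ (-(γ + y * Complex.I)) * (τ : ℂ) ^ (-(γ + y * Complex.I))) ∂ν := by
    intro y
    rw [hM, hneg, integral_const_mul, integral_const_mul]
    ring
  simp only [hF]
  rw [integral_const_mul, integral_integral_swap]
  · have hin : ∀ᵐ τ : ℝ ∂ν, ∫ y : ℝ, Complex.Gamma (γ + y * Complex.I) *
        ((u : ℂ) ^ (-(γ + y * Complex.I)) * (τ : ℂ) ^ (-(γ + y * Complex.I))) =
        2 * Real.pi * ((Real.exp (-(u * τ)) : ℝ) : ℂ) := by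
      filter_upwards [ae_mixingMeasure_pos] with τ hτ
      rw [← mellinInv_Gamma hγ (mul_pos hu hτ), mellinInv, Complex.real_smul]
      push_cast
      rw [← mul_assoc, mul_one_div_cancel (by exact_mod_cast (show 2 * Real.pi ≠ 0 by positivity)),
        one_mul]
      refine integral_congr_ae (Eventually.of_forall fun y => ?_)
      simp only [smul_eq_mul]
      rw [Complex.mul_cpow_ofReal_nonneg hu.le hτ.le]
      ring
    rw [integral_congr_ae hin, integral_const_mul, integral_complex_ofReal]
    have h1 : (normConst a α b β : ℂ) ≠ 0 := Complex.ofReal_ne_zero.2 hK.ne'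
    have h2 : (Real.pi : ℂ) ≠ 0 := Complex.ofReal_ne_zero.2 Real.pi_ne_zero
    field_simp
  -- The modulus of the integrand splits as |Γ(γ + iy)| times u^{-γ} τ^{-γ}, a product of two
  -- integrable functions of separate variables.
  · have hi := ((integrable_Gamma_line hγ).norm.mul_prod
      ((integrable_rpow_mixingMeasure hA (r := -γ)
        (by simpa [sub_eq_add_neg] using hγb)).const_mul (u ^ (-γ))))
    refine hi.mono' ?_ ?_
    · have hm : AEStronglyMeasurable (fun q : ℝ × ℝ => Complex.Gamma (γ + q.1 * Complex.I))
          (volume.prod ν) :=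
        (integrable_Gamma_line hγ).aestronglyMeasurable.comp_fst
      refine hm.mul (Measurable.aestronglyMeasurable ?_)
      fun_prop
    · have hpos : ∀ᵐ q ∂(volume : Measure ℝ).prod ν, 0 < q.2 :=
        Measure.quasiMeasurePreserving_snd.ae ae_mixingMeasure_pos
      filter_upwards [hpos] with q hq
      simp only [Function.uncurry, norm_mul]
      rw [norm_ofReal_cpow_neg hu, norm_ofReal_cpow_neg hq]

/-- The normalized generalized Wright function is the Laplace transform of the mixing measure. -/
lemma wrightPsi_eq_laplace (hA : FoxHAssumption a α b β) {u : ℝ} (hu : 0 ≤ u) :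
    1 / (normConst a α b β : ℂ) * wrightPsi a α b β ((-u : ℝ) : ℂ) =
      ((∫ τ, Real.exp (-(u * τ)) ∂mixingMeasure a α b β : ℝ) : ℂ) := by
  by_cases h : Summable (genWrightTerm (fun j => ((b j + β j : ℝ) : ℂ)) β
      (fun i => ((a i + α i : ℝ) : ℂ)) α ((-u : ℝ) : ℂ))
  · exact wrightPsi_of_summable hA h
  -- At u = 0 only the term k = 0 survives and the series converges, so the contour representation
  -- is met only for u > 0.
  · refine wrightPsi_of_not_summable hA (hu.lt_of_ne ?_) h
    rintro rfl
    refine h (summable_of_ne_finset_zero (s := {0}) fun k hk => ?_)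
    simp at hk
    simp [genWrightTerm, hk]

end Mixing

/-! ### Gaussian scale mixtures -/

lemma integral_gaussianReal_odd_pow (n : ℕ) :
    ∫ z, z ^ (2 * n + 1) ∂ProbabilityTheory.gaussianReal 0 1 = 0 := by
  have h : (ProbabilityTheory.gaussianReal 0 1).map (fun z => -z) =
      ProbabilityTheory.gaussianReal 0 1 := by
    rw [ProbabilityTheory.gaussianReal_map_neg, neg_zero]
  have h2 : ∫ z, z ^ (2 * n + 1) ∂ProbabilityTheory.gaussianReal 0 1 =
      ∫ z, (-z) ^ (2 * n + 1) ∂ProbabilityTheory.gaussianReal 0 1 := by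
    conv_lhs => rw [← h]
    rw [integral_map (by fun_prop) (by fun_prop)]
  have h3 : ∀ z : ℝ, (-z) ^ (2 * n + 1) = -(z ^ (2 * n + 1)) := fun z =>
    Odd.neg_pow ⟨n, rfl⟩ z
  simp only [h3, integral_neg] at h2
  linarith

/-- The integral is a Gamma value at n + 1/2, hence a double factorial (2n - 1)!!, and (2n)! = (2n -
1)!! 2^n n!. -/
lemma integral_gaussianReal_even_pow (n : ℕ) :
    ∫ z, z ^ (2 * n) ∂ProbabilityTheory.gaussianReal 0 1 =
      ((2 * n)! : ℝ) / ((n ! : ℝ) * 2 ^ n) := by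
  rw [ProbabilityTheory.integral_gaussianReal_eq_integral_smul one_ne_zero]
  have h1 : ∀ z : ℝ, ProbabilityTheory.gaussianPDFReal 0 1 z • z ^ (2 * n) =
      (Real.sqrt (2 * Real.pi))⁻¹ * (|z| ^ (2 * n : ℝ) * Real.exp (-(1 / 2) * |z| ^ (2 : ℝ))) := by
    intro z
    have : |z| ^ (2 * n : ℝ) = z ^ (2 * n) := by
      rw [← Nat.cast_ofNat, ← Nat.cast_mul, Real.rpow_natCast, pow_mul, sq_abs, ← pow_mul]
    rw [this, Real.rpow_two, sq_abs, ProbabilityTheory.gaussianPDFReal]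
    simp only [NNReal.coe_one, mul_one, sub_zero, smul_eq_mul]
    rw [show -z ^ 2 / 2 = -(1 / 2) * z ^ 2 by ring]
    ring
  simp only [h1]
  rw [integral_const_mul, integral_comp_abs
    (f := fun x : ℝ => x ^ (2 * n : ℝ) * Real.exp (-(1 / 2) * x ^ (2 : ℝ))),
    integral_rpow_mul_exp_neg_mul_rpow two_pos
      (by have : (0 : ℝ) ≤ n := Nat.cast_nonneg n; linarith) (by norm_num : (0 : ℝ) < 1 / 2)]
  have e1 : ((2 * n : ℝ) + 1) / 2 = n + 1 / 2 := by ring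
  rw [e1, Real.Gamma_nat_add_half]
  have e2 : (1 / 2 : ℝ) ^ (-(2 * (n : ℝ) + 1) / 2) = 2 ^ n * Real.sqrt 2 := by
    rw [one_div, Real.inv_rpow two_pos.le, ← Real.rpow_neg two_pos.le,
      show -(-(2 * (n : ℝ) + 1) / 2) = n + 1 / 2 by ring, Real.rpow_add two_pos,
      Real.rpow_natCast, Real.sqrt_eq_rpow]
  rw [e2, Real.sqrt_mul two_pos.le]
  have hs2 : Real.sqrt 2 ≠ 0 := by positivity
  have hsp : Real.sqrt Real.pi ≠ 0 := (Real.sqrt_pos.2 Real.pi_pos).ne'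
  have hd : ((2 * n)! : ℝ) = ((2 * n - 1)‼ : ℕ) * (2 ^ n * n !) := by
    rcases n with _ | k
    · simp
    · rw [show 2 * (k + 1) = (2 * k + 1) + 1 by ring, Nat.factorial_eq_mul_doubleFactorial,
        show 2 * k + 1 + 1 = 2 * (k + 1) by ring, Nat.doubleFactorial_two_mul,
        show 2 * (k + 1) - 1 = 2 * k + 1 by omega]
      push_cast
      ring
  rw [hd]
  have : (n ! : ℝ) ≠ 0 := by positivity
  field_simp

lemma integrable_pow_gaussianReal (k : ℕ) :
    Integrable (fun z : ℝ => z ^ k) (ProbabilityTheory.gaussianReal 0 1) := by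
  have h := ProbabilityTheory.memLp_id_gaussianReal (μ := 0) (v := 1) k
  have h2 : Integrable (fun z : ℝ => ‖z‖ ^ k) (ProbabilityTheory.gaussianReal 0 1) :=
    MemLp.integrable_norm_pow' h
  exact h2.mono' (by fun_prop) (Eventually.of_forall fun z => (norm_pow z k).le)

section Mixture

variable {Ω : Type*} [MeasurableSpace Ω] {P : Measure Ω} [IsProbabilityMeasure P]
  {ν : Measure ℝ} [IsProbabilityMeasure ν] {Y : Ω → ℝ} {v : ℝ}

/-- A random variable whose characteristic function is `s ↦ ∫ e^{-s² v τ / 2} dν(τ)` is distributed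
as `√τ √v z` with independent `τ ∼ ν` and a standard Gaussian `z`. -/
lemma map_eq_gaussian_mixture (hν : ∀ᵐ τ ∂ν, 0 < τ) (hY : AEMeasurable Y P) (hv : 0 ≤ v)
    (h : ∀ s : ℝ, ∫ ω, Complex.exp (Complex.I * ((s * Y ω : ℝ) : ℂ)) ∂P =
      ((∫ τ, Real.exp (-(s ^ 2 * v / 2 * τ)) ∂ν : ℝ) : ℂ)) :
    P.map Y = (ν.prod (ProbabilityTheory.gaussianReal 0 1)).map
      (fun q : ℝ × ℝ => Real.sqrt q.1 * Real.sqrt v * q.2) := by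
  have hm : Measurable fun q : ℝ × ℝ => Real.sqrt q.1 * Real.sqrt v * q.2 := by fun_prop
  have := Measure.isProbabilityMeasure_map hY
  have := Measure.isProbabilityMeasure_map (μ := ν.prod (ProbabilityTheory.gaussianReal 0 1))
    hm.aemeasurable
  refine Measure.ext_of_charFun (funext fun s => ?_)
  rw [charFun_apply_real, charFun_apply_real, integral_map hY (by fun_prop),
    integral_map hm.aemeasurable (by fun_prop)]
  have hl : ∀ ω, Complex.exp (s * Y ω * Complex.I) =
      Complex.exp (Complex.I * ((s * Y ω : ℝ) : ℂ)) := by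
    intro ω; push_cast; ring_nf
  simp only [hl]
  rw [h, integral_prod, ← integral_complex_ofReal]
  · refine integral_congr_ae ?_
    filter_upwards [hν] with τ hτ
    have := ProbabilityTheory.charFun_gaussianReal (μ := 0) (v := 1)
      (s * (Real.sqrt τ * Real.sqrt v))
    rw [charFun_apply_real] at this
    simp only [Complex.ofReal_mul, Complex.ofReal_exp] at this ⊢
    have e : ∀ z : ℝ, (s : ℂ) * (Real.sqrt τ * Real.sqrt v * z) * Complex.I =
      s * (Real.sqrt τ * Real.sqrt v) * z * Complex.I := by intro z; ring
    simp only [e, this]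
    congr 1
    have h1 : ((Real.sqrt τ : ℝ) : ℂ) ^ 2 = τ := by
      rw [← Complex.ofReal_pow, Real.sq_sqrt hτ.le]
    have h2 : ((Real.sqrt v : ℝ) : ℂ) ^ 2 = v := by
      rw [← Complex.ofReal_pow, Real.sq_sqrt hv]
    rw [mul_pow, mul_pow, h1, h2]
    push_cast
    ring
  · refine Integrable.of_bound (Measurable.aestronglyMeasurable (by fun_prop)) 1
      (Eventually.of_forall fun q => ?_)
    rw [← Complex.ofReal_mul, Complex.norm_exp_ofReal_mul_I]

lemma integrable_sqrt_pow (hν : ∀ᵐ τ ∂ν, 0 < τ) (hi : ∀ l : ℕ, Integrable (fun τ : ℝ => τ ^ l) ν)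
    (k : ℕ) : Integrable (fun τ : ℝ => Real.sqrt τ ^ k) ν := by
  refine ((integrable_const (1 : ℝ)).add (hi k)).mono'
    (Measurable.aestronglyMeasurable (by fun_prop)) ?_
  filter_upwards [hν] with τ hτ
  rw [Real.norm_of_nonneg (by positivity)]
  simp only [Pi.add_apply]
  rcases le_total τ 1 with h | h
  · have : Real.sqrt τ ^ k ≤ 1 := pow_le_one₀ (Real.sqrt_nonneg _) (Real.sqrt_le_one.2 h)
    have : 0 ≤ τ ^ k := by positivity
    linarith
  · have : Real.sqrt τ ^ k ≤ τ ^ k := by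
      refine pow_le_pow_left₀ (Real.sqrt_nonneg _) ?_ k
      rw [Real.sqrt_le_left hτ.le]; nlinarith
    linarith

/-- Under the product law τ and z are independent, so the moment of √τ √v z factors. The
half-integer moments of ν are finite since √τ^k ≤ 1 + τ^k. -/
lemma moments_of_gaussian_mixture (hν : ∀ᵐ τ ∂ν, 0 < τ)
    (hi : ∀ l : ℕ, Integrable (fun τ : ℝ => τ ^ l) ν) (hY : AEMeasurable Y P) (hv : 0 ≤ v)
    (h : ∀ s : ℝ, ∫ ω, Complex.exp (Complex.I * ((s * Y ω : ℝ) : ℂ)) ∂P =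
      ((∫ τ, Real.exp (-(s ^ 2 * v / 2 * τ)) ∂ν : ℝ) : ℂ)) (k : ℕ) :
    Integrable (fun ω => Y ω ^ k) P ∧ ∫ ω, Y ω ^ k ∂P =
      (∫ τ, Real.sqrt τ ^ k ∂ν) * Real.sqrt v ^ k *
        ∫ z, z ^ k ∂ProbabilityTheory.gaussianReal 0 1 := by
  have hlaw := map_eq_gaussian_mixture hν hY hv h
  have hm : Measurable fun q : ℝ × ℝ => Real.sqrt q.1 * Real.sqrt v * q.2 := by fun_prop
  have hp : Measurable fun x : ℝ => x ^ k := by fun_prop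
  have hI : Integrable (fun q : ℝ × ℝ => (Real.sqrt q.1 ^ k * Real.sqrt v ^ k) * q.2 ^ k)
      (ν.prod (ProbabilityTheory.gaussianReal 0 1)) :=
    ((integrable_sqrt_pow hν hi k).mul_const _).mul_prod (integrable_pow_gaussianReal k)
  constructor
  · have h1 : Integrable (fun x : ℝ => x ^ k) (P.map Y) := by
      rw [hlaw, integrable_map_measure hp.aestronglyMeasurable hm.aemeasurable]
      refine hI.congr (Eventually.of_forall fun q => ?_)
      simp only [Function.comp, mul_pow]
    exact (integrable_map_measure hp.aestronglyMeasurable hY).1 h1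
  · rw [← integral_map (f := fun x : ℝ => x ^ k) hY hp.aestronglyMeasurable, hlaw,
      integral_map hm.aemeasurable hp.aestronglyMeasurable]
    simp only [mul_pow]
    rw [integral_prod_mul (fun τ : ℝ => Real.sqrt τ ^ k * Real.sqrt v ^ k) (fun z : ℝ => z ^ k),
      integral_mul_const]

lemma odd_moment_of_gaussian_mixture (hν : ∀ᵐ τ ∂ν, 0 < τ)
    (hi : ∀ l : ℕ, Integrable (fun τ : ℝ => τ ^ l) ν) (hY : AEMeasurable Y P) (hv : 0 ≤ v)
    (h : ∀ s : ℝ, ∫ ω, Complex.exp (Complex.I * ((s * Y ω : ℝ) : ℂ)) ∂P =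
      ((∫ τ, Real.exp (-(s ^ 2 * v / 2 * τ)) ∂ν : ℝ) : ℂ)) (n : ℕ) :
    ∫ ω, Y ω ^ (2 * n + 1) ∂P = 0 := by
  rw [(moments_of_gaussian_mixture hν hi hY hv h _).2, integral_gaussianReal_odd_pow, mul_zero]

lemma even_moment_of_gaussian_mixture (hν : ∀ᵐ τ ∂ν, 0 < τ)
    (hi : ∀ l : ℕ, Integrable (fun τ : ℝ => τ ^ l) ν) (hY : AEMeasurable Y P) (hv : 0 ≤ v)
    (h : ∀ s : ℝ, ∫ ω, Complex.exp (Complex.I * ((s * Y ω : ℝ) : ℂ)) ∂P =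
      ((∫ τ, Real.exp (-(s ^ 2 * v / 2 * τ)) ∂ν : ℝ) : ℂ)) (n : ℕ) :
    ∫ ω, Y ω ^ (2 * n) ∂P =
      (∫ τ, τ ^ n ∂ν) * v ^ n * (((2 * n)! : ℝ) / ((n ! : ℝ) * 2 ^ n)) := by
  rw [(moments_of_gaussian_mixture hν hi hY hv h _).2, integral_gaussianReal_even_pow,
    pow_mul (Real.sqrt v), Real.sq_sqrt hv]
  congr 2
  refine integral_congr_ae ?_
  filter_upwards [hν] with τ hτ
  rw [pow_mul, Real.sq_sqrt hτ.le]

end Mixture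

/-! ### The extended dual pairing -/

lemma toReal_eLpNorm_two_sq {X : Type*} [MeasurableSpace X] {P : Measure X} {g : X → ℝ}
    (hg : MemLp g 2 P) : (eLpNorm g 2 P).toReal ^ 2 = ∫ x, g x ^ 2 ∂P := by
  rw [hg.eLpNorm_eq_integral_rpow_norm two_ne_zero ENNReal.ofNat_ne_top]
  have h0 : 0 ≤ ∫ x, ‖g x‖ ^ (2 : ℝ≥0∞).toReal ∂P :=
    integral_nonneg fun x => by positivity
  rw [ENNReal.toReal_ofReal (by positivity), ← Real.rpow_natCast, ← Real.rpow_mul h0]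
  simp

lemma measurable_apply_schwartz (ξ : 𝓢(ℝ, ℝ)) : Measurable fun ω : RealTempered => ω ξ := by
  have h : MeasurableSpace.comap (fun ω : RealTempered => ω ξ) (borel ℝ) ≤ cylinderSigma :=
    le_iSup (fun ξ : 𝓢(ℝ, ℝ) =>
      MeasurableSpace.comap (fun ω : RealTempered => ω ξ) (borel ℝ)) ξ
  rw [measurable_iff_comap_le, BorelSpace.measurable_eq (α := ℝ)]
  exact h

section Pairing

variable {m p : ℕ} {a α : Fin p → ℝ} {b β : Fin m → ℝ} {μ : Measure RealTempered}

lemma charFun_apply_schwartz (hA : FoxHAssumption a α b β) (hμ : IsFoxHMeasure a α b β μ)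
    (ξ : 𝓢(ℝ, ℝ)) :
    ∫ ω : RealTempered, Complex.exp (Complex.I * (ω ξ : ℂ)) ∂μ =
      ((∫ τ, Real.exp (-((∫ x, ξ x ^ 2) / 2 * τ)) ∂mixingMeasure a α b β : ℝ) : ℂ) := by
  rw [hμ.charFunctional, neg_div, wrightPsi_eq_laplace hA]
  exact div_nonneg (integral_nonneg fun x => sq_nonneg _) two_pos.le

lemma charFun_apply_schwartz_mul (hA : FoxHAssumption a α b β) (hμ : IsFoxHMeasure a α b β μ)
    (ξ : 𝓢(ℝ, ℝ)) (s : ℝ) :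
    ∫ ω : RealTempered, Complex.exp (Complex.I * ((s * ω ξ : ℝ) : ℂ)) ∂μ =
      ((∫ τ, Real.exp (-(s ^ 2 * (∫ x, ξ x ^ 2) / 2 * τ)) ∂mixingMeasure a α b β : ℝ) : ℂ) := by
  have h := charFun_apply_schwartz hA hμ (s • ξ)
  simp only [map_smul, smul_eq_mul, _root_.smul_apply, mul_pow, integral_const_mul] at h
  exact h

/-- The second moment of the mixture is the mean of ν times the squared L²-norm of the test
function; this makes the pairing a multiple of an isometry. -/
lemma memLp_apply_schwartz (hA : FoxHAssumption a α b β) (hμ : IsFoxHMeasure a α b β μ)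
    (ξ : 𝓢(ℝ, ℝ)) : MemLp (fun ω : RealTempered => ω ξ) 2 μ ∧
      ∫ ω : RealTempered, ω ξ ^ 2 ∂μ = (∫ τ, τ ∂mixingMeasure a α b β) * ∫ x, ξ x ^ 2 := by
  have := hμ.isProbabilityMeasure
  have := isProbabilityMeasure_mixingMeasure hA
  have hm := measurable_apply_schwartz ξ
  have hv : 0 ≤ ∫ x, ξ x ^ 2 := integral_nonneg fun x => sq_nonneg _
  have hc := charFun_apply_schwartz_mul hA hμ ξ
  have hi := integrable_pow_mixingMeasure hA
  have h1 := (moments_of_gaussian_mixture ae_mixingMeasure_pos hi hm.aemeasurable hv hc 2).1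
  have h2 := even_moment_of_gaussian_mixture ae_mixingMeasure_pos hi hm.aemeasurable hv hc 1
  refine ⟨(memLp_two_iff_integrable_sq hm.aestronglyMeasurable).2 h1, ?_⟩
  norm_num at h2
  exact h2

variable (a α b β) in
/-- The square root of the mean of the mixing measure. -/
def mixingScale : ℝ := Real.sqrt (∫ τ, τ ∂mixingMeasure a α b β)

lemma eLpNorm_apply_schwartz (hA : FoxHAssumption a α b β) (hμ : IsFoxHMeasure a α b β μ)
    (ξ : 𝓢(ℝ, ℝ)) : (eLpNorm (fun ω : RealTempered => ω ξ) 2 μ).toReal =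
      mixingScale a α b β * ‖ξ.toLp 2 (volume : Measure ℝ)‖ := by
  obtain ⟨h1, h2⟩ := memLp_apply_schwartz hA hμ ξ
  have h3 := toReal_eLpNorm_two_sq h1
  have h4 := toReal_eLpNorm_two_sq (ξ.memLp 2 (volume : Measure ℝ))
  have h5 : 0 ≤ ∫ τ, τ ∂mixingMeasure a α b β :=
    integral_nonneg_of_ae (by filter_upwards [ae_mixingMeasure_pos] with τ hτ using hτ.le)
  have h6 : 0 ≤ mixingScale a α b β := Real.sqrt_nonneg _
  rw [← sq_eq_sq₀ ENNReal.toReal_nonneg (mul_nonneg h6 (norm_nonneg _)), h3, h2, mul_pow, SchwartzMap.norm_toLp, h4, mixingScale, Real.sq_sqrt h5]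

/-- Schwartz functions are dense in L²(ℝ) and the pairing multiplies distances by a constant, so it
sends Cauchy sequences to Cauchy sequences in the complete space L²(μ). -/
lemma exists_isL2Pairing (hA : FoxHAssumption a α b β) (hμ : IsFoxHMeasure a α b β μ)
    {f : ℝ → ℝ} (hf : MemLp f 2 volume) : ∃ Y, IsL2Pairing μ f Y := by
  have hd := SchwartzMap.denseRange_toLpCLM (E := ℝ) (F := ℝ) (p := 2) (by simp)
    (μ := (volume : Measure ℝ)) (hf.toLp f)
  obtain ⟨x, hx, hlim⟩ := mem_closure_iff_seq_limit.1 hd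
  choose ξ hξ using hx
  have hlim' : Tendsto (fun k => (ξ k).toLp 2 (volume : Measure ℝ)) atTop (𝓝 (hf.toLp f)) := by
    exact hlim.congr fun k => (hξ k).symm
  have hmem := fun ξ : 𝓢(ℝ, ℝ) => (memLp_apply_schwartz hA hμ ξ).1
  set T : ℕ → Lp ℝ 2 μ := fun k => (hmem (ξ k)).toLp _ with hT
  have hdist : ∀ k l, dist (T k) (T l) = mixingScale a α b β *
      dist ((ξ k).toLp 2 (volume : Measure ℝ)) ((ξ l).toLp 2 (volume : Measure ℝ)) := by
    intro k l
    have h1 := eLpNorm_apply_schwartz hA hμ (ξ k - ξ l)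
    have h2 : (ξ k - ξ l).toLp 2 (volume : Measure ℝ) =
        (ξ k).toLp 2 (volume : Measure ℝ) - (ξ l).toLp 2 (volume : Measure ℝ) :=
      map_sub (SchwartzMap.toLpCLM ℝ ℝ 2 (volume : Measure ℝ)) (ξ k) (ξ l)
    rw [h2, ← dist_eq_norm] at h1
    rw [← h1, dist_eq_norm, hT]
    simp only
    rw [← MemLp.toLp_sub, Lp.norm_toLp]
    simp only [map_sub]
    rfl
  have hcauchy : CauchySeq T := by
    have hc := hlim'.cauchySeq
    rw [Metric.cauchySeq_iff] at hc ⊢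
    intro ε hε
    have hs : 0 ≤ mixingScale a α b β := Real.sqrt_nonneg _
    -- The summand 1 avoids having to know that the scale is nonzero.
    obtain ⟨N, hN⟩ := hc (ε / (mixingScale a α b β + 1)) (by positivity)
    refine ⟨N, fun k hk l hl => ?_⟩
    rw [hdist]
    have := hN k hk l hl
    rw [lt_div_iff₀ (by positivity)] at this
    have := dist_nonneg (x := (ξ k).toLp 2 (volume : Measure ℝ))
      (y := (ξ l).toLp 2 (volume : Measure ℝ))
    linarith
  obtain ⟨y, hy⟩ := cauchySeq_tendsto_of_complete hcauchy
  refine ⟨y, Lp.memLp y, ξ, ?_, ?_⟩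
  · exact (Lp.tendsto_Lp_iff_tendsto_eLpNorm'' _ (fun k => (ξ k).memLp 2 volume) f hf).1 hlim'
  · rw [Lp.tendsto_Lp_iff_tendsto_eLpNorm'] at hy
    refine hy.congr fun k => eLpNorm_congr_ae ?_
    filter_upwards [(hmem (ξ k)).coeFn_toLp] with ω hω
    simp only [Pi.sub_apply, hT, hω]

lemma isL2Pairing_l2Pairing (hA : FoxHAssumption a α b β) (hμ : IsFoxHMeasure a α b β μ)
    {f : ℝ → ℝ} (hf : MemLp f 2 volume) : IsL2Pairing μ f (l2Pairing μ f) := by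
  have h := exists_isL2Pairing hA hμ hf
  rw [l2Pairing, dif_pos h]
  exact h.choose_spec

/-! ### Linearity and characteristic function of the extended pairing -/

lemma IsL2Pairing.congr_ae {f : ℝ → ℝ} {Y Z : RealTempered → ℝ} (h : IsL2Pairing μ f Y)
    (hYZ : Z =ᵐ[μ] Y) : IsL2Pairing μ f Z := by
  obtain ⟨h1, ξ, h2, h3⟩ := h
  refine ⟨(memLp_congr_ae hYZ).2 h1, ξ, h2, h3.congr fun k => eLpNorm_congr_ae ?_⟩
  filter_upwards [hYZ] with ω hω
  rw [hω]

lemma IsL2Pairing.zero : IsL2Pairing μ 0 0 :=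
  ⟨MemLp.zero', fun _ => 0, by simp, by simp⟩

lemma IsL2Pairing.add {f g : ℝ → ℝ} {Y Z : RealTempered → ℝ} (hf : MemLp f 2 volume)
    (hg : MemLp g 2 volume) (h : IsL2Pairing μ f Y) (h' : IsL2Pairing μ g Z) :
    IsL2Pairing μ (f + g) (Y + Z) := by
  obtain ⟨h1, ξ, h2, h3⟩ := h
  obtain ⟨h1', η, h2', h3'⟩ := h'
  refine ⟨h1.add h1', fun k => ξ k + η k, ?_, ?_⟩
  · have := h2.add h2'
    rw [add_zero] at this
    refine tendsto_of_tendsto_of_tendsto_of_le_of_le tendsto_const_nhds this (fun _ => zero_le)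
      fun k => ?_
    refine le_trans (le_of_eq ?_) (eLpNorm_add_le (((ξ k).memLp 2 volume).sub hf).1
      (((η k).memLp 2 volume).sub hg).1 one_le_two)
    congr 1
    ext x
    simp only [_root_.add_apply, Pi.add_apply]
    ring
  · have := h3.add h3'
    rw [add_zero] at this
    refine tendsto_of_tendsto_of_tendsto_of_le_of_le tendsto_const_nhds this (fun _ => zero_le)
      fun k => ?_
    refine le_trans (le_of_eq ?_) (eLpNorm_add_le
      ((measurable_apply_schwartz (ξ k)).aestronglyMeasurable.sub h1.1)
      ((measurable_apply_schwartz (η k)).aestronglyMeasurable.sub h1'.1) one_le_two)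
    congr 1
    ext ω
    simp only [map_add, Pi.add_apply]
    ring

lemma IsL2Pairing.const_smul {f : ℝ → ℝ} {Y : RealTempered → ℝ} (h : IsL2Pairing μ f Y) (c : ℝ) :
    IsL2Pairing μ (c • f) (c • Y) := by
  obtain ⟨h1, ξ, h2, h3⟩ := h
  refine ⟨h1.const_smul c, fun k => c • ξ k, ?_, ?_⟩
  · have := ENNReal.Tendsto.const_mul (a := ‖c‖ₑ) h2 (Or.inr (by simp))
    rw [mul_zero] at this
    refine this.congr fun k => ?_
    rw [← eLpNorm_const_smul]
    congr 1
    ext x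
    simp only [_root_.smul_apply, Pi.smul_apply, smul_eq_mul]
    ring
  · have := ENNReal.Tendsto.const_mul (a := ‖c‖ₑ) h3 (Or.inr (by simp))
    rw [mul_zero] at this
    refine this.congr fun k => ?_
    rw [← eLpNorm_const_smul]
    congr 1
    ext ω
    simp only [map_smul, Pi.smul_apply, smul_eq_mul]
    ring

/-- A linear combination of pairings is a single pairing; joint characteristic functions thereby
reduce to the one-dimensional formula. -/
lemma IsL2Pairing.sum {ι : Type*} {f : ι → ℝ → ℝ} {Y : ι → RealTempered → ℝ} (s : Finset ι)
    (lam : ι → ℝ) (hf : ∀ i, MemLp (f i) 2 volume) (h : ∀ i, IsL2Pairing μ (f i) (Y i)) :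
    IsL2Pairing μ (∑ i ∈ s, lam i • f i) (∑ i ∈ s, lam i • Y i) := by
  classical
  induction s using Finset.induction_on with
  | empty => simpa using IsL2Pairing.zero
  | insert i s his ih =>
    rw [Finset.sum_insert his, Finset.sum_insert his]
    exact IsL2Pairing.add ((hf i).const_smul _)
      (memLp_finsetSum' s fun i _ => (hf i).const_smul _) ((h i).const_smul _) ih

/-- The characteristic function of the extended dual pairing. -/
lemma IsL2Pairing.charFun (hA : FoxHAssumption a α b β) (hμ : IsFoxHMeasure a α b β μ)
    {f : ℝ → ℝ} (hf : MemLp f 2 volume) {Y : RealTempered → ℝ} (h : IsL2Pairing μ f Y) :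
    ∫ ω, Complex.exp (Complex.I * (Y ω : ℂ)) ∂μ =
      ((∫ τ, Real.exp (-((∫ x, f x ^ 2) / 2 * τ)) ∂mixingMeasure a α b β : ℝ) : ℂ) := by
  have := hμ.isProbabilityMeasure
  have := isProbabilityMeasure_mixingMeasure hA
  obtain ⟨h1, ξ, h2, h3⟩ := h
  have hnorm : Tendsto (fun k => ∫ x, ξ k x ^ 2) atTop (𝓝 (∫ x, f x ^ 2)) := by
    have := ((Lp.tendsto_Lp_iff_tendsto_eLpNorm'' (fun k => (ξ k : ℝ → ℝ))
      (fun k => (ξ k).memLp 2 volume) f hf).2 h2).norm.pow 2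
    simp only [Lp.norm_toLp, toReal_eLpNorm_two_sq hf,
      toReal_eLpNorm_two_sq ((ξ _).memLp 2 volume)] at this
    exact this
  -- L²-convergence gives a.e. convergence along a subsequence, enough to pass to the limit in the
  -- bounded exponentials.
  obtain ⟨ns, hns, hae⟩ := (tendstoInMeasure_of_tendsto_eLpNorm (p := 2) two_ne_zero
    (fun k => (measurable_apply_schwartz (ξ k)).aestronglyMeasurable) h1.1 h3).exists_seq_tendsto_ae
  have hL : Tendsto (fun k => ∫ ω : RealTempered, Complex.exp (Complex.I * (ω (ξ (ns k)) : ℂ)) ∂μ)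
      atTop (𝓝 (∫ ω, Complex.exp (Complex.I * (Y ω : ℂ)) ∂μ)) := by
    refine tendsto_integral_of_dominated_convergence (fun _ => 1) (fun k => ?_)
      (integrable_const _) (fun k => Eventually.of_forall fun ω => ?_) ?_
    · have := measurable_apply_schwartz (ξ (ns k))
      exact ((Complex.measurable_ofReal.comp this).const_mul _).cexp.aestronglyMeasurable
    · rw [mul_comm, Complex.norm_exp_ofReal_mul_I]
    · filter_upwards [hae] with ω hω
      exact (Complex.continuous_exp.tendsto _).comp
        (((Complex.continuous_ofReal.tendsto _).comp hω).const_mul Complex.I)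
  have hR : Tendsto (fun k => ∫ τ, Real.exp (-((∫ x, ξ (ns k) x ^ 2) / 2 * τ))
      ∂mixingMeasure a α b β) atTop
      (𝓝 (∫ τ, Real.exp (-((∫ x, f x ^ 2) / 2 * τ)) ∂mixingMeasure a α b β)) := by
    refine tendsto_integral_of_dominated_convergence (fun _ => 1)
      (fun k => Continuous.aestronglyMeasurable (by fun_prop)) (integrable_const _) (fun k => ?_) ?_
    · filter_upwards [ae_mixingMeasure_pos] with τ hτ
      rw [Real.norm_of_nonneg (Real.exp_pos _).le, Real.exp_le_one_iff, neg_nonpos]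
      exact mul_nonneg (div_nonneg (integral_nonneg fun x => sq_nonneg _) two_pos.le) hτ.le
    · refine Eventually.of_forall fun τ => ?_
      exact (Real.continuous_exp.tendsto _).comp
        (((((hnorm.comp hns.tendsto_atTop).div_const 2).mul_const τ)).neg)
  refine tendsto_nhds_unique hL ?_
  simp only [charFun_apply_schwartz hA hμ]
  exact (Complex.continuous_ofReal.tendsto _).comp hR

lemma IsL2Pairing.charFun_mul (hA : FoxHAssumption a α b β) (hμ : IsFoxHMeasure a α b β μ)
    {f : ℝ → ℝ} (hf : MemLp f 2 volume) {Y : RealTempered → ℝ} (h : IsL2Pairing μ f Y) (s : ℝ) :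
    ∫ ω, Complex.exp (Complex.I * ((s * Y ω : ℝ) : ℂ)) ∂μ =
      ((∫ τ, Real.exp (-(s ^ 2 * (∫ x, f x ^ 2) / 2 * τ)) ∂mixingMeasure a α b β : ℝ) : ℂ) := by
  have := (h.const_smul s).charFun hA hμ (hf.const_smul s)
  simpa only [Pi.smul_apply, smul_eq_mul, mul_pow, integral_const_mul] using this

end Pairing

/-! ### The Mandelbrot-Van Ness kernel -/

/-- The truncated power `y_+^{H - 1/2}`. -/
def truncPow (H y : ℝ) : ℝ := if 0 < y then y ^ (H - 1 / 2) else 0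

/-- Both fractional operators applied to an indicator come from this integral: the fractional
integral with r = H - 3/2, the derivative, before differentiation, with r = H - 1/2. -/
lemma setIntegral_Ioi_indicator_mul_rpow {t r : ℝ} (ht : 0 ≤ t) (hr : -1 < r) (x : ℝ) :
    ∫ u in Ioi x, (Ico 0 t).indicator (fun _ => (1 : ℝ)) u * (u - x) ^ r =
      ((max (t - x) 0) ^ (r + 1) - (max (-x) 0) ^ (r + 1)) / (r + 1) := by
  have h1 : ∀ u : ℝ, (Ico 0 t).indicator (fun _ => (1 : ℝ)) u * (u - x) ^ r =
      (Ico 0 t).indicator (fun u => (u - x) ^ r) u := by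
    intro u
    by_cases hu : u ∈ Ico 0 t <;> simp [hu]
  simp only [h1]
  rw [setIntegral_indicator measurableSet_Ico]
  -- Writing both ends with max x covers every position of x at once; for x ≥ t both sets are empty.
  have hset : (Ioi x ∩ Ico 0 t : Set ℝ) =ᵐ[volume] Ioc (max x 0) (max x t) := by
    have h0 : ∀ᵐ u : ℝ, u ≠ 0 := Measure.ae_ne volume 0
    have h2 : ∀ᵐ u : ℝ, u ≠ t := Measure.ae_ne volume t
    filter_upwards [h0, h2] with u hu0 hut
    apply propext
    change (u ∈ Ioi x ∩ Ico 0 t) ↔ (u ∈ Ioc (max x 0) (max x t))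
    simp only [mem_inter_iff, mem_Ioi, mem_Ico, mem_Ioc, max_lt_iff, le_max_iff]
    constructor
    · rintro ⟨h1, h2, h3⟩
      exact ⟨⟨h1, lt_of_le_of_ne h2 hu0.symm⟩, Or.inr h3.le⟩
    · rintro ⟨⟨h1, h2⟩, h3⟩
      rcases h3 with h3 | h3
      · exact absurd h1 (not_lt.2 h3)
      · exact ⟨h1, h2.le, lt_of_le_of_ne h3 hut⟩
  rw [setIntegral_congr_set hset,
    ← intervalIntegral.integral_of_le (max_le_max le_rfl ht),
    intervalIntegral.integral_comp_sub_right (fun v => v ^ r), integral_rpow (Or.inl hr)]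
  have e1 : max x t - x = max (t - x) 0 := by
    rcases le_total x t with h | h
    · rw [max_eq_right h, max_eq_left (by linarith)]
    · rw [max_eq_left h, max_eq_right (by linarith)]; ring
  have e2 : max x 0 - x = max (-x) 0 := by
    rcases le_total x 0 with h | h
    · rw [max_eq_right h, max_eq_left (by linarith)]; ring
    · rw [max_eq_left h, max_eq_right (by linarith)]; ring
  rw [e1, e2]

lemma max_rpow_eq_truncPow {H : ℝ} (hH : 1 / 2 < H) (y : ℝ) :
    (max y 0) ^ (H - 1 / 2) = truncPow H y := by
  rw [truncPow]
  split_ifs with h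
  · rw [max_eq_left h.le]
  · rw [max_eq_right (not_lt.1 h), Real.zero_rpow (by linarith)]

lemma hasDerivAt_max_rpow {H : ℝ} (c x : ℝ) (hx : x ≠ c) (hq : 0 < H + 1 / 2) :
    HasDerivAt (fun y : ℝ => (max (c - y) 0) ^ (H + 1 / 2))
      (-((H + 1 / 2) * truncPow H (c - x))) x := by
  rcases lt_or_gt_of_ne hx with h | h
  · have h1 : HasDerivAt (fun y : ℝ => (c - y) ^ (H + 1 / 2))
        (-((H + 1 / 2) * truncPow H (c - x))) x := by
      have := ((hasDerivAt_id x).const_sub c).rpow_const (p := H + 1 / 2)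
        (Or.inl (by simp only [id]; linarith))
      refine this.congr_deriv ?_
      rw [truncPow, if_pos (by linarith)]
      simp only [id]
      rw [show H + 1 / 2 - 1 = H - 1 / 2 by ring]
      ring
    refine h1.congr_of_eventuallyEq ?_
    filter_upwards [Iio_mem_nhds h] with y hy
    rw [max_eq_left (by linarith [mem_Iio.1 hy])]
  · rw [truncPow, if_neg (by linarith), mul_zero, neg_zero]
    refine (hasDerivAt_const x (0 : ℝ)).congr_of_eventuallyEq ?_
    filter_upwards [Ioi_mem_nhds h] with y hy
    rw [max_eq_right (by linarith [mem_Ioi.1 hy]), Real.zero_rpow hq.ne']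

/-- The squared `L²`-norm of the Mandelbrot-Van Ness kernel at time `1`. -/
def mvnNormSq (H : ℝ) : ℝ :=
  (∫ s in Ioi (0 : ℝ), ((1 + s) ^ (H - 1 / 2) - s ^ (H - 1 / 2)) ^ 2) + 1 / (2 * H)

lemma mvnNormSq_pos {H : ℝ} (hH : 0 < H) : 0 < mvnNormSq H := by
  have : 0 ≤ ∫ s in Ioi (0 : ℝ), ((1 + s) ^ (H - 1 / 2) - s ^ (H - 1 / 2)) ^ 2 :=
    integral_nonneg fun s => sq_nonneg _
  rw [mvnNormSq]
  positivity

/-- The normalized Mandelbrot-Van Ness kernel. -/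
def mvnKernel (H t x : ℝ) : ℝ :=
  mvnNormSq H ^ (-(1 / 2) : ℝ) * (truncPow H (t - x) - truncPow H (-x))

/-- In the regimes H ≠ 1/2 the factor Γ(H + 1/2) of K_H cancels the constants of the fractional
operator, leaving a difference of truncated powers. The points 0 and t are discarded because of
kinks and endpoint conventions. -/
lemma fracOpMinus_indicator {H : ℝ} (hH0 : 0 < H) {t : ℝ} (ht : 0 ≤ t) :
    fracOpMinus H ((Ico 0 t).indicator fun _ => 1) =ᵐ[volume] mvnKernel H t := by
  have h0 : ∀ᵐ x : ℝ, x ≠ 0 := Measure.ae_ne volume 0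
  have h1 : ∀ᵐ x : ℝ, x ≠ t := Measure.ae_ne volume t
  have hc : fracConst H = Real.Gamma (H + 1 / 2) * mvnNormSq H ^ (-(1 / 2) : ℝ) := rfl
  have hG : Real.Gamma (H + 1 / 2) ≠ 0 := (Real.Gamma_pos_of_pos (by linarith)).ne'
  filter_upwards [h0, h1] with x hx0 hxt
  rw [fracOpMinus, mvnKernel]
  split_ifs with h h'
  · rw [rlDerivMinus, hc]
    have e : (fun y => ∫ u in Ioi y, (Ico 0 t).indicator (fun _ => (1 : ℝ)) u *
        (u - y) ^ (-(-(H - 1 / 2)))) = fun y => ((max (t - y) 0) ^ (H + 1 / 2) -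
          (max (0 - y) 0) ^ (H + 1 / 2)) / (H + 1 / 2) := by
      ext y
      rw [neg_neg, setIntegral_Ioi_indicator_mul_rpow ht (by linarith), zero_sub,
        show H - 1 / 2 + 1 = H + 1 / 2 by ring]
    have hd := ((hasDerivAt_max_rpow (H := H) t x hxt (by linarith)).fun_sub
      (hasDerivAt_max_rpow (H := H) 0 x hx0 (by linarith))).div_const (H + 1 / 2)
    rw [e, hd.deriv, zero_sub, show 1 - -(H - 1 / 2) = H + 1 / 2 by ring]
    have : H + 1 / 2 ≠ 0 := by linarith
    field_simp
    ring
  · subst h'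
    -- At H = 1/2 the integrand in the normalization vanishes and 1/(2H) = 1.
    have hI : mvnNormSq (1 / 2) = 1 := by simp [mvnNormSq]
    rw [hI, Real.one_rpow, one_mul, truncPow, truncPow]
    simp only [sub_self, Real.rpow_zero]
    by_cases hx : 0 ≤ x
    · by_cases hxt' : x < t
      · rw [indicator_of_mem (show x ∈ Ico 0 t from ⟨hx, hxt'⟩), if_pos (by linarith),
          if_neg (by linarith), sub_zero]
      · rw [indicator_of_notMem (fun h => hxt' h.2), if_neg (by linarith),
          if_neg (by linarith), sub_zero]
    · rw [indicator_of_notMem (fun h => hx h.1), if_pos (by linarith),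
          if_pos (by linarith), sub_self]
  · have hH : 1 / 2 < H := lt_of_le_of_ne (not_lt.1 h) (Ne.symm h')
    rw [rlIntegralMinus, hc, setIntegral_Ioi_indicator_mul_rpow ht (by linarith),
      show H - 1 / 2 - 1 + 1 = H - 1 / 2 by ring, max_rpow_eq_truncPow hH,
      max_rpow_eq_truncPow hH]
    have hg : Real.Gamma (H + 1 / 2) = (H - 1 / 2) * Real.Gamma (H - 1 / 2) := by
      rw [← Real.Gamma_add_one (by linarith)]; congr 1; ring
    have h1 : Real.Gamma (H - 1 / 2) ≠ 0 := (Real.Gamma_pos_of_pos (by linarith)).ne'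
    have h2 : H - 1 / 2 ≠ 0 := by linarith
    rw [hg]
    generalize Real.Gamma (H - 1 / 2) = G at h1
    generalize H - 1 / 2 = q at h2
    field_simp

/-! ### Norms and inner products of the kernels -/

lemma measurable_truncPow (H : ℝ) : Measurable (truncPow H) :=
  Measurable.ite measurableSet_Ioi (by fun_prop) measurable_const

lemma abs_one_add_rpow_sub_rpow_le {e s : ℝ} (he : e ≤ 1) (hs : 0 < s) :
    |(1 + s) ^ e - s ^ e| ≤ |e| * s ^ (e - 1) := by
  have hd : ∀ x ∈ Icc s (1 + s), HasDerivWithinAt (fun x : ℝ => x ^ e) (e * x ^ (e - 1))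
      (Icc s (1 + s)) x := fun x hx =>
    (Real.hasDerivAt_rpow_const (Or.inl (by linarith [hx.1]))).hasDerivWithinAt
  have h := (convex_Icc s (1 + s)).norm_image_sub_le_of_norm_hasDerivWithin_le
    (C := |e| * s ^ (e - 1)) hd (fun x hx => ?_) (x := s) (y := 1 + s)
    ⟨le_rfl, by linarith⟩ ⟨by linarith, le_rfl⟩
  · simpa using h
  · have hx0 : 0 < x := by linarith [hx.1]
    rw [norm_mul, Real.norm_eq_abs, Real.norm_of_nonneg (Real.rpow_nonneg hx0.le _)]
    exact mul_le_mul_of_nonneg_left (Real.rpow_le_rpow_of_nonpos hs hx.1 (by linarith))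
      (abs_nonneg _)

/-- Near 0 the square is at most 2(s^{2H-1} + (1 + s)^{2H-1}), integrable because H > 0; on (1, ∞)
the mean value inequality gives a multiple of s^{2H-3}, integrable because H < 1. -/
lemma integrableOn_mvn_tail {H : ℝ} (hH0 : 0 < H) (hH1 : H < 1) :
    IntegrableOn (fun s : ℝ => ((1 + s) ^ (H - 1 / 2) - s ^ (H - 1 / 2)) ^ 2) (Ioi 0) := by
  have hm : Measurable fun s : ℝ => ((1 + s) ^ (H - 1 / 2) - s ^ (H - 1 / 2)) ^ 2 := by fun_prop
  rw [← Ioc_union_Ioi_eq_Ioi zero_le_one]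
  refine IntegrableOn.union ?_ ?_
  · have h1 : IntegrableOn (fun s : ℝ => s ^ (2 * H - 1)) (Ioc 0 1) :=
      (intervalIntegrable_iff_integrableOn_Ioc_of_le zero_le_one).1
        (intervalIntegral.intervalIntegrable_rpow' (by linarith))
    have h2 : IntegrableOn (fun s : ℝ => (1 + s) ^ (2 * H - 1)) (Ioc 0 1) := by
      refine (ContinuousOn.integrableOn_Icc ?_).mono_set Ioc_subset_Icc_self
      intro s hs
      exact (ContinuousAt.rpow_const (by fun_prop)
        (Or.inl (by linarith [hs.1]))).continuousWithinAt
    refine ((h1.add h2).const_mul 2).mono' hm.aestronglyMeasurable ?_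
    filter_upwards [ae_restrict_mem measurableSet_Ioc] with s hs
    have hs0 : 0 < s := hs.1
    have e : ∀ y : ℝ, 0 < y → y ^ (2 * H - 1) = (y ^ (H - 1 / 2)) ^ 2 := by
      intro y hy
      rw [← Real.rpow_natCast, ← Real.rpow_mul hy.le]
      congr 1; push_cast; ring
    rw [Real.norm_of_nonneg (sq_nonneg _)]
    simp only [Pi.add_apply]
    rw [e s hs0, e (1 + s) (by linarith)]
    nlinarith [sq_nonneg ((1 + s) ^ (H - 1 / 2) + s ^ (H - 1 / 2))]
  · have h1 : IntegrableOn (fun s : ℝ => |H - 1 / 2| ^ 2 * s ^ (2 * H - 3)) (Ioi 1) :=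
      (integrableOn_Ioi_rpow_of_lt (by linarith) one_pos).const_mul _
    refine h1.mono' hm.aestronglyMeasurable ?_
    filter_upwards [ae_restrict_mem measurableSet_Ioi] with s hs
    have hs0 : 0 < s := lt_trans one_pos hs
    rw [Real.norm_of_nonneg (sq_nonneg _), ← sq_abs]
    have h := abs_one_add_rpow_sub_rpow_le (e := H - 1 / 2) (by linarith) hs0
    refine (pow_le_pow_left₀ (abs_nonneg _) h 2).trans (le_of_eq ?_)
    rw [mul_pow, ← Real.rpow_natCast (s ^ _), ← Real.rpow_mul hs0.le]
    congr 2; push_cast; ring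

/-- After reflecting x, the half-line (0, ∞) contributes the integral in K_H, the interval (-1, 0]
contributes 1/(2H), and the rest is zero. -/
lemma integral_truncPow_sub_sq {H : ℝ} (hH0 : 0 < H) (hH1 : H < 1) :
    Integrable (fun x => (truncPow H (1 - x) - truncPow H (-x)) ^ 2) ∧
      ∫ x, (truncPow H (1 - x) - truncPow H (-x)) ^ 2 = mvnNormSq H := by
  set g : ℝ → ℝ := fun x => (truncPow H (1 + x) - truncPow H x) ^ 2 with hg
  have hneg : (fun x => (truncPow H (1 - x) - truncPow H (-x)) ^ 2) = fun x => g (-x) := by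
    ext x; simp only [hg, sub_eq_add_neg]
  have h2H : (2 * H - 1 : ℝ) + 1 = 2 * H := by ring
  have k1 : EqOn g (fun s : ℝ => ((1 + s) ^ (H - 1 / 2) - s ^ (H - 1 / 2)) ^ 2) (Ioi 0) := by
    intro s hs
    have hs' : 0 < s := hs
    simp only [hg, truncPow]
    rw [if_pos (by linarith), if_pos hs']
  have k2 : EqOn g (fun s : ℝ => (1 + s) ^ (2 * H - 1)) (Ioc (-1) 0) := by
    intro s hs
    have hs' : 0 < 1 + s := by linarith [hs.1]
    simp only [hg, truncPow]
    rw [if_pos hs', if_neg (not_lt.2 hs.2), sub_zero, ← Real.rpow_natCast, ← Real.rpow_mul hs'.le]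
    congr 1; push_cast; ring
  have k3 : EqOn g (fun _ => 0) (Iic (-1)) := by
    intro s hs
    have hs' : s ≤ -1 := hs
    simp only [hg, truncPow]
    rw [if_neg (by linarith), if_neg (by linarith)]
    norm_num
  have i1 : IntegrableOn g (Ioi 0) :=
    (integrableOn_mvn_tail hH0 hH1).congr_fun k1.symm measurableSet_Ioi
  have hI : IntervalIntegrable (fun s : ℝ => (1 + s) ^ (2 * H - 1)) volume (-1) 0 := by
    have := (intervalIntegral.intervalIntegrable_rpow' (a := 0) (b := 1)
      (show -1 < 2 * H - 1 by linarith)).comp_add_left 1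
    simpa using this
  have i2 : IntegrableOn g (Ioc (-1) 0) :=
    ((intervalIntegrable_iff_integrableOn_Ioc_of_le (by norm_num)).1 hI).congr_fun k2.symm
      measurableSet_Ioc
  have i3 : IntegrableOn g (Iic (-1)) :=
    integrableOn_zero.congr_fun k3.symm measurableSet_Iic
  have u1 : (Ioc (-1) 0 ∪ Ioi 0 : Set ℝ) = Ioi (-1) := Ioc_union_Ioi_eq_Ioi (by norm_num)
  have i4 : IntegrableOn g (Ioi (-1)) := u1 ▸ i2.union i1
  have i5 : Integrable g := by
    rw [← integrableOn_univ, ← Iic_union_Ioi (a := (-1 : ℝ))]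
    exact i3.union i4
  constructor
  · rw [hneg]; exact i5.comp_neg
  · rw [hneg, integral_neg_eq_self g, ← intervalIntegral.integral_Iic_add_Ioi i3 i4,
      setIntegral_congr_fun measurableSet_Iic k3, ← u1,
      setIntegral_union (by
        rw [Set.disjoint_left]; intro x hx hx'; exact absurd hx.2 (not_le.2 hx'))
        measurableSet_Ioi i2 i1, setIntegral_congr_fun measurableSet_Ioi k1,
      setIntegral_congr_fun measurableSet_Ioc k2,
      ← intervalIntegral.integral_of_le (by norm_num : (-1 : ℝ) ≤ 0),
      intervalIntegral.integral_comp_add_left (fun s : ℝ => s ^ (2 * H - 1)),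
      integral_rpow (Or.inl (by linarith)), h2H, mvnNormSq]
    norm_num
    rw [Real.zero_rpow (by linarith)]
    ring

lemma truncPow_mul {H t : ℝ} (ht : 0 < t) (y : ℝ) :
    truncPow H (t * y) = t ^ (H - 1 / 2) * truncPow H y := by
  simp only [truncPow, mul_pos_iff_of_pos_left ht]
  split_ifs with h
  · rw [Real.mul_rpow ht.le h.le]
  · simp

lemma integral_truncPow_sub_sq_of_pos {H : ℝ} (hH0 : 0 < H) (hH1 : H < 1) {t : ℝ} (ht : 0 < t) :
    Integrable (fun x => (truncPow H (t - x) - truncPow H (-x)) ^ 2) ∧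
      ∫ x, (truncPow H (t - x) - truncPow H (-x)) ^ 2 = t ^ (2 * H) * mvnNormSq H := by
  obtain ⟨h1, h2⟩ := integral_truncPow_sub_sq hH0 hH1
  have e : ∀ x, (truncPow H (t - t * x) - truncPow H (-(t * x))) ^ 2 =
      t ^ (2 * H - 1) * (truncPow H (1 - x) - truncPow H (-x)) ^ 2 := by
    intro x
    rw [show t - t * x = t * (1 - x) by ring, show -(t * x) = t * (-x) by ring,
      truncPow_mul ht, truncPow_mul ht, ← mul_sub, mul_pow, ← Real.rpow_natCast (t ^ _),
      ← Real.rpow_mul ht.le]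
    congr 2; push_cast; ring
  constructor
  · rw [← integrable_comp_mul_left_iff _ ht.ne']
    simp only [e]
    exact h1.const_mul _
  · have := Measure.integral_comp_mul_left
      (fun x => (truncPow H (t - x) - truncPow H (-x)) ^ 2) t
    simp only [e] at this
    rw [integral_const_mul, h2, abs_of_pos (inv_pos.2 ht), smul_eq_mul,
      eq_inv_mul_iff_mul_eq₀ ht.ne'] at this
    rw [← this, ← mul_assoc]
    congr 1
    rw [mul_comm, ← Real.rpow_add_one ht.ne']
    congr 1; ring

lemma mvnNormSq_rpow_sq {H : ℝ} (hH0 : 0 < H) :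
    (mvnNormSq H ^ (-(1 / 2) : ℝ)) ^ 2 * mvnNormSq H = 1 := by
  have h := mvnNormSq_pos hH0
  rw [← Real.rpow_natCast, ← Real.rpow_mul h.le, ← Real.rpow_add_one h.ne']
  norm_num

lemma measurable_mvnKernel (H t : ℝ) : Measurable (mvnKernel H t) :=
  (((measurable_truncPow H).comp (measurable_const.sub measurable_id)).sub
    ((measurable_truncPow H).comp measurable_neg)).const_mul _

/-- The common term at -x cancels, so a difference of kernels is a translate of the kernel for the
time increment. Translation invariance and homogeneity of truncated powers then give the
self-similar value. -/
lemma mvnKernel_sub_sq {H : ℝ} (hH0 : 0 < H) (hH1 : H < 1) (t s : ℝ) :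
    Integrable (fun x => (mvnKernel H t x - mvnKernel H s x) ^ 2) ∧
      ∫ x, (mvnKernel H t x - mvnKernel H s x) ^ 2 = |t - s| ^ (2 * H) := by
  wlog hst : s ≤ t generalizing s t
  · have h := this s t (le_of_not_ge hst)
    rw [abs_sub_comm]
    have e : ∀ x, (mvnKernel H t x - mvnKernel H s x) ^ 2 =
      (mvnKernel H s x - mvnKernel H t x) ^ 2 := fun x => by ring
    simpa only [e] using h
  rcases hst.eq_or_lt with rfl | hst
  · have : (2 * H) ≠ 0 := by linarith
    simp [Real.zero_rpow this]
  · obtain ⟨h1, h2⟩ := integral_truncPow_sub_sq_of_pos hH0 hH1 (sub_pos.2 hst)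
    have e : ∀ x, (mvnKernel H t x - mvnKernel H s x) ^ 2 =
        (mvnNormSq H ^ (-(1 / 2) : ℝ)) ^ 2 *
          (truncPow H (t - s - (x - s)) - truncPow H (-(x - s))) ^ 2 := by
      intro x
      rw [mvnKernel, mvnKernel, show t - s - (x - s) = t - x by ring,
        show -(x - s) = s - x by ring]
      ring
    simp only [e]
    refine ⟨(h1.comp_sub_right s).const_mul _, ?_⟩
    rw [integral_const_mul, integral_sub_right_eq_self
      (fun x => (truncPow H (t - s - x) - truncPow H (-x)) ^ 2) s, h2, mul_comm (_ ^ (2 * H)),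
      ← mul_assoc, mvnNormSq_rpow_sq hH0, one_mul, abs_of_pos (sub_pos.2 hst)]

lemma mvnKernel_zero (H x : ℝ) : mvnKernel H 0 x = 0 := by simp [mvnKernel]

lemma memLp_mvnKernel {H : ℝ} (hH0 : 0 < H) (hH1 : H < 1) (t : ℝ) :
    MemLp (mvnKernel H t) 2 volume := by
  rw [memLp_two_iff_integrable_sq (measurable_mvnKernel H t).aestronglyMeasurable]
  simpa [mvnKernel_zero] using (mvnKernel_sub_sq hH0 hH1 t 0).1

lemma integral_mvnKernel_sq {H : ℝ} (hH0 : 0 < H) (hH1 : H < 1) (t : ℝ) :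
    ∫ x, mvnKernel H t x ^ 2 = |t| ^ (2 * H) := by
  simpa [mvnKernel_zero] using (mvnKernel_sub_sq hH0 hH1 t 0).2

lemma integral_mvnKernel_mul {H : ℝ} (hH0 : 0 < H) (hH1 : H < 1) (t s : ℝ) :
    ∫ x, mvnKernel H t x * mvnKernel H s x =
      1 / 2 * (|t| ^ (2 * H) + |s| ^ (2 * H) - |t - s| ^ (2 * H)) := by
  have e : ∀ x, mvnKernel H t x * mvnKernel H s x = 1 / 2 *
      (mvnKernel H t x ^ 2 + mvnKernel H s x ^ 2 - (mvnKernel H t x - mvnKernel H s x) ^ 2) :=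
    fun x => by ring
  have it := (memLp_mvnKernel hH0 hH1 t).integrable_sq
  have is := (memLp_mvnKernel hH0 hH1 s).integrable_sq
  simp only [e]
  rw [integral_const_mul, integral_sub (it.fun_add is) (mvnKernel_sub_sq hH0 hH1 t s).1,
    integral_add it is, integral_mvnKernel_sq hH0 hH1, integral_mvnKernel_sq hH0 hH1,
    (mvnKernel_sub_sq hH0 hH1 t s).2]

/-- The fractional Brownian covariance matrix is the Gram matrix of the kernels, their inner
products being obtained by polarization. -/
lemma integral_sum_mvnKernel_sq {H : ℝ} (hH0 : 0 < H) (hH1 : H < 1) {n : ℕ} (t lam : Fin n → ℝ) :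
    ∫ x, (∑ i, lam i * mvnKernel H (t i) x) ^ 2 = lam ⬝ᵥ fbmCov H t *ᵥ lam := by
  have e : ∀ x, (∑ i, lam i * mvnKernel H (t i) x) ^ 2 =
      ∑ i, ∑ j, lam i * lam j * (mvnKernel H (t i) x * mvnKernel H (t j) x) := by
    intro x
    rw [sq, Finset.sum_mul_sum]
    exact Finset.sum_congr rfl fun i _ => Finset.sum_congr rfl fun j _ => by ring
  have hi : ∀ i j, Integrable fun x =>
      lam i * lam j * (mvnKernel H (t i) x * mvnKernel H (t j) x) := fun i j =>
    ((memLp_mvnKernel hH0 hH1 (t i)).integrable_mul (memLp_mvnKernel hH0 hH1 (t j))).const_mul _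
  simp only [e]
  rw [integral_finsetSum _ fun i _ => integrable_finsetSum _ fun j _ => hi i j]
  simp only [dotProduct, Matrix.mulVec, Finset.mul_sum]
  refine Finset.sum_congr rfl fun i _ => ?_
  rw [integral_finsetSum _ fun j _ => hi i j]
  refine Finset.sum_congr rfl fun j _ => ?_
  rw [integral_const_mul, integral_mvnKernel_mul hH0 hH1, fbmCov, Matrix.of_apply]
  ring

/-- The kernels are linearly independent. Just to the left of the largest time with a nonzero
coefficient, every other contributing kernel vanishes, so the combination cannot be zero almost
everywhere. -/
lemma posDef_fbmCov {H : ℝ} (hH0 : 0 < H) (hH1 : H < 1) {n : ℕ} {t : Fin n → ℝ}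
    (ht : ∀ i, 0 < t i) (hmono : StrictMono t) : (fbmCov H t).PosDef := by
  refine Matrix.PosDef.of_dotProduct_mulVec_pos ?_ fun lam hlam => ?_
  · ext i j
    simp only [Matrix.conjTranspose_apply, fbmCov, Matrix.of_apply, star_trivial]
    rw [abs_sub_comm]; ring
  rw [star_trivial, ← integral_sum_mvnKernel_sq hH0 hH1]
  refine lt_of_le_of_ne (integral_nonneg fun x => sq_nonneg _) fun h0 => hlam ?_
  have hmem : MemLp (fun x => ∑ i, lam i * mvnKernel H (t i) x) 2 volume :=
    memLp_finsetSum _ fun i _ => (memLp_mvnKernel hH0 hH1 (t i)).const_mul _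
  have hae := (integral_eq_zero_iff_of_nonneg (fun x => sq_nonneg _) hmem.integrable_sq).1 h0.symm
  by_contra hne
  obtain ⟨i₀, hi₀⟩ : ∃ i, lam i ≠ 0 := by
    by_contra h; push Not at h; exact hne (funext h)
  obtain ⟨l, hl, hmax⟩ := (Finset.univ.filter fun i => lam i ≠ 0).exists_max_image id
    ⟨i₀, by simpa using hi₀⟩
  simp only [Finset.mem_filter, Finset.mem_univ, true_and, id] at hl hmax
  -- c is taken beyond 0 and all earlier times, so that on (c, t_l) only the leading power of the
  -- l-th kernel survives.
  have hev : ∀ᶠ c in 𝓝[<] (t l), 0 < c ∧ ∀ k, k < l → t k < c := by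
    refine Filter.Eventually.filter_mono nhdsWithin_le_nhds ?_
    refine (lt_mem_nhds (ht l)).and (eventually_all.2 fun k => ?_)
    by_cases hk : k < l
    · filter_upwards [lt_mem_nhds (hmono hk)] with c hc _ using hc
    · exact Eventually.of_forall fun c h => absurd h hk
  obtain ⟨c, ⟨hc0, hck⟩, hcl⟩ := (hev.and self_mem_nhdsWithin).exists
  have hval : ∀ x ∈ Ioo c (t l), (∑ i, lam i * mvnKernel H (t i) x) ^ 2 ≠ 0 := by
    intro x hx
    rw [Finset.sum_eq_single l]
    · have h1 : 0 < truncPow H (t l - x) := by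
        rw [truncPow, if_pos (by linarith [hx.2])]
        exact Real.rpow_pos_of_pos (by linarith [hx.2]) _
      rw [mvnKernel, show truncPow H (-x) = 0 by
        rw [truncPow, if_neg (by linarith [hx.1])], sub_zero]
      have h2 := Real.rpow_pos_of_pos (mvnNormSq_pos hH0) (-(1 / 2))
      exact pow_ne_zero 2 (mul_ne_zero hl (mul_pos h2 h1).ne')
    · intro k _ hkl
      by_cases hk : lam k = 0
      · rw [hk, zero_mul]
      · have hk' : k < l := lt_of_le_of_ne (hmax k hk) hkl
        have := hck k hk'
        rw [mvnKernel, truncPow, if_neg (by linarith [hx.1]), truncPow,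
          if_neg (by linarith [hx.1]), sub_zero, mul_zero, mul_zero]
    · simp
  have hnull : volume (Ioo c (t l)) = 0 :=
    measure_mono_null (fun x hx => hval x hx) (ae_iff.1 hae)
  rw [Real.volume_Ioo, ENNReal.ofReal_eq_zero] at hnull
  have : c < t l := hcl
  linarith

/-! ### Centred Gaussian densities and their scale mixtures -/

section GaussianDensity

variable {n : ℕ}

/-- The density of the centred Gaussian law on `ℝⁿ` with covariance matrix `M`. -/
def gaussDensity (M : Matrix (Fin n) (Fin n) ℝ) (x : Fin n → ℝ) : ℝ :=
  1 / ((2 * Real.pi) ^ ((n : ℝ) / 2) * M.det ^ (1 / 2 : ℝ)) * Real.exp (-(x ⬝ᵥ M⁻¹ *ᵥ x) / 2)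

open scoped MatrixOrder in
lemma exists_eq_transpose_mul_self {M : Matrix (Fin n) (Fin n) ℝ} (hM : M.PosDef) :
    ∃ B : Matrix (Fin n) (Fin n) ℝ, M = Bᵀ * B ∧ B.det ≠ 0 := by
  obtain ⟨B, hB⟩ := CStarAlgebra.nonneg_iff_eq_star_mul_self.mp hM.posSemidef.nonneg
  have hB' : M = Bᵀ * B := hB
  refine ⟨B, hB', fun h => hM.det_pos.ne' ?_⟩
  rw [hB', Matrix.det_mul, h, mul_zero]

lemma integral_comp_toLin' {E : Type*} [NormedAddCommGroup E] [NormedSpace ℝ E]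
    {A : Matrix (Fin n) (Fin n) ℝ} (hA : A.det ≠ 0) (f : (Fin n → ℝ) → E) :
    ∫ x, f x = |A.det| • ∫ y, f (A *ᵥ y) := by
  have hmap := Real.map_matrix_volume_pi_eq_smul_volume_pi hA
  have hinj : Function.Injective (Matrix.toLin' A) :=
    Matrix.mulVec_injective_iff_isUnit.2
      ((Matrix.isUnit_iff_isUnit_det A).2 (isUnit_iff_ne_zero.2 hA))
  have hemb : MeasurableEmbedding (Matrix.toLin' A) :=
    (Matrix.toLin' A).continuous_of_finiteDimensional.measurableEmbedding hinj
  have h := hemb.integral_map (μ := volume) f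
  rw [hmap, integral_smul_measure, ENNReal.toReal_ofReal (abs_nonneg _)] at h
  simp only [Matrix.toLin'_apply] at h
  rw [← h, smul_smul, abs_inv, mul_inv_cancel₀ (abs_ne_zero.2 hA), one_smul]

lemma integral_cexp_mul_gaussian (κ : Fin n → ℝ) :
    ∫ y : Fin n → ℝ, Complex.exp (Complex.I * ((κ ⬝ᵥ y : ℝ) : ℂ)) *
        ((Real.exp (-(y ⬝ᵥ y) / 2) : ℝ) : ℂ) =
      (((2 * Real.pi) ^ ((n : ℝ) / 2) * Real.exp (-(κ ⬝ᵥ κ) / 2) : ℝ) : ℂ) := by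
  have h := GaussianFourier.integral_cexp_neg_mul_sum_add (b := ((1 / 2 : ℝ) : ℂ))
    (by rw [Complex.ofReal_re]; norm_num) (fun i => Complex.I * (κ i : ℂ))
  have e : ∀ y : Fin n → ℝ, Complex.exp (Complex.I * ((κ ⬝ᵥ y : ℝ) : ℂ)) *
        ((Real.exp (-(y ⬝ᵥ y) / 2) : ℝ) : ℂ) =
      Complex.exp (-((1 / 2 : ℝ) : ℂ) * ∑ i, (y i : ℂ) ^ 2 + ∑ i, Complex.I * (κ i : ℂ) * y i) := by
    intro y
    rw [Complex.ofReal_exp, ← Complex.exp_add]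
    congr 1
    simp only [dotProduct]
    push_cast
    rw [Finset.mul_sum]
    simp only [mul_assoc, sq]
    ring
  simp only [e]
  rw [h]
  have e2 : (Real.pi / ((1 / 2 : ℝ) : ℂ)) ^ (Fintype.card (Fin n) / 2 : ℂ) =
      (((2 * Real.pi) ^ ((n : ℝ) / 2) : ℝ) : ℂ) := by
    rw [Complex.ofReal_cpow (by positivity), Fintype.card_fin]
    push_cast
    congr 1
    ring
  rw [e2, Complex.ofReal_mul, Complex.ofReal_exp]
  congr 2
  simp only [mul_pow, Complex.I_sq, dotProduct]
  push_cast
  rw [← Finset.mul_sum]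
  simp only [sq]
  ring

/-- With M = BᵀB, the substitution x = Bᵀy turns the quadratic form into |y|² and the Jacobian |det
B| into det(M)^{1/2}, leaving a product of standard Gaussians. -/
lemma integral_cexp_mul_gaussDensity {M : Matrix (Fin n) (Fin n) ℝ} (hM : M.PosDef)
    (lam : Fin n → ℝ) :
    ∫ x, Complex.exp (Complex.I * ((lam ⬝ᵥ x : ℝ) : ℂ)) * (gaussDensity M x : ℂ) =
      ((Real.exp (-(lam ⬝ᵥ M *ᵥ lam) / 2) : ℝ) : ℂ) := by
  obtain ⟨B, hB, hdet⟩ := exists_eq_transpose_mul_self hM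
  have hdetT : Bᵀ.det ≠ 0 := by rwa [Matrix.det_transpose]
  have hu : IsUnit B.det := isUnit_iff_ne_zero.2 hdet
  have huT : IsUnit Bᵀ.det := isUnit_iff_ne_zero.2 hdetT
  have h1 : ∀ y, (Bᵀ *ᵥ y) ⬝ᵥ M⁻¹ *ᵥ (Bᵀ *ᵥ y) = y ⬝ᵥ y := by
    intro y
    rw [hB, Matrix.mul_inv_rev, Matrix.mulVec_mulVec, Matrix.mul_assoc,
      Matrix.nonsing_inv_mul _ huT, Matrix.mul_one, Matrix.mulVec_transpose,
      ← Matrix.dotProduct_mulVec, Matrix.mulVec_mulVec, Matrix.mul_nonsing_inv _ hu,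
      Matrix.one_mulVec]
  have h2 : ∀ y, lam ⬝ᵥ (Bᵀ *ᵥ y) = (B *ᵥ lam) ⬝ᵥ y := by
    intro y
    rw [Matrix.dotProduct_mulVec, Matrix.vecMul_transpose]
  have h3 : (B *ᵥ lam) ⬝ᵥ (B *ᵥ lam) = lam ⬝ᵥ M *ᵥ lam := by
    rw [hB, ← Matrix.mulVec_mulVec, Matrix.dotProduct_mulVec lam, Matrix.vecMul_transpose]
  have h4 : M.det ^ (1 / 2 : ℝ) = |Bᵀ.det| := by
    rw [hB, Matrix.det_mul, Matrix.det_transpose, ← Real.sqrt_eq_rpow, Real.sqrt_mul_self_eq_abs]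
  rw [integral_comp_toLin' hdetT]
  have e : ∀ y, Complex.exp (Complex.I * ((lam ⬝ᵥ (Bᵀ *ᵥ y) : ℝ) : ℂ)) *
      (gaussDensity M (Bᵀ *ᵥ y) : ℂ) =
      ((1 / ((2 * Real.pi) ^ ((n : ℝ) / 2) * |Bᵀ.det|) : ℝ) : ℂ) *
        (Complex.exp (Complex.I * (((B *ᵥ lam) ⬝ᵥ y : ℝ) : ℂ)) *
          ((Real.exp (-(y ⬝ᵥ y) / 2) : ℝ) : ℂ)) := by
    intro y
    rw [gaussDensity, h1, h2, h4, Complex.ofReal_mul]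
    ring
  simp only [e]
  rw [integral_const_mul, integral_cexp_mul_gaussian, h3, Complex.real_smul, ← Complex.ofReal_mul,
    ← Complex.ofReal_mul]
  congr 1
  have k1 : |Bᵀ.det| ≠ 0 := abs_ne_zero.2 hdetT
  have k2 : (2 * Real.pi) ^ ((n : ℝ) / 2) ≠ 0 := (Real.rpow_pos_of_pos (by positivity) _).ne'
  field_simp

lemma gaussDensity_nonneg {M : Matrix (Fin n) (Fin n) ℝ} (hM : M.PosDef) (x : Fin n → ℝ) :
    0 ≤ gaussDensity M x := by
  have := hM.det_pos
  rw [gaussDensity]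
  positivity

/-- The density of a centred Gaussian law on `ℝⁿ` with covariance matrix `τ M`. -/
def scaledGaussDensity (M : Matrix (Fin n) (Fin n) ℝ) (x : Fin n → ℝ) (τ : ℝ) : ℝ :=
  1 / τ ^ ((n : ℝ) / 2) * gaussDensity M (fun i => x i / Real.sqrt τ)

lemma scaledGaussDensity_nonneg {M : Matrix (Fin n) (Fin n) ℝ} (hM : M.PosDef) (x : Fin n → ℝ)
    {τ : ℝ} (hτ : 0 < τ) : 0 ≤ scaledGaussDensity M x τ :=
  mul_nonneg (by positivity) (gaussDensity_nonneg hM _)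

lemma measurable_scaledGaussDensity (M : Matrix (Fin n) (Fin n) ℝ) :
    Measurable fun q : (Fin n → ℝ) × ℝ => scaledGaussDensity M q.1 q.2 := by
  have hg : Continuous (gaussDensity M) := by
    unfold gaussDensity
    fun_prop
  refine Measurable.mul (by fun_prop) (hg.measurable.comp ?_)
  refine measurable_pi_lambda _ fun i => ?_
  exact ((measurable_pi_apply i).comp measurable_fst).div
    (Real.continuous_sqrt.measurable.comp measurable_snd)

lemma integral_cexp_mul_scaledGaussDensity {M : Matrix (Fin n) (Fin n) ℝ} (hM : M.PosDef)
    (lam : Fin n → ℝ) {τ : ℝ} (hτ : 0 < τ) :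
    ∫ x, Complex.exp (Complex.I * ((lam ⬝ᵥ x : ℝ) : ℂ)) * (scaledGaussDensity M x τ : ℂ) =
      ((Real.exp (-((lam ⬝ᵥ M *ᵥ lam) / 2 * τ)) : ℝ) : ℂ) := by
  have hs : 0 < Real.sqrt τ := Real.sqrt_pos.2 hτ
  have h := Measure.integral_comp_inv_smul (volume : Measure (Fin n → ℝ))
    (fun y => Complex.exp (Complex.I * (((Real.sqrt τ • lam) ⬝ᵥ y : ℝ) : ℂ)) *
      (gaussDensity M y : ℂ)) (Real.sqrt τ)
  rw [integral_cexp_mul_gaussDensity hM, Module.finrank_fin_fun] at h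
  have e : ∀ x : Fin n → ℝ, Complex.exp (Complex.I * ((lam ⬝ᵥ x : ℝ) : ℂ)) *
      (scaledGaussDensity M x τ : ℂ) = ((1 / τ ^ ((n : ℝ) / 2) : ℝ) : ℂ) *
      (Complex.exp (Complex.I * (((Real.sqrt τ • lam) ⬝ᵥ ((Real.sqrt τ)⁻¹ • x) : ℝ) : ℂ)) *
      (gaussDensity M ((Real.sqrt τ)⁻¹ • x) : ℂ)) := by
    intro x
    rw [smul_dotProduct, dotProduct_smul, smul_smul, mul_inv_cancel₀ hs.ne', one_smul,
      scaledGaussDensity]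
    have : (fun i => x i / Real.sqrt τ) = (Real.sqrt τ)⁻¹ • x := by
      ext i; simp [div_eq_inv_mul]
    rw [this]
    push_cast
    ring
  simp only [e]
  rw [integral_const_mul, h, Complex.real_smul, ← mul_assoc, ← Complex.ofReal_mul]
  have k : Real.sqrt τ ^ n = τ ^ ((n : ℝ) / 2) := by
    rw [Real.sqrt_eq_rpow, ← Real.rpow_natCast, ← Real.rpow_mul hτ.le]
    congr 1; ring
  rw [abs_of_pos (by positivity), k, one_div_mul_cancel (Real.rpow_pos_of_pos hτ _).ne',
    Complex.ofReal_one, one_mul, Matrix.mulVec_smul, smul_dotProduct, dotProduct_smul, smul_smul,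
    Real.mul_self_sqrt hτ.le, smul_eq_mul]
  congr 2
  ring

lemma integral_scaledGaussDensity {M : Matrix (Fin n) (Fin n) ℝ} (hM : M.PosDef)
    {τ : ℝ} (hτ : 0 < τ) :
    Integrable (fun x => scaledGaussDensity M x τ) ∧ ∫ x, scaledGaussDensity M x τ = 1 := by
  have h := integral_cexp_mul_scaledGaussDensity hM 0 hτ
  simp only [zero_dotProduct, Complex.ofReal_zero, mul_zero, Complex.exp_zero, one_mul, zero_div,
    zero_mul, neg_zero, Real.exp_zero] at h
  rw [integral_complex_ofReal] at h
  have h' : ∫ x, scaledGaussDensity M x τ = 1 := by exact_mod_cast h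
  refine ⟨?_, h'⟩
  -- A nonintegrable function has integral 0 by convention, so the value 1 already forces
  -- integrability.
  by_contra hn
  rw [integral_undef hn] at h'
  exact zero_ne_one h'

/-- For x ≠ 0 the factor e^{-q/(2τ)} with q > 0 defeats the singularity τ^{-n/2} at τ = 0; at the
origin q = 0 and this mechanism is lost. -/
lemma exists_scaledGaussDensity_le {M : Matrix (Fin n) (Fin n) ℝ} (hM : M.PosDef)
    {x : Fin n → ℝ} (hx : x ≠ 0) : ∃ C, ∀ τ, 0 < τ → scaledGaussDensity M x τ ≤ C := by
  set q := x ⬝ᵥ M⁻¹ *ᵥ x with hq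
  have hq0 : 0 < q := by
    have := hM.inv.dotProduct_mulVec_pos hx
    rwa [star_trivial] at this
  set c := 1 / ((2 * Real.pi) ^ ((n : ℝ) / 2) * M.det ^ (1 / 2 : ℝ)) with hc
  have hc0 : 0 ≤ c := by have := hM.det_pos; positivity
  -- With w = 1/τ, the constant comes from w^{n/2} ≤ 1 + w^n and from the single term (qw/2)^n / n!
  -- ≤ e^{qw/2} of the exponential series.
  refine ⟨c * (1 + n ! / (q / 2) ^ n), fun τ hτ => ?_⟩
  have hs : 0 < Real.sqrt τ := Real.sqrt_pos.2 hτ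
  have hx' : (fun i => x i / Real.sqrt τ) = (Real.sqrt τ)⁻¹ • x := by
    ext i; simp [div_eq_inv_mul]
  have hw : 0 < τ⁻¹ := inv_pos.2 hτ
  have e : scaledGaussDensity M x τ =
      c * ((τ⁻¹) ^ ((n : ℝ) / 2) * Real.exp (-(q / 2 * τ⁻¹))) := by
    have h1 : (Real.sqrt τ)⁻¹ * (Real.sqrt τ)⁻¹ = τ⁻¹ := by
      rw [← mul_inv, Real.mul_self_sqrt hτ.le]
    rw [scaledGaussDensity, gaussDensity, hx', Matrix.mulVec_smul, smul_dotProduct,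
      dotProduct_smul, smul_smul, h1, ← hq, ← hc, smul_eq_mul, one_div, Real.inv_rpow hτ.le,
      show -(τ⁻¹ * q) / 2 = -(q / 2 * τ⁻¹) by ring]
    ring
  rw [e]
  refine mul_le_mul_of_nonneg_left ?_ hc0
  have h1 : (τ⁻¹) ^ ((n : ℝ) / 2) ≤ 1 + (τ⁻¹) ^ n := by
    rcases le_total τ⁻¹ 1 with h | h
    · have : (τ⁻¹) ^ ((n : ℝ) / 2) ≤ 1 := Real.rpow_le_one hw.le h (by positivity)
      have : 0 ≤ (τ⁻¹) ^ n := by positivity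
      linarith
    · have : (τ⁻¹) ^ ((n : ℝ) / 2) ≤ (τ⁻¹) ^ (n : ℝ) :=
        Real.rpow_le_rpow_of_exponent_le h (by
          have : (0 : ℝ) ≤ n := Nat.cast_nonneg n
          linarith)
      rw [Real.rpow_natCast] at this
      linarith
  have hy : 0 ≤ q / 2 * τ⁻¹ := by positivity
  have h2 := Real.pow_div_factorial_le_exp (q / 2 * τ⁻¹) hy n
  have hexp : Real.exp (-(q / 2 * τ⁻¹)) ≤ 1 := Real.exp_le_one_iff.2 (by linarith)
  have h3 : (τ⁻¹) ^ n * Real.exp (-(q / 2 * τ⁻¹)) ≤ n ! / (q / 2) ^ n := by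
    rw [Real.exp_neg, ← div_eq_mul_inv, div_le_div_iff₀ (Real.exp_pos _) (by positivity)]
    rw [div_le_iff₀ (by positivity), mul_pow] at h2
    linarith
  calc _ ≤ (1 + (τ⁻¹) ^ n) * Real.exp (-(q / 2 * τ⁻¹)) :=
        mul_le_mul_of_nonneg_right h1 (Real.exp_pos _).le
    _ ≤ _ := by rw [add_mul, one_mul]; exact add_le_add hexp h3

variable {ν : Measure ℝ} [IsProbabilityMeasure ν]

lemma integrable_scaledGaussDensity_right {M : Matrix (Fin n) (Fin n) ℝ} (hM : M.PosDef)
    (hν : ∀ᵐ τ ∂ν, 0 < τ) {x : Fin n → ℝ} (hx : x ≠ 0) :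
    Integrable (scaledGaussDensity M x) ν := by
  obtain ⟨C, hC⟩ := exists_scaledGaussDensity_le hM hx
  refine Integrable.of_bound
    ((measurable_scaledGaussDensity M).comp measurable_prodMk_left).aestronglyMeasurable C ?_
  filter_upwards [hν] with τ hτ
  rw [Real.norm_of_nonneg (scaledGaussDensity_nonneg hM x hτ)]
  exact hC τ hτ

/-- For ν-almost every τ the section in x is a probability density, so the double integral is the
mass of ν. This justifies Fubini even though the mixture may diverge at x = 0. -/
lemma integrable_scaledGaussDensity_prod {M : Matrix (Fin n) (Fin n) ℝ} (hM : M.PosDef)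
    (hν : ∀ᵐ τ ∂ν, 0 < τ) :
    Integrable (fun q : (Fin n → ℝ) × ℝ => scaledGaussDensity M q.1 q.2) (volume.prod ν) := by
  rw [integrable_prod_iff' (measurable_scaledGaussDensity M).aestronglyMeasurable]
  constructor
  · filter_upwards [hν] with τ hτ using (integral_scaledGaussDensity hM hτ).1
  · refine (integrable_const (1 : ℝ)).congr ?_
    filter_upwards [hν] with τ hτ
    rw [← (integral_scaledGaussDensity hM hτ).2]
    refine integral_congr_ae (Eventually.of_forall fun x => ?_)
    simp only [Real.norm_of_nonneg (scaledGaussDensity_nonneg hM x hτ)]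

/-- A random vector whose characteristic function is `lam ↦ ∫ e^{-(lam, M lam) τ / 2} dν(τ)` has the
corresponding mixture of Gaussian densities as its density. -/
lemma map_eq_withDensity_gaussian_mixture {Ω : Type*} [MeasurableSpace Ω] {P : Measure Ω}
    [IsProbabilityMeasure P] {M : Matrix (Fin n) (Fin n) ℝ} (hM : M.PosDef)
    (hν : ∀ᵐ τ ∂ν, 0 < τ) {Y : Ω → Fin n → ℝ} (hY : AEMeasurable Y P)
    (h : ∀ lam : Fin n → ℝ, ∫ ω, Complex.exp (Complex.I * ((lam ⬝ᵥ Y ω : ℝ) : ℂ)) ∂P =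
      ((∫ τ, Real.exp (-((lam ⬝ᵥ M *ᵥ lam) / 2 * τ)) ∂ν : ℝ) : ℂ)) :
    P.map Y = (volume : Measure (Fin n → ℝ)).withDensity
      (fun x => ENNReal.ofReal (∫ τ, scaledGaussDensity M x τ ∂ν)) := by
  have hI := integrable_scaledGaussDensity_prod hM hν
  set g : (Fin n → ℝ) → ℝ := fun x => ∫ τ, scaledGaussDensity M x τ ∂ν with hg
  have hgm : Measurable g :=
    (measurable_scaledGaussDensity M).stronglyMeasurable.integral_prod_right.measurable
  have hg0 : ∀ x, 0 ≤ g x := fun x => integral_nonneg_of_ae (by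
    filter_upwards [hν] with τ hτ using scaledGaussDensity_nonneg hM x hτ)
  have hgi : Integrable g := hI.integral_prod_left
  have := Measure.isProbabilityMeasure_map hY
  have : IsFiniteMeasure ((volume : Measure (Fin n → ℝ)).withDensity
      (fun x => ENNReal.ofReal (g x))) := isFiniteMeasure_withDensity_ofReal hgi.2
  refine Measure.ext_of_charFunDual (funext fun L => ?_)
  set lam : Fin n → ℝ := fun i => L (Pi.single i 1) with hlam
  have hL : ∀ x : Fin n → ℝ, L x = lam ⬝ᵥ x := by
    intro x
    conv_lhs => rw [pi_eq_sum_univ' x]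
    rw [map_sum]
    refine Finset.sum_congr rfl fun i _ => ?_
    rw [map_smul, smul_eq_mul, mul_comm]
  rw [charFunDual_apply, charFunDual_apply,
    integral_map hY (Continuous.aestronglyMeasurable (by fun_prop)),
    integral_withDensity_eq_integral_toReal_smul hgm.ennreal_ofReal
      (Eventually.of_forall fun _ => ENNReal.ofReal_lt_top)]
  simp only [hL, ENNReal.toReal_ofReal (hg0 _)]
  have e1 : ∀ y : Fin n → ℝ, Complex.exp (((lam ⬝ᵥ y : ℝ) : ℂ) * Complex.I) =
      Complex.exp (Complex.I * ((lam ⬝ᵥ y : ℝ) : ℂ)) := fun y => by rw [mul_comm]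
  simp only [e1]
  rw [h]
  have e2 : ∀ x, g x • Complex.exp (Complex.I * ((lam ⬝ᵥ x : ℝ) : ℂ)) =
      ∫ τ, Complex.exp (Complex.I * ((lam ⬝ᵥ x : ℝ) : ℂ)) * (scaledGaussDensity M x τ : ℂ) ∂ν := by
    intro x
    rw [integral_const_mul, integral_complex_ofReal, Complex.real_smul, mul_comm]
  simp only [e2]
  rw [integral_integral_swap, ← integral_complex_ofReal]
  · refine integral_congr_ae ?_
    filter_upwards [hν] with τ hτ
    rw [integral_cexp_mul_scaledGaussDensity hM lam hτ]
  · refine hI.norm.mono' (Measurable.aestronglyMeasurable ?_) (Eventually.of_forall fun q => ?_)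
    · have h1 : Measurable fun q : (Fin n → ℝ) × ℝ => (lam ⬝ᵥ q.1 : ℝ) := by
        unfold dotProduct; fun_prop
      exact ((Complex.measurable_ofReal.comp h1).const_mul _).cexp.mul
        (Complex.measurable_ofReal.comp (measurable_scaledGaussDensity M))
    · simp only [Function.uncurry]
      rw [norm_mul, mul_comm Complex.I, Complex.norm_exp_ofReal_mul_I, one_mul, Complex.norm_real]

end GaussianDensity

/-! ### The generalized Fox-H process -/

section FoxHProcess

variable {m p : ℕ} {a α : Fin p → ℝ} {b β : Fin m → ℝ} {μ : Measure RealTempered} {H : ℝ}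
  {X : ℝ → RealTempered → ℝ}

/-- Existence of the L²-limit rules out the default value of `l2Pairing`, and a.e. equality replaces
the fractional operator by the explicit kernel. -/
lemma IsFoxHProcess.isL2Pairing (hA : FoxHAssumption a α b β) (hμ : IsFoxHMeasure a α b β μ)
    (hH0 : 0 < H) (hH1 : H < 1) (hX : IsFoxHProcess μ H X) {t : ℝ} (ht : 0 ≤ t) :
    IsL2Pairing μ (mvnKernel H t) (X t) := by
  have hae := fracOpMinus_indicator hH0 ht
  have hf := (memLp_congr_ae hae).2 (memLp_mvnKernel hH0 hH1 t)
  obtain ⟨h1, ξ, h2, h3⟩ := (isL2Pairing_l2Pairing hA hμ hf).congr_ae (hX t ht)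
  refine ⟨h1, ξ, h2.congr fun k => eLpNorm_congr_ae ?_, h3⟩
  filter_upwards [hae] with x hx
  rw [hx]

lemma IsFoxHProcess.charFun (hA : FoxHAssumption a α b β) (hμ : IsFoxHMeasure a α b β μ)
    (hH0 : 0 < H) (hH1 : H < 1) (hX : IsFoxHProcess μ H X) {n : ℕ} {t : Fin n → ℝ}
    (ht : ∀ i, 0 < t i) (lam : Fin n → ℝ) :
    ∫ ω, Complex.exp (Complex.I * ((lam ⬝ᵥ fun i => X (t i) ω : ℝ) : ℂ)) ∂μ =
      ((∫ τ, Real.exp (-((lam ⬝ᵥ fbmCov H t *ᵥ lam) / 2 * τ)) ∂mixingMeasure a α b β : ℝ) : ℂ) := by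
  have hf := fun i => memLp_mvnKernel hH0 hH1 (t i)
  have h := IsL2Pairing.sum Finset.univ lam hf fun i => hX.isL2Pairing hA hμ hH0 hH1 (ht i).le
  have hc := h.charFun hA hμ (memLp_finsetSum' _ fun i _ => (hf i).const_smul _)
  simp only [Finset.sum_apply, Pi.smul_apply, smul_eq_mul,
    integral_sum_mvnKernel_sq hH0 hH1] at hc
  exact hc

lemma fbmDensity_eq_gaussDensity {n : ℕ} (t : Fin n → ℝ) :
    fbmDensity H t = gaussDensity (fbmCov H t) := rfl

lemma mixtureIntegrand_eq {n : ℕ} (hA : FoxHAssumption a α b β) (t x : Fin n → ℝ) :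
    mixtureIntegrand a α b β H t x = fun τ => normConst a α b β *
      ((foxHReal a α b β τ / normConst a α b β) • scaledGaussDensity (fbmCov H t) x τ) := by
  ext τ
  have := (normConst_pos hA).ne'
  rw [mixtureIntegrand, fbmDensity_eq_gaussDensity, scaledGaussDensity, smul_eq_mul]
  field_simp

lemma IsFoxHProcess.density (hA : FoxHAssumption a α b β) (hμ : IsFoxHMeasure a α b β μ)
    (hH0 : 0 < H) (hH1 : H < 1) (hX : IsFoxHProcess μ H X) {n : ℕ} {t : Fin n → ℝ}
    (ht : ∀ i, 0 < t i) (hmono : StrictMono t) :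
    AEMeasurable (fun ω i => X (t i) ω) μ ∧
      (∀ x : Fin n → ℝ, x ≠ 0 → IntegrableOn (mixtureIntegrand a α b β H t x) (Ioi 0)) ∧
      μ.map (fun ω i => X (t i) ω) =
        (volume : Measure (Fin n → ℝ)).withDensity (fun x => ENNReal.ofReal
          (1 / normConst a α b β * ∫ τ in Ioi (0 : ℝ), mixtureIntegrand a α b β H t x τ)) := by
  have := hμ.isProbabilityMeasure
  have := isProbabilityMeasure_mixingMeasure hA
  have hM := posDef_fbmCov hH0 hH1 ht hmono
  have hmeas : AEMeasurable (fun ω i => X (t i) ω) μ :=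
    aemeasurable_pi_lambda _ fun i =>
      (hX.isL2Pairing hA hμ hH0 hH1 (ht i).le).1.1.aemeasurable
  refine ⟨hmeas, fun x hx => ?_, ?_⟩
  · rw [mixtureIntegrand_eq hA]
    exact ((integrable_mixingMeasure_iff hA).1
      (integrable_scaledGaussDensity_right hM ae_mixingMeasure_pos hx)).const_mul _
  · rw [map_eq_withDensity_gaussian_mixture hM ae_mixingMeasure_pos hmeas
      fun lam => hX.charFun hA hμ hH0 hH1 ht lam]
    congr 1
    ext x
    rw [mixtureIntegrand_eq hA, integral_const_mul, ← integral_mixingMeasure hA, ← mul_assoc,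
      one_div_mul_cancel (normConst_pos hA).ne', one_mul]

lemma IsL2Pairing.moments (hA : FoxHAssumption a α b β) (hμ : IsFoxHMeasure a α b β μ)
    {f : ℝ → ℝ} (hf : MemLp f 2 volume) {Y : RealTempered → ℝ} (h : IsL2Pairing μ f Y) :
    (∀ k : ℕ, Integrable (fun ω => Y ω ^ k) μ) ∧
      ∀ n : ℕ, ∫ ω, Y ω ^ (2 * n + 1) ∂μ = 0 ∧ ∫ ω, Y ω ^ (2 * n) ∂μ =
        gammaRatio a α b β n / normConst a α b β * (∫ x, f x ^ 2) ^ n *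
          (((2 * n)! : ℝ) / ((n ! : ℝ) * 2 ^ n)) := by
  have := hμ.isProbabilityMeasure
  have := isProbabilityMeasure_mixingMeasure hA
  have hi := integrable_pow_mixingMeasure hA
  have hv : 0 ≤ ∫ x, f x ^ 2 := integral_nonneg fun x => sq_nonneg _
  have hm := h.1.1.aemeasurable
  have hc := h.charFun_mul hA hμ hf
  refine ⟨fun k => (moments_of_gaussian_mixture ae_mixingMeasure_pos hi hm hv hc k).1,
    fun n => ⟨odd_moment_of_gaussian_mixture ae_mixingMeasure_pos hi hm hv hc n, ?_⟩⟩
  rw [even_moment_of_gaussian_mixture ae_mixingMeasure_pos hi hm hv hc n,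
    integral_pow_mixingMeasure hA]

lemma IsL2Pairing.integral_sq (hA : FoxHAssumption a α b β) (hμ : IsFoxHMeasure a α b β μ)
    {f : ℝ → ℝ} (hf : MemLp f 2 volume) {Y : RealTempered → ℝ} (h : IsL2Pairing μ f Y) :
    ∫ ω, Y ω ^ 2 ∂μ = gammaRatio a α b β 1 / normConst a α b β * ∫ x, f x ^ 2 := by
  have := ((h.moments hA hμ hf).2 1).2
  norm_num at this
  exact this

lemma IsFoxHProcess.moments (hA : FoxHAssumption a α b β) (hμ : IsFoxHMeasure a α b β μ)
    (hH0 : 0 < H) (hH1 : H < 1) (hX : IsFoxHProcess μ H X) {t : ℝ} (ht : 0 ≤ t) :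
    (∀ k : ℕ, Integrable (fun ω => X t ω ^ k) μ) ∧
      ∀ n : ℕ, ∫ ω, X t ω ^ (2 * n + 1) ∂μ = 0 ∧
        ∫ ω, X t ω ^ (2 * n) ∂μ =
          1 / normConst a α b β * gammaRatio a α b β n *
            (((2 * n)! : ℝ) / ((n ! : ℝ) * 2 ^ n)) * t ^ (2 * (n : ℝ) * H) := by
  obtain ⟨h1, h2⟩ :=
    (hX.isL2Pairing hA hμ hH0 hH1 ht).moments hA hμ (memLp_mvnKernel hH0 hH1 t)
  refine ⟨h1, fun n => ⟨(h2 n).1, ?_⟩⟩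
  rw [(h2 n).2, integral_mvnKernel_sq hH0 hH1, abs_of_nonneg ht, ← Real.rpow_mul_natCast ht,
    show 2 * H * (n : ℝ) = 2 * n * H by ring]
  ring

/-- Polarization: X_t - X_s is the pairing with the difference of kernels, so all three squares have
known second moments, with common factor the mean of ν. -/
lemma IsFoxHProcess.covariance (hA : FoxHAssumption a α b β) (hμ : IsFoxHMeasure a α b β μ)
    (hH0 : 0 < H) (hH1 : H < 1) (hX : IsFoxHProcess μ H X) {t s : ℝ} (ht : 0 ≤ t) (hs : 0 ≤ s) :
    Integrable (fun ω => X t ω * X s ω) μ ∧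
      ∫ ω, X t ω * X s ω ∂μ =
        1 / (2 * normConst a α b β) *
          ((∏ j, Real.Gamma (b j + 2 * β j)) / ∏ i, Real.Gamma (a i + 2 * α i)) *
          (t ^ (2 * H) + s ^ (2 * H) - |t - s| ^ (2 * H)) := by
  have hpt := hX.isL2Pairing hA hμ hH0 hH1 ht
  have hps := hX.isL2Pairing hA hμ hH0 hH1 hs
  have hft := memLp_mvnKernel hH0 hH1 t
  have hfs := memLp_mvnKernel hH0 hH1 s
  have hfd := hfs.const_smul (-1 : ℝ)
  have hpd := hpt.add hft hfd (hps.const_smul (-1))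
  have e0 : ∀ ω, X t ω * X s ω =
      1 / 2 * (X t ω ^ 2 + X s ω ^ 2 - (X t + (-1 : ℝ) • X s) ω ^ 2) := by
    intro ω
    simp only [Pi.add_apply, Pi.smul_apply, smul_eq_mul]
    ring
  have e1 : ∀ x, (mvnKernel H t + (-1 : ℝ) • mvnKernel H s) x ^ 2 =
      (mvnKernel H t x - mvnKernel H s x) ^ 2 := by
    intro x
    simp only [Pi.add_apply, Pi.smul_apply, smul_eq_mul]
    ring
  have e2 : gammaRatio a α b β 1 =
      (∏ j, Real.Gamma (b j + 2 * β j)) / ∏ i, Real.Gamma (a i + 2 * α i) := by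
    have : ∀ x y : ℝ, x + y * (((1 : ℕ) : ℝ) + 1) = x + 2 * y := fun x y => by push_cast; ring
    simp only [gammaRatio, this]
  have hd := hpd.integral_sq hA hμ (hft.add hfd)
  simp only [e1, (mvnKernel_sub_sq hH0 hH1 t s).2] at hd
  refine ⟨hpt.1.integrable_mul hps.1, ?_⟩
  simp only [e0]
  rw [integral_const_mul, integral_sub (hpt.1.integrable_sq.fun_add hps.1.integrable_sq)
    hpd.1.integrable_sq, integral_add hpt.1.integrable_sq hps.1.integrable_sq,
    hpt.integral_sq hA hμ hft, hps.integral_sq hA hμ hfs, hd, integral_mvnKernel_sq hH0 hH1,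
    integral_mvnKernel_sq hH0 hH1, abs_of_nonneg ht, abs_of_nonneg hs, ← e2]
  have := (normConst_pos hA).ne'
  field_simp

end FoxHProcess

end

theorem mainTheorem3 {m p : ℕ} (a α : Fin p → ℝ) (b β : Fin m → ℝ)
    (hA : FoxHAssumption a α b β) (H : ℝ) (hH0 : 0 < H) (hH1 : H < 1)
    (μ : Measure RealTempered) (hμ : IsFoxHMeasure a α b β μ)
    (X : ℝ → RealTempered → ℝ) (hX : IsFoxHProcess μ H X) :
    -- joint characteristic function
    (∀ (n : ℕ) (t : Fin n → ℝ), (∀ i, 0 < t i) → StrictMono t → ∀ lam : Fin n → ℝ,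
      ∫ ω, Complex.exp (Complex.I * ((lam ⬝ᵥ fun i => X (t i) ω : ℝ) : ℂ)) ∂μ =
        1 / (normConst a α b β : ℂ) *
          wrightPsi a α b β ((-(lam ⬝ᵥ fbmCov H t *ᵥ lam) / 2 : ℝ) : ℂ)) ∧
    -- joint density
    (∀ (n : ℕ) (t : Fin n → ℝ), (∀ i, 0 < t i) → StrictMono t →
      AEMeasurable (fun ω i => X (t i) ω) μ ∧
      (∀ x : Fin n → ℝ, x ≠ 0 →
        IntegrableOn (mixtureIntegrand a α b β H t x) (Ioi 0)) ∧
      μ.map (fun ω i => X (t i) ω) =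
        (volume : Measure (Fin n → ℝ)).withDensity (fun x => ENNReal.ofReal
          (1 / normConst a α b β * ∫ τ in Ioi (0 : ℝ), mixtureIntegrand a α b β H t x τ))) ∧
    -- moments
    (∀ t : ℝ, 0 ≤ t →
      (∀ k : ℕ, Integrable (fun ω => X t ω ^ k) μ) ∧
      ∀ n : ℕ, ∫ ω, X t ω ^ (2 * n + 1) ∂μ = 0 ∧
        ∫ ω, X t ω ^ (2 * n) ∂μ =
          1 / normConst a α b β * gammaRatio a α b β n *
            (((2 * n)! : ℝ) / ((n ! : ℝ) * 2 ^ n)) * t ^ (2 * (n : ℝ) * H)) ∧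
    -- covariance
    (∀ t s : ℝ, 0 ≤ t → 0 ≤ s →
      Integrable (fun ω => X t ω * X s ω) μ ∧
      ∫ ω, X t ω * X s ω ∂μ =
        1 / (2 * normConst a α b β) *
          ((∏ j, Real.Gamma (b j + 2 * β j)) / ∏ i, Real.Gamma (a i + 2 * α i)) *
          (t ^ (2 * H) + s ^ (2 * H) - |t - s| ^ (2 * H))) := by
  refine ⟨fun n t ht _ lam => ?_, fun n t ht hmono => hX.density hA hμ hH0 hH1 ht hmono,
    fun t ht => hX.moments hA hμ hH0 hH1 ht, fun t s ht hs => hX.covariance hA hμ hH0 hH1 ht hs⟩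
  -- The Laplace identity needs a nonnegative argument, and a Gram form provides it.
  have hq : 0 ≤ lam ⬝ᵥ fbmCov H t *ᵥ lam := by
    rw [← integral_sum_mvnKernel_sq hH0 hH1]
    exact integral_nonneg fun x => sq_nonneg _
  rw [hX.charFun hA hμ hH0 hH1 ht lam, neg_div,
    wrightPsi_eq_laplace hA (div_nonneg hq two_pos.le)]
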